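/- **Theorem 1.3.** Let $(g_{i,j})_{1\le i,j\le N}$ be i.i.d. standard Gaussians and let $H_N(\sigma)=N^{-1/2}\sum_{i,j=1}^N g_{i,j}\sigma_i\sigma_j$, $\sigma\in\{-1,1\}^N$, be the Sherrington–Kirkpatrick Hamiltonian; identify $H_N$ with $(g_{i,j})\in\mathbb R^{N^2}$. For $\sigma\in\{-1,1\}^N$ let $L_i(\sigma)=\sigma_i\,(H_N(\sigma)-H_N(\sigma\oplus e_i))/2$, where $\sigma\oplus e_i$ is $\sigma$ with its $i$-th coordinate flipped, and let $$S(\gamma,\delta;H_N)=\bigl\{\sigma\in\{-1,1\}^N:\ |\{i:\ \sigma_iL_i(\sigma)<\gamma\}|\le\delta N\bigr\}$$ be the set of $(\gamma,\delta)$-gapped states. A randomized algorithm is a measurable map $\mathcal A^\circ:(H_N,\omega)\mapsto \mathcal A^\circ(H_N,\omega)\in\mathbb R^N$, where $\omega$ is a random element of a Polish space, independent of $H_N$; it is deterministic if it does not depend on $\omega$. Let $U_1,\dots,U_N$ be i.i.d. uniform on $[-1,1]$, independent of $(H_N,\omega)$, and let $\mathcal A(H_N,\omega,\vec U)\in\{-1,1\}^N$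 have $i$-th coordinate $1$ if $\mathcal A^\circ(H_N,\omega)_i\ge U_i$ and $-1$ otherwise. Call $\mathcal A^\circ$ $C$-Lipschitz if for each fixed $\omega$ it is $C$-Lipschitz from $\mathbb R^{N^2}$ to $\mathbb R^N$ in the Euclidean norms, and a degree $D$ polynomial if each of its $N$ coordinates is a polynomial of degree at most $D$ in the $g_{i,j}$. For every $\gamma>0$ there is $\delta>0$ such that for every $C>0$ the following hold. (I) There are $c=c(\gamma,\delta,C)>0$ and $N_0=N_0(\gamma,\delta,C)$ such that for all $N\ge N_0$ and every $C$-Lipschitz randomized algorithm $\mathcal A^\circ$, $$\mathbb P[\mathcal A(H_N,\omega,\vec U)\in S(\gamma,\delta;H_N)]\le e^{-cN}.$$ (II) There are $c,c'>0$ and $N_0$, depending only on $\gamma,\delta,C$, such that for all $N\ge N_0$, all integers $1\le D\le\frac{\log N}{11}$, and every deterministic degree $D$ polynomial $\mathcal A^\circ$ with $\mathbb E\|\mathcal A^\circ(H_N)\|^2\le CN$, $$\mathbb P[\mathcal A(H_N,\vec U)\in S(\gamma,\delta;H_N)]\le \exp\bigl(-c\,D\,N^{1/(3D)}\bigr)\le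 N^{-c'}.$$ (III) There is $c=c(\gamma,\delta,C)>0$ such that for every sequence of integers $D_N\ge1$ with $D_N=o(N)$ there is $N_0$ such that for all $N\ge N_0$ and every deterministic degree $D_N$ polynomial $\mathcal A^\circ$ with $\mathbb E\|\mathcal A^\circ(H_N)\|^2\le CN$, $$\mathbb P[\mathcal A(H_N,\vec U)\in S(\gamma,\delta;H_N)]\le (D_N/N)^{c},$$ and $(D_N/N)^c\to0$ as $N\to\infty$. -/

import Mathlib

open MeasureTheory ProbabilityTheory Filter Topology Asymptotics

noncomputable section

namespace SKModel

/-- The state space `ℝ^(N²)` of disorder coefficients `(g_{i,j})`, with its Euclidean norm. -/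
abbrev Disorder (N : ℕ) : Type := EuclideanSpace ℝ (Fin N × Fin N)

/-- The law of the disorder: the coefficients `g_{i,j}` are i.i.d. standard Gaussians. -/
def disorderLaw (N : ℕ) : Measure (Disorder N) :=
  (Measure.pi fun _ : Fin N × Fin N => gaussianReal 0 1).map (WithLp.toLp 2)

/-- The law of `(U_1, …, U_N)`, i.i.d. uniform on `[-1, 1]`. -/
def roundingLaw (N : ℕ) : Measure (Fin N → ℝ) :=
  Measure.pi fun _ : Fin N => cond volume (Set.Icc (-1 : ℝ) 1)

/-- The Sherrington–Kirkpatrick Hamiltonian with disorder `g`. -/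
def hamiltonian {N : ℕ} (g : Disorder N) (σ : Fin N → ℝ) : ℝ :=
  1 / √(N : ℝ) * ∑ i, ∑ j, g (i, j) * σ i * σ j

/-- The point `σ` with its `i`-th spin flipped. -/
def flipSpin {N : ℕ} (σ : Fin N → ℝ) (i : Fin N) : Fin N → ℝ :=
  Function.update σ i (-σ i)

/-- The `i`-th local field at `σ`. -/
def localField {N : ℕ} (g : Disorder N) (σ : Fin N → ℝ) (i : Fin N) : ℝ :=
  σ i * (hamiltonian g σ - hamiltonian g (flipSpin σ i)) / 2

/-- The set of `(γ, δ)`-gapped states in `{-1, 1}^N` for the Hamiltonian with disorder `g`. -/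
def gappedStates {N : ℕ} (γ δ : ℝ) (g : Disorder N) : Set (Fin N → ℝ) :=
  {σ | (∀ i, σ i = 1 ∨ σ i = -1) ∧
    ({i : Fin N | σ i * localField g σ i < γ}.ncard : ℝ) ≤ δ * N}

/-- Coordinate-wise rounding to `{-1, 1}^N` with thresholds `u`. -/
def roundSpins {N : ℕ} (u : Fin N → ℝ) (x : EuclideanSpace ℝ (Fin N)) : Fin N → ℝ :=
  fun i => if u i ≤ x i then 1 else -1

/-- Success probability of the rounding of the randomized algorithm `A`, where the disorder, the
internal randomness `ω ∼ ν` and the rounding thresholds are independent. -/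
def randomizedSuccess {N : ℕ} {Ω : Type*} [MeasurableSpace Ω] (ν : Measure Ω) (γ δ : ℝ)
    (A : Disorder N → Ω → EuclideanSpace ℝ (Fin N)) : ℝ :=
  ((disorderLaw N).prod (ν.prod (roundingLaw N))).real
    {z | roundSpins z.2.2 (A z.1 z.2.1) ∈ gappedStates γ δ z.1}

/-- Success probability of the rounding of the deterministic algorithm `A`. -/
def deterministicSuccess {N : ℕ} (γ δ : ℝ) (A : Disorder N → EuclideanSpace ℝ (Fin N)) : ℝ :=
  ((disorderLaw N).prod (roundingLaw N)).real
    {z | roundSpins z.2 (A z.1) ∈ gappedStates γ δ z.1}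

/-- Every output coordinate of `A` is a polynomial of degree at most `D` in the disorder. -/
def IsPolynomialOfDegree {N : ℕ} (D : ℕ) (A : Disorder N → EuclideanSpace ℝ (Fin N)) : Prop :=
  ∃ P : Fin N → MvPolynomial (Fin N × Fin N) ℝ,
    ∀ i, (P i).totalDegree ≤ D ∧ ∀ g : Disorder N, A g i = MvPolynomial.eval (fun k => g k) (P i)

/-- The second moment bound `𝔼 ‖A(H_N)‖² ≤ C N`. -/
def SecondMomentBound {N : ℕ} (C : ℝ) (A : Disorder N → EuclideanSpace ℝ (Fin N)) : Prop :=
  ∫ g, ‖A g‖ ^ 2 ∂(disorderLaw N) ≤ C * N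

end SKModel

end

open SKModel

/-! Gapped states of correlated disorders exhibit an overlap gap, and a stable algorithm run along a
slowly changing disorder cannot jump across it. Let `g₀, …, g_K`, with `K = 2 ^ m`, be a stationary
Gaussian chain whose neighbours have correlation `exp (-T / K)`, and let `σ_k` be the rounded output
at `g_k`, with all auxiliary randomness and the rounding thresholds frozen.

Overlap gap. Suppose `σ` is gapped for `g`, `τ` is gapped for a disorder of correlation `q` with
`g`, and they differ on a set `I` of size between `ρN/2` and `ρN`. On most of `I` the field of `σ`
is aligned with `σ` by at least `γ`, while the field of `τ` is aligned with `τ = -σ`. Hence either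
the interactions inside `I` contribute order `γρN`, though their variance is only of order `ρ²N`, or
the innovation contributes order `γρN`, though its variance is of order `(1 - q²)ρN`. The first
event has probability `exp (-cγ²N)`, the second `exp (-cγ²ρN / (1 - q²))`. Since `σ` is a function
of `g`, a union over few small sets of sites suffices, of entropy of order `ρ log (1/ρ) N`. Both
bounds win when `ρ` is small and `1 - q²` is at most of order `γ² / log (1/ρ)`
(`gapped_pair_dichotomy`, `ouPair_gapped_annulus_le`).

Chaining. Cut the chain into windows over which `1 - q²` is that small. A path of gapped states with
short steps moves at most `ρN/2` per window, so over the whole chain it moves of order `(T/γ²) ρ log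
(1/ρ) N`, still a small fraction of `N`. But `g_K` is almost independent of `g₀`, and a
configuration near `σ₀` is then unlikely to be gapped for `g_K` (`ouPair_gapped_close_le`). So a
path that is gapped throughout and has short steps is exponentially unlikely. Conversely, by
reversibility it has probability at least the `K`-th power of the corresponding one-edge
probability, a Blakley–Roy inequality (`ouPair_pow_le_pathLaw`). Also, both ends of an edge are
gapped with probability at least `P(gapped)²` (`sq_measure_le_ouPair`). Therefore `P(gapped)²` is at
most the probability of one long step plus `10 exp (-cN/K)` (`exists_success_sq_le`).

Stability. A Chernoff bound over the thresholds reduces a long step to `‖A g - A g'‖ > ρ√N`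
(`exists_rounded_success_sq_le`). For Lipschitz `A`, a Gaussian exponential moment along the arc
joining the two inputs makes this exponentially unlikely at a fixed `K`
(`LipschitzWith.ouPair_norm_sub_gt_le`). For degree `D` polynomials the increment has second moment
at most `2 (1 - q ^ D) E‖A‖²` (`pow_mul_le_polyCorr`), and hypercontractivity, proved by adding
random signs one at a time and passing to the Gaussian limit, raises this to higher moments.
Optimising `K` and the moment gives the two polynomial bounds. -/

open scoped ENNReal NNReal RealInnerProductSpace

/-! ### Rotation invariance and tails of Gaussian vectors -/

section GaussianBasics

variable {E : Type*} [NormedAddCommGroup E] [InnerProductSpace ℝ E] [FiniteDimensional ℝ E]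
  [MeasurableSpace E] [BorelSpace E]

/-- Rotation invariance of the product of two standard Gaussian measures. -/
theorem stdGaussian_prod_map_reflection {c s : ℝ} (h : c ^ 2 + s ^ 2 = 1) :
    ((stdGaussian E).prod (stdGaussian E)).map
      (fun p : E × E => (c • p.1 + s • p.2, s • p.1 - c • p.2)) =
      (stdGaussian E).prod (stdGaussian E) := by
  let R : E × E →L[ℝ] E × E :=
    (c • ContinuousLinearMap.fst ℝ E E + s • ContinuousLinearMap.snd ℝ E E).prod
      (s • ContinuousLinearMap.fst ℝ E E - c • ContinuousLinearMap.snd ℝ E E)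
  have hR : (fun p : E × E => (c • p.1 + s • p.2, s • p.1 - c • p.2)) = R := by
    ext p <;> simp [R]
  rw [hR]
  apply Measure.ext_of_charFunDual
  ext L
  rw [charFunDual_map, charFunDual_prod, charFunDual_prod]
  simp only [charFunDual_stdGaussian]
  set a := L.comp (ContinuousLinearMap.inl ℝ E E) with ha
  set b := L.comp (ContinuousLinearMap.inr ℝ E E) with hb
  have e1 : (L.comp R).comp (ContinuousLinearMap.inl ℝ E E) = c • a + s • b := by
    ext x
    simp only [ha, hb, R, ContinuousLinearMap.comp_apply, ContinuousLinearMap.inl_apply,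
      ContinuousLinearMap.inr_apply, ContinuousLinearMap.prod_apply,
      add_apply, smul_apply, sub_apply,
      ContinuousLinearMap.coe_fst', ContinuousLinearMap.coe_snd']
    rw [← map_smul, ← map_smul, ← map_add]
    simp
  have e2 : (L.comp R).comp (ContinuousLinearMap.inr ℝ E E) = s • a - c • b := by
    ext x
    simp only [ha, hb, R, ContinuousLinearMap.comp_apply, ContinuousLinearMap.inl_apply,
      ContinuousLinearMap.inr_apply, ContinuousLinearMap.prod_apply,
      add_apply, smul_apply, sub_apply,
      ContinuousLinearMap.coe_fst', ContinuousLinearMap.coe_snd']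
    rw [← map_smul, ← map_smul, ← map_sub]
    simp
  rw [e1, e2, ← Complex.exp_add, ← Complex.exp_add]
  congr 1
  have key : ‖c • a + s • b‖ ^ 2 + ‖s • a - c • b‖ ^ 2 = ‖a‖ ^ 2 + ‖b‖ ^ 2 := by
    have h1 := norm_add_sq_real (c • (InnerProductSpace.toDual ℝ E).symm a)
      (s • (InnerProductSpace.toDual ℝ E).symm b)
    have h2 := norm_sub_sq_real (s • (InnerProductSpace.toDual ℝ E).symm a)
      (c • (InnerProductSpace.toDual ℝ E).symm b)
    simp only [← map_smul, ← map_add, ← map_sub, LinearIsometryEquiv.norm_map] at h1 h2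
    simp only [map_smul, real_inner_smul_left, real_inner_smul_right, norm_smul, mul_pow,
      Real.norm_eq_abs, sq_abs] at h1 h2
    rw [h1, h2]
    linear_combination (‖a‖ ^ 2 + ‖b‖ ^ 2) * h
  have key' : (‖c • a + s • b‖ : ℂ) ^ 2 + (‖s • a - c • b‖ : ℂ) ^ 2 =
      (‖a‖ : ℂ) ^ 2 + (‖b‖ : ℂ) ^ 2 := by exact_mod_cast key
  linear_combination (-1 / 2 : ℂ) * key'

theorem stdGaussian_prod_map_combination {c s : ℝ} (h : c ^ 2 + s ^ 2 = 1) :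
    ((stdGaussian E).prod (stdGaussian E)).map (fun p : E × E => c • p.1 + s • p.2) =
      stdGaussian E := by
  have h1 := congrArg (fun μ => Measure.map Prod.fst μ)
    (stdGaussian_prod_map_reflection (E := E) h)
  rw [Measure.map_map (by fun_prop) (by fun_prop)] at h1
  rw [Measure.map_fst_prod] at h1
  simpa [Function.comp_def] using h1

theorem map_inner_stdGaussian (a : E) :
    (stdGaussian E).map (fun x => ⟪a, x⟫) = gaussianReal 0 (‖a‖₊ ^ 2) := by
  have := (isGaussian_stdGaussian (E := E)).map_eq_gaussianReal (innerSL ℝ a)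
  simp only [integral_strongDual_stdGaussian, variance_dual_stdGaussian] at this
  have h2 : ⇑(innerSL ℝ a) = fun x => ⟪a, x⟫ := by ext x; simp
  rw [h2] at this
  rw [this]
  congr 1
  ext
  simp

theorem integral_exp_inner_stdGaussian (a : E) (t : ℝ) :
    mgf (fun x => ⟪a, x⟫) (stdGaussian E) t = Real.exp (‖a‖ ^ 2 * t ^ 2 / 2) := by
  rw [mgf_gaussianReal (map_inner_stdGaussian a)]
  simp

/-- Chernoff's bound at the tilt `t / v`, optimal for variance `v`. Allowing any upper bound `v` of
`‖a‖ ^ 2` gives one exponent for a whole family of vectors, `a = 0` included. -/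
theorem stdGaussian_inner_ge_le (a : E) {t v : ℝ} (ht : 0 ≤ t) (hv : 0 < v) (hav : ‖a‖ ^ 2 ≤ v) :
    (stdGaussian E).real {x | t ≤ ⟪a, x⟫} ≤ Real.exp (-(t ^ 2 / (2 * v))) := by
  have hint : Integrable (fun x => Real.exp (t / v * ⟪a, x⟫)) (stdGaussian E) := by
    have : Integrable (fun y => Real.exp (t / v * y))
        ((stdGaussian E).map (fun x => ⟪a, x⟫)) := by
      rw [map_inner_stdGaussian]; exact integrable_exp_mul_gaussianReal _
    exact this.comp_measurable (by fun_prop)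
  refine (measure_ge_le_exp_mul_mgf t (div_nonneg ht hv.le) hint).trans ?_
  rw [integral_exp_inner_stdGaussian, ← Real.exp_add]
  apply Real.exp_le_exp.2
  have : ‖a‖ ^ 2 * (t / v) ^ 2 / 2 ≤ v * (t / v) ^ 2 / 2 := by gcongr
  have e : -(t / v) * t + v * (t / v) ^ 2 / 2 = -(t ^ 2 / (2 * v)) := by field_simp; ring
  linarith

end GaussianBasics

theorem disorderLaw_eq_stdGaussian (N : ℕ) : disorderLaw N = stdGaussian (Disorder N) :=
  map_pi_eq_stdGaussian

/-! ### The reversible Gaussian chain and its transfer operators -/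

section OrnsteinUhlenbeck

variable {E : Type*} [NormedAddCommGroup E] [InnerProductSpace ℝ E] [FiniteDimensional ℝ E]
  [MeasurableSpace E] [BorelSpace E]

/-- One step of the stationary Gaussian chain with correlation `q`, driven by the noise `y`. -/
noncomputable def ouStep (q : ℝ) (x y : E) : E := q • x + √(1 - q ^ 2) • y

@[fun_prop]
theorem measurable_ouStep {α : Type*} [MeasurableSpace α] (q : ℝ) {f g : α → E}
    (hf : Measurable f) (hg : Measurable g) : Measurable (fun a => ouStep q (f a) (g a)) := by
  unfold ouStep; fun_prop

variable (E) in
/-- The law of a pair of standard Gaussian vectors with correlation `q`. -/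
noncomputable def ouPair (q : ℝ) : Measure (E × E) :=
  ((stdGaussian E).prod (stdGaussian E)).map (fun p => (p.1, ouStep q p.1 p.2))

instance isProbabilityMeasure_ouPair (q : ℝ) : IsProbabilityMeasure (ouPair E q) :=
  Measure.isProbabilityMeasure_map (by fun_prop)

theorem one_sub_sq_nonneg {q : ℝ} (h0 : 0 ≤ q) (h1 : q ≤ 1) : 0 ≤ 1 - q ^ 2 := by nlinarith

theorem sq_add_sq_sqrt_one_sub {q : ℝ} (h0 : 0 ≤ q) (h1 : q ≤ 1) :
    q ^ 2 + √(1 - q ^ 2) ^ 2 = 1 := by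
  rw [Real.sq_sqrt (one_sub_sq_nonneg h0 h1)]; ring

/-- With `s = √(1 - q ^ 2)`, the reflection `(x, y) ↦ (q x + s y, s x - q y)` is an involution
preserving the Gaussian product, and its first component is the chain step. It therefore exchanges
the two ends of a step. This reversibility underlies the self-adjointness of the transfer operators.
-/
theorem ouPair_map_swap {q : ℝ} (h0 : 0 ≤ q) (h1 : q ≤ 1) :
    (ouPair E q).map Prod.swap = ouPair E q := by
  have h := sq_add_sq_sqrt_one_sub h0 h1
  conv_rhs => rw [ouPair, ← stdGaussian_prod_map_reflection (E := E) h]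
  rw [ouPair, Measure.map_map (by fun_prop) (by fun_prop),
    Measure.map_map (by fun_prop) (by fun_prop)]
  congr 1
  ext p
  · simp [ouStep]
  · simp only [Function.comp_apply, Prod.swap_prod_mk, ouStep, smul_add, smul_sub, smul_smul]
    have : p.1 = (q ^ 2 + √(1 - q ^ 2) ^ 2) • p.1 := by rw [h, one_smul]
    nth_rw 1 [this]
    module

theorem lintegral_ouPair_comm {q : ℝ} (h0 : 0 ≤ q) (h1 : q ≤ 1) {f : E × E → ℝ≥0∞}
    (hf : Measurable f) : ∫⁻ p, f p.swap ∂(ouPair E q) = ∫⁻ p, f p ∂(ouPair E q) := by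
  conv_rhs => rw [← ouPair_map_swap h0 h1, lintegral_map hf (by fun_prop)]

theorem lintegral_ouPair (q : ℝ) {f : E × E → ℝ≥0∞} (hf : Measurable f) :
    ∫⁻ p, f p ∂(ouPair E q) =
      ∫⁻ x, ∫⁻ y, f (x, ouStep q x y) ∂(stdGaussian E) ∂(stdGaussian E) := by
  rw [ouPair, lintegral_map hf (by fun_prop), lintegral_prod _ (by fun_prop)]

theorem ouPair_map_fst (q : ℝ) : (ouPair E q).map Prod.fst = stdGaussian E := by
  rw [ouPair, Measure.map_map (by fun_prop) (by fun_prop)]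
  change Measure.map Prod.fst _ = _
  rw [Measure.map_fst_prod]; simp

theorem ouPair_map_snd {q : ℝ} (h0 : 0 ≤ q) (h1 : q ≤ 1) :
    (ouPair E q).map Prod.snd = stdGaussian E := by
  rw [← ouPair_map_swap h0 h1, Measure.map_map (by fun_prop) (by fun_prop)]
  exact ouPair_map_fst q

theorem stdGaussian_prod_map_add_smul (α β : ℝ) :
    ((stdGaussian E).prod (stdGaussian E)).map (fun p : E × E => α • p.1 + β • p.2) =
      (stdGaussian E).map (fun y => √(α ^ 2 + β ^ 2) • y) := by
  rcases eq_or_ne (α ^ 2 + β ^ 2) 0 with h | h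
  · have hα : α = 0 := by nlinarith [sq_nonneg α, sq_nonneg β]
    have hβ : β = 0 := by nlinarith [sq_nonneg α, sq_nonneg β]
    simp [hα, hβ, Measure.map_const]
  · have hpos : 0 < α ^ 2 + β ^ 2 := lt_of_le_of_ne (by positivity) h.symm
    set r := √(α ^ 2 + β ^ 2) with hr
    have hr0 : 0 < r := Real.sqrt_pos.2 hpos
    have hr2 : r ^ 2 = α ^ 2 + β ^ 2 := Real.sq_sqrt hpos.le
    have := stdGaussian_prod_map_combination (E := E) (c := α / r) (s := β / r) (by
      rw [div_pow, div_pow, ← add_div, hr2]; exact div_self h)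
    conv_rhs => rw [← this]
    rw [Measure.map_map (by fun_prop) (by fun_prop)]
    congr 1
    ext p
    simp only [Function.comp_apply, smul_add, smul_smul]
    rw [mul_div_cancel₀ _ hr0.ne', mul_div_cancel₀ _ hr0.ne']

/-- The innovations of two successive steps are independent and merge into one Gaussian of variance
`b² (1 - a²) + (1 - b²) = 1 - (ab)²`, so correlations multiply. -/
theorem ouPair_comp {a b : ℝ} (ha0 : 0 ≤ a) (ha1 : a ≤ 1) (hb0 : 0 ≤ b) (hb1 : b ≤ 1) :
    ((ouPair E a).prod (stdGaussian E)).map (fun p => (p.1.1, ouStep b p.1.2 p.2)) =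
      ouPair E (a * b) := by
  apply Measure.ext_of_lintegral
  intro f hf
  rw [lintegral_map hf (by fun_prop), lintegral_prod _ (by fun_prop), lintegral_ouPair _ hf]
  have hm : Measurable fun p : E × E => ∫⁻ y, f (p.1, ouStep b p.2 y) ∂(stdGaussian E) :=
    Measurable.lintegral_prod_right' (f := fun p : (E × E) × E => f (p.1.1, ouStep b p.1.2 p.2))
      (by fun_prop)
  rw [lintegral_ouPair _ hm]
  refine lintegral_congr fun x => ?_
  have h1 : ∫⁻ y, ∫⁻ z, f (x, ouStep b (ouStep a x y) z) ∂(stdGaussian E) ∂(stdGaussian E) =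
      ∫⁻ w, f (x, (a * b) • x + w) ∂(((stdGaussian E).prod (stdGaussian E)).map
        (fun p : E × E => (b * √(1 - a ^ 2)) • p.1 + √(1 - b ^ 2) • p.2)) := by
    rw [lintegral_map (by fun_prop) (by fun_prop), lintegral_prod _ (by fun_prop)]
    refine lintegral_congr fun y => lintegral_congr fun z => ?_
    congr 2
    simp only [ouStep]
    module
  rw [h1, stdGaussian_prod_map_add_smul, lintegral_map (by fun_prop) (by fun_prop)]
  have h2 : (b * √(1 - a ^ 2)) ^ 2 + √(1 - b ^ 2) ^ 2 = 1 - (a * b) ^ 2 := by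
    rw [mul_pow, Real.sq_sqrt (one_sub_sq_nonneg ha0 ha1),
      Real.sq_sqrt (one_sub_sq_nonneg hb0 hb1)]
    ring
  simp only [h2, ouStep]

theorem sq_lintegral_le_lintegral_sq {α : Type*} [MeasurableSpace α] {μ : Measure α}
    [IsProbabilityMeasure μ] {f : α → ℝ≥0∞} (hf : Measurable f) :
    (∫⁻ x, f x ∂μ) ^ 2 ≤ ∫⁻ x, f x * f x ∂μ := by
  have h := ENNReal.lintegral_mul_le_Lp_mul_Lq μ (p := 2) (q := 2)
    (by constructor <;> norm_num) hf.aemeasurable (aemeasurable_const (b := (1 : ℝ≥0∞)))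
  simp only [Pi.mul_apply, mul_one, ENNReal.one_rpow, lintegral_const, measure_univ] at h
  calc (∫⁻ x, f x ∂μ) ^ 2 ≤ ((∫⁻ x, f x ^ (2 : ℝ) ∂μ) ^ (1 / 2 : ℝ)) ^ 2 := by gcongr
    _ = ∫⁻ x, f x * f x ∂μ := by
      rw [← ENNReal.rpow_natCast, ← ENNReal.rpow_mul]
      norm_num
      refine lintegral_congr fun x => by rw [sq]

/-- The transfer operator of the chain with multiplicative edge weight `w`. -/
noncomputable def edgeOp (q : ℝ) (w : E × E → ℝ≥0∞) (f : E → ℝ≥0∞) (x : E) : ℝ≥0∞ :=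
  ∫⁻ y, w (x, ouStep q x y) * f (ouStep q x y) ∂(stdGaussian E)

theorem measurable_edgeOp {q : ℝ} {w : E × E → ℝ≥0∞} {f : E → ℝ≥0∞} (hw : Measurable w)
    (hf : Measurable f) : Measurable (edgeOp q w f) :=
  Measurable.lintegral_prod_right'
    (f := fun p : E × E => w (p.1, ouStep q p.1 p.2) * f (ouStep q p.1 p.2)) (by fun_prop)

theorem measurable_edgeOp_iterate {q : ℝ} {w : E × E → ℝ≥0∞} {f : E → ℝ≥0∞} (hw : Measurable w)
    (hf : Measurable f) (n : ℕ) : Measurable ((edgeOp q w)^[n] f) := by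
  induction n with
  | zero => exact hf
  | succ n ih => rw [Function.iterate_succ_apply']; exact measurable_edgeOp hw ih

theorem lintegral_mul_edgeOp {q : ℝ} {w : E × E → ℝ≥0∞} {f g : E → ℝ≥0∞} (hw : Measurable w)
    (hf : Measurable f) (hg : Measurable g) :
    ∫⁻ x, g x * edgeOp q w f x ∂(stdGaussian E) =
      ∫⁻ p, g p.1 * (w p * f p.2) ∂(ouPair E q) := by
  rw [lintegral_ouPair _ (by fun_prop)]
  refine lintegral_congr fun x => ?_
  rw [edgeOp, ← lintegral_const_mul _ (by fun_prop)]

theorem edgeOp_symm {q : ℝ} (h0 : 0 ≤ q) (h1 : q ≤ 1) {w : E × E → ℝ≥0∞} {f g : E → ℝ≥0∞}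
    (hw : Measurable w) (hsymm : ∀ p, w p.swap = w p) (hf : Measurable f) (hg : Measurable g) :
    ∫⁻ x, g x * edgeOp q w f x ∂(stdGaussian E) = ∫⁻ x, edgeOp q w g x * f x ∂(stdGaussian E) := by
  simp_rw [mul_comm _ (f _)]
  rw [lintegral_mul_edgeOp hw hf hg, lintegral_mul_edgeOp hw hg hf,
    ← lintegral_ouPair_comm h0 h1 (by fun_prop)]
  refine lintegral_congr fun p => ?_
  rw [hsymm]
  simp only [Prod.fst_swap, Prod.snd_swap]
  ring

theorem edgeOp_iterate_symm {q : ℝ} (h0 : 0 ≤ q) (h1 : q ≤ 1) {w : E × E → ℝ≥0∞}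
    (hw : Measurable w) (hsymm : ∀ p, w p.swap = w p) (n : ℕ) {f g : E → ℝ≥0∞}
    (hf : Measurable f) (hg : Measurable g) :
    ∫⁻ x, g x * (edgeOp q w)^[n] f x ∂(stdGaussian E) =
      ∫⁻ x, (edgeOp q w)^[n] g x * f x ∂(stdGaussian E) := by
  induction n generalizing f g with
  | zero => rfl
  | succ n ih =>
    rw [Function.iterate_succ_apply, ih (measurable_edgeOp hw hf) hg,
      edgeOp_symm h0 h1 hw hsymm hf (measurable_edgeOp_iterate hw hg n),
      Function.iterate_succ_apply']

/-- The Blakley–Roy inequality for paths whose length is a power of two. -/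
theorem pow_le_lintegral_edgeOp_iterate {q : ℝ} (h0 : 0 ≤ q) (h1 : q ≤ 1) {w : E × E → ℝ≥0∞}
    (hw : Measurable w) (hsymm : ∀ p, w p.swap = w p) (m : ℕ) :
    (∫⁻ p, w p ∂(ouPair E q)) ^ 2 ^ m ≤
      ∫⁻ x, (edgeOp q w)^[2 ^ m] (fun _ => 1) x ∂(stdGaussian E) := by
  induction m with
  | zero =>
    have := lintegral_mul_edgeOp (q := q) (f := fun _ => 1) (g := fun _ => 1) hw
      measurable_const measurable_const
    simp only [one_mul, mul_one] at this
    simp [this]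
  | succ m ih =>
    have hm := measurable_edgeOp_iterate (q := q) hw (measurable_const (a := (1 : ℝ≥0∞))) (2 ^ m)
    -- For the self-adjoint transfer operator `T`, Cauchy–Schwarz gives `⟨1, T^(2n) 1⟩ = ‖T^n 1‖² ≥
    -- ⟨1, T^n 1⟩²`. Each doubling of the length squares the bound, whence the restriction to powers
    -- of two.
    calc (∫⁻ p, w p ∂(ouPair E q)) ^ 2 ^ (m + 1)
        = ((∫⁻ p, w p ∂(ouPair E q)) ^ 2 ^ m) ^ 2 := by rw [← pow_mul, pow_succ]
      _ ≤ (∫⁻ x, (edgeOp q w)^[2 ^ m] (fun _ => 1) x ∂(stdGaussian E)) ^ 2 := by gcongr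
      _ ≤ ∫⁻ x, (edgeOp q w)^[2 ^ m] (fun _ => 1) x * (edgeOp q w)^[2 ^ m] (fun _ => 1) x
            ∂(stdGaussian E) := sq_lintegral_le_lintegral_sq hm
      _ = ∫⁻ x, 1 * (edgeOp q w)^[2 ^ m] ((edgeOp q w)^[2 ^ m] (fun _ => 1)) x
            ∂(stdGaussian E) := by
          rw [edgeOp_iterate_symm h0 h1 hw hsymm (2 ^ m) hm measurable_const]
      _ = _ := by
          simp only [one_mul, ← Function.iterate_add_apply, pow_succ, mul_two]

/-- Two correlated copies of an event are positively correlated. -/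
theorem sq_measure_le_ouPair {q : ℝ} (h0 : 0 ≤ q) (h1 : q ≤ 1) {S : Set E}
    (hS : MeasurableSet S) : (stdGaussian E S) ^ 2 ≤ ouPair E q (S ×ˢ S) := by
  -- Splitting a step of correlation `q = a * a` into two halves writes the pair probability as `‖P
  -- f‖²`, where `P` is the half step and `f` the indicator of `S`. Cauchy–Schwarz bounds this below
  -- by `(∫ P f)²`, and stationarity gives `∫ P f = ∫ f`.
  set a := √q
  have ha0 : 0 ≤ a := Real.sqrt_nonneg q
  have ha1 : a ≤ 1 := Real.sqrt_le_one.2 h1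
  have haq : a * a = q := Real.mul_self_sqrt h0
  set f : E → ℝ≥0∞ := S.indicator 1 with hfdef
  have hf : Measurable f := measurable_one.indicator hS
  have hw : Measurable (fun _ : E × E => (1 : ℝ≥0∞)) := measurable_const
  set P := edgeOp a (fun _ : E × E => (1 : ℝ≥0∞)) with hP
  have hPf : Measurable (P f) := measurable_edgeOp hw hf
  have e1 : ∫⁻ x, P f x ∂(stdGaussian E) = stdGaussian E S := by
    have := lintegral_mul_edgeOp (q := a) (g := fun _ => 1) hw hf measurable_const
    simp only [one_mul] at this
    rw [hP, this, ← lintegral_map (f := f) hf measurable_snd, ouPair_map_snd ha0 ha1, hfdef,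
      lintegral_indicator_one hS]
  have e2 : ∫⁻ x, P f x * P f x ∂(stdGaussian E) = ouPair E q (S ×ˢ S) := by
    rw [hP, ← edgeOp_symm ha0 ha1 hw (fun _ => rfl) hPf hf, lintegral_mul_edgeOp hw hPf hf,
      ← haq, ← ouPair_comp ha0 ha1 ha0 ha1, ← lintegral_indicator_one (hS.prod hS),
      lintegral_map (measurable_one.indicator (hS.prod hS)) (by fun_prop)]
    have hm : Measurable fun p : (E × E) × E =>
        (S ×ˢ S).indicator (1 : E × E → ℝ≥0∞) (p.1.1, ouStep a p.1.2 p.2) :=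
      (measurable_one.indicator (hS.prod hS)).comp (by fun_prop)
    rw [lintegral_prod _ hm.aemeasurable]
    refine lintegral_congr fun p => ?_
    rw [one_mul, hP, edgeOp, ← lintegral_const_mul _ (by fun_prop)]
    refine lintegral_congr fun z => ?_
    simp only [one_mul, hfdef, Set.indicator, Set.mem_prod, Pi.one_apply]
    split_ifs <;> simp_all
  rw [← e1, ← e2]
  exact sq_lintegral_le_lintegral_sq hPf

variable (E) in
/-- The law of the first `n + 1` states of the stationary chain; later coordinates are frozen. -/
noncomputable def pathLaw (q : ℝ) : ℕ → Measure (ℕ → E)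
  | 0 => (stdGaussian E).map (fun x _ => x)
  | n + 1 => ((pathLaw q n).prod (stdGaussian E)).map
      (fun p => Function.update p.1 (n + 1) (ouStep q (p.1 n) p.2))

@[fun_prop]
theorem measurable_path_update (q : ℝ) (n : ℕ) : Measurable
    (fun p : (ℕ → E) × E => Function.update p.1 (n + 1) (ouStep q (p.1 n) p.2)) := by
  refine measurable_pi_lambda _ fun k => ?_
  by_cases hk : k = n + 1
  · subst hk; simp only [Function.update_self]; fun_prop
  · simp only [Function.update_of_ne hk]; fun_prop

instance isProbabilityMeasure_pathLaw (q : ℝ) (n : ℕ) : IsProbabilityMeasure (pathLaw E q n) := by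
  induction n with
  | zero => exact Measure.isProbabilityMeasure_map (by fun_prop)
  | succ n ih => exact Measure.isProbabilityMeasure_map (by fun_prop)

theorem lintegral_pathLaw_succ (q : ℝ) (n : ℕ) {F : (ℕ → E) → ℝ≥0∞} (hF : Measurable F) :
    ∫⁻ ω, F ω ∂(pathLaw E q (n + 1)) = ∫⁻ ω, ∫⁻ z,
      F (Function.update ω (n + 1) (ouStep q (ω n) z)) ∂(stdGaussian E) ∂(pathLaw E q n) := by
  rw [pathLaw, lintegral_map hF (by fun_prop), lintegral_prod _ (by fun_prop)]

/-- Integrating out the last state replaces the terminal function `h` by `edgeOp q w h` on a path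
one step shorter. This turns path probabilities into iterates of the transfer operator. -/
theorem lintegral_pathLaw_prod_edges {q : ℝ} {w : E × E → ℝ≥0∞} (hw : Measurable w) (n : ℕ)
    {h : E → ℝ≥0∞} (hh : Measurable h) :
    ∫⁻ ω, (∏ k ∈ Finset.range n, w (ω k, ω (k + 1))) * h (ω n) ∂(pathLaw E q n) =
      ∫⁻ x, (edgeOp q w)^[n] h x ∂(stdGaussian E) := by
  induction n generalizing h with
  | zero => simp only [Finset.range_zero, Finset.prod_empty, one_mul, pathLaw,
      Function.iterate_zero_apply]; rw [lintegral_map (by fun_prop) (by fun_prop)]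
  | succ n ih =>
    rw [lintegral_pathLaw_succ _ _ (by fun_prop), Function.iterate_succ_apply,
      ← ih (measurable_edgeOp hw hh)]
    refine lintegral_congr fun ω => ?_
    rw [edgeOp, ← lintegral_const_mul _ (by fun_prop)]
    refine lintegral_congr fun z => ?_
    rw [Finset.prod_range_succ, Function.update_self, mul_assoc,
      Function.update_of_ne (by omega : n ≠ n + 1)]
    congr 1
    refine Finset.prod_congr rfl fun k hk => ?_
    have := Finset.mem_range.1 hk
    rw [Function.update_of_ne (by omega), Function.update_of_ne (by omega)]

theorem pathLaw_map_self (q : ℝ) (h0 : 0 ≤ q) (h1 : q ≤ 1) (n : ℕ) :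
    (pathLaw E q n).map (fun ω => ω n) = stdGaussian E := by
  induction n with
  | zero => rw [pathLaw, Measure.map_map (by fun_prop) (by fun_prop)]; exact Measure.map_id
  | succ n ih =>
    rw [pathLaw, Measure.map_map (by fun_prop) (by fun_prop)]
    conv_rhs => rw [← stdGaussian_prod_map_combination (sq_add_sq_sqrt_one_sub h0 h1)]
    nth_rw 2 [← ih]
    have e : (stdGaussian E) = (stdGaussian E).map id := Measure.map_id.symm
    nth_rw 2 [e]
    rw [Measure.map_prod_map _ _ (by fun_prop) (by fun_prop),
      Measure.map_map (by fun_prop) (by fun_prop)]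
    congr 1
    ext p
    simp [ouStep]

theorem pathLaw_map_pair {q : ℝ} (h0 : 0 ≤ q) (h1 : q ≤ 1) {s n : ℕ} (hsn : s ≤ n) :
    (pathLaw E q n).map (fun ω => (ω s, ω n)) = ouPair E (q ^ (n - s)) := by
  induction n, hsn using Nat.le_induction with
  | base =>
    have : (fun ω : ℕ → E => (ω s, ω s)) = (fun x => (x, x)) ∘ (fun ω => ω s) := rfl
    rw [this, ← Measure.map_map (by fun_prop) (by fun_prop), pathLaw_map_self q h0 h1, ouPair]
    have h2 : (fun p : E × E => (p.1, ouStep (q ^ (s - s)) p.1 p.2)) =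
        (fun x => (x, x)) ∘ Prod.fst := by
      ext p <;> simp [ouStep]
    rw [h2, ← Measure.map_map (by fun_prop) (by fun_prop), Measure.map_fst_prod]
    simp
  | succ n hsn ih =>
    rw [Nat.succ_sub hsn, pow_succ, ← ouPair_comp (pow_nonneg h0 _) (pow_le_one₀ h0 h1) h0 h1,
      ← ih, pathLaw, Measure.map_map (by fun_prop) (by fun_prop)]
    have e : (stdGaussian E) = (stdGaussian E).map id := Measure.map_id.symm
    nth_rw 2 [e]
    rw [Measure.map_prod_map _ _ (by fun_prop) (by fun_prop),
      Measure.map_map (by fun_prop) (by fun_prop)]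
    congr 1
    ext p
    · simp [Function.update_of_ne (by omega : s ≠ n + 1)]
    · simp

theorem pathLaw_map_pair_of_le {q : ℝ} (h0 : 0 ≤ q) (h1 : q ≤ 1) {s t n : ℕ} (hst : s ≤ t)
    (htn : t ≤ n) :
    (pathLaw E q n).map (fun ω => (ω s, ω t)) = ouPair E (q ^ (t - s)) := by
  induction n, htn using Nat.le_induction with
  | base => exact pathLaw_map_pair h0 h1 hst
  | succ n htn ih =>
    rw [← ih, pathLaw, Measure.map_map (by fun_prop) (by fun_prop)]
    have h2 : (fun ω : ℕ → E => (ω s, ω t)) ∘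
        (fun p : (ℕ → E) × E => Function.update p.1 (n + 1) (ouStep q (p.1 n) p.2)) =
        (fun ω : ℕ → E => (ω s, ω t)) ∘ Prod.fst := by
      ext p <;> simp [Function.update_of_ne (by omega : s ≠ n + 1),
        Function.update_of_ne (by omega : t ≠ n + 1)]
    rw [h2, ← Measure.map_map (by fun_prop) (by fun_prop), Measure.map_fst_prod]
    simp

/-- The probability that all `2 ^ m` edges of the chain lie in a symmetric set is at least the
corresponding power of the probability for a single edge. -/
theorem ouPair_pow_le_pathLaw {q : ℝ} (h0 : 0 ≤ q) (h1 : q ≤ 1) {A : Set (E × E)}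
    (hA : MeasurableSet A) (hsymm : ∀ p, p.swap ∈ A ↔ p ∈ A) (m : ℕ) :
    (ouPair E q A) ^ 2 ^ m ≤
      pathLaw E q (2 ^ m) {ω | ∀ k < 2 ^ m, (ω k, ω (k + 1)) ∈ A} := by
  have hw : Measurable (A.indicator (1 : E × E → ℝ≥0∞)) := measurable_one.indicator hA
  have h := pow_le_lintegral_edgeOp_iterate h0 h1 hw (fun p => by
    by_cases hp : p ∈ A <;> simp [hp, hsymm]) m
  rw [lintegral_indicator_one hA, ← lintegral_pathLaw_prod_edges hw _ measurable_const] at h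
  refine h.trans (le_of_eq ?_)
  have hmeas : MeasurableSet {ω : ℕ → E | ∀ k < 2 ^ m, (ω k, ω (k + 1)) ∈ A} := by
    simp only [Set.ofPred_forall]
    refine MeasurableSet.iInter fun k => MeasurableSet.iInter fun _ => ?_
    exact (show Measurable fun ω : ℕ → E => (ω k, ω (k + 1)) by fun_prop) hA
  rw [← lintegral_indicator_one hmeas]
  refine lintegral_congr fun ω => ?_
  rw [mul_one]
  by_cases hω : ∀ k < 2 ^ m, (ω k, ω (k + 1)) ∈ A
  · rw [Set.indicator_of_mem (by exact hω), Finset.prod_eq_one]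
    · rfl
    · intro k hk
      rw [Set.indicator_of_mem (hω k (Finset.mem_range.1 hk))]; rfl
  · rw [Set.indicator_of_notMem (by exact hω)]
    push Not at hω
    obtain ⟨k, hk, hkA⟩ := hω
    exact Finset.prod_eq_zero (Finset.mem_range.2 hk) (Set.indicator_of_notMem hkA _)

end OrnsteinUhlenbeck

/-! ### Local fields as linear functionals of the disorder -/

section Coupling

variable {N : ℕ}

/-- The coefficient vector of the disorder in the bilinear form
`N^(-1/2) ∑_{i ≠ j} u_i (g_{i,j} + g_{j,i}) v_j`. -/
noncomputable def coupling (u v : Fin N → ℝ) : Disorder N :=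
  WithLp.toLp 2 fun k => if k.1 = k.2 then 0 else (u k.1 * v k.2 + u k.2 * v k.1) / √(N : ℝ)

/-- The field created at site `i` by the configuration `v`. -/
noncomputable def siteField (g : Disorder N) (v : Fin N → ℝ) (i : Fin N) : ℝ :=
  1 / √(N : ℝ) * ∑ j, if i = j then 0 else (g (i, j) + g (j, i)) * v j

/-- Once the configurations are fixed, a weighted sum of fields is a Gaussian linear form in the
disorder, so its tail is governed by the norm of the coefficient vector. -/
theorem inner_coupling (u v : Fin N → ℝ) (g : Disorder N) :
    ⟪coupling u v, g⟫ = ∑ i, u i * siteField g v i := by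
  have h1 : ⟪coupling u v, g⟫ = ∑ i, ∑ j, g (i, j) *
      (if i = j then 0 else (u i * v j + u j * v i) / √(N : ℝ)) := by
    rw [PiLp.inner_apply, Fintype.sum_prod_type]
    simp [coupling]
  have h2 : ∑ i, u i * siteField g v i =
      ∑ i, ∑ j, (if i = j then 0 else g (i, j) * (u i * v j / √(N : ℝ))) +
      ∑ i, ∑ j, (if i = j then 0 else g (j, i) * (u i * v j / √(N : ℝ))) := by
    rw [← Finset.sum_add_distrib]
    refine Finset.sum_congr rfl fun i _ => ?_
    rw [siteField, Finset.mul_sum, Finset.mul_sum, ← Finset.sum_add_distrib]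
    refine Finset.sum_congr rfl fun j _ => ?_
    split_ifs <;> ring
  rw [h1, h2, Finset.sum_comm (γ := Fin N) (f := fun i j =>
    (if i = j then 0 else g (j, i) * (u i * v j / √(N : ℝ))))]
  rw [← Finset.sum_add_distrib]
  refine Finset.sum_congr rfl fun i _ => ?_
  rw [← Finset.sum_add_distrib]
  refine Finset.sum_congr rfl fun j _ => ?_
  by_cases hij : i = j
  · simp [hij]
  · rw [if_neg hij, if_neg hij, if_neg (Ne.symm hij)]; ring

/-- Symmetrised entries are handled by `(a + b)² ≤ 2a² + 2b²`. Keeping both factors matters: for `u`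
supported on `J` and `v` on `I` the variance is of order `|J||I|/N` rather than `|J|`, which is the
gain behind the overlap gap. -/
theorem norm_coupling_sq_le (u v : Fin N → ℝ) :
    ‖coupling u v‖ ^ 2 ≤ 4 * (∑ i, u i ^ 2) * (∑ i, v i ^ 2) / N := by
  rw [EuclideanSpace.real_norm_sq_eq, Fintype.sum_prod_type]
  have key : ∀ i j : Fin N, (coupling u v (i, j)) ^ 2 ≤
      2 * (u i ^ 2 * v j ^ 2) / N + 2 * (v i ^ 2 * u j ^ 2) / N := by
    intro i j
    simp only [coupling]
    split_ifs
    · rw [zero_pow two_ne_zero]; positivity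
    · rw [div_pow, Real.sq_sqrt (Nat.cast_nonneg N), ← add_div]
      gcongr
      nlinarith [sq_nonneg (u i * v j - u j * v i)]
  calc ∑ i, ∑ j, (coupling u v (i, j)) ^ 2
      ≤ ∑ i, ∑ j, (2 * (u i ^ 2 * v j ^ 2) / N + 2 * (v i ^ 2 * u j ^ 2) / N) :=
        Finset.sum_le_sum fun i _ => Finset.sum_le_sum fun j _ => key i j
    _ = 4 * (∑ i, u i ^ 2) * (∑ i, v i ^ 2) / N := by
      simp only [Finset.sum_add_distrib, ← Finset.sum_div, ← Finset.mul_sum, ← Finset.sum_mul]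
      ring

theorem siteField_sub_two_smul (g : Disorder N) (v w : Fin N → ℝ) (i : Fin N) :
    siteField g (fun j => v j - 2 * w j) i = siteField g v i - 2 * siteField g w i := by
  simp only [siteField, Finset.mul_sum, ← Finset.sum_sub_distrib]
  refine Finset.sum_congr rfl fun j _ => ?_
  split_ifs <;> ring

theorem siteField_ouStep (q : ℝ) (g z : Disorder N) (v : Fin N → ℝ) (i : Fin N) :
    siteField (ouStep q g z) v i = q * siteField g v i + √(1 - q ^ 2) * siteField z v i := by
  simp only [siteField, Finset.mul_sum, ← Finset.sum_add_distrib]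
  refine Finset.sum_congr rfl fun j _ => ?_
  split_ifs
  · ring
  · simp only [ouStep, PiLp.add_apply, PiLp.smul_apply, smul_eq_mul]; ring

/-- Flipping spin `i` changes only the terms with exactly one index equal to `i`. The diagonal term
is unchanged because `σ i ^ 2 = 1`, so `siteField` omits it. -/
theorem localField_eq_siteField (g : Disorder N) {σ : Fin N → ℝ} {i : Fin N}
    (hσ : σ i = 1 ∨ σ i = -1) : localField g σ i = siteField g σ i := by
  have hsq : σ i * σ i = 1 := by rcases hσ with h | h <;> rw [h] <;> norm_num
  have key : ∑ a, ∑ b, g (a, b) * σ a * σ b -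
      ∑ a, ∑ b, g (a, b) * flipSpin σ i a * flipSpin σ i b =
      2 * σ i * ∑ j, if i = j then 0 else (g (i, j) + g (j, i)) * σ j := by
    have h1 : ∀ a b, g (a, b) * σ a * σ b - g (a, b) * flipSpin σ i a * flipSpin σ i b =
        (if a = i then (if i = b then 0 else 2 * σ i * (g (i, b) * σ b)) else 0) +
        (if b = i then (if i = a then 0 else 2 * σ i * (g (a, i) * σ a)) else 0) := by
      intro a b
      simp only [flipSpin, Function.update_apply]
      by_cases ha : a = i <;> by_cases hb : b = i
      · subst ha; subst hb; simp
      · subst ha; simp [hb, Ne.symm hb]; ring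
      · subst hb; simp [ha, Ne.symm ha]; ring
      · simp [ha, hb]
    simp only [← Finset.sum_sub_distrib, h1, Finset.sum_add_distrib]
    have h2 : ∑ a, ∑ b, (if a = i then (if i = b then 0 else 2 * σ i * (g (i, b) * σ b)) else 0) =
        ∑ b, (if i = b then 0 else 2 * σ i * (g (i, b) * σ b)) := by
      rw [Finset.sum_comm]; simp
    rw [h2]
    simp only [Finset.sum_ite_eq', Finset.mem_univ, if_true]
    rw [← Finset.sum_add_distrib, Finset.mul_sum]
    refine Finset.sum_congr rfl fun j _ => ?_
    split_ifs <;> ring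
  rw [localField, hamiltonian, hamiltonian, ← mul_sub, key, siteField]
  linear_combination (1 / √(N : ℝ) * ∑ j, if i = j then 0 else (g (i, j) + g (j, i)) * σ j) * hsq

/-- The restriction of `σ` to the sites in `J`, extended by zero. -/
def restrictTo (J : Finset (Fin N)) (σ : Fin N → ℝ) (i : Fin N) : ℝ := if i ∈ J then σ i else 0

/-- `σ` with the spins in `I` flipped. -/
def flipOn (I : Finset (Fin N)) (σ : Fin N → ℝ) (i : Fin N) : ℝ := if i ∈ I then -σ i else σ i

/-- The spin configuration which is `1` exactly on `P`. -/
def signOn (P : Finset (Fin N)) (i : Fin N) : ℝ := if i ∈ P then 1 else -1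

/-- The proposition that `σ` is an element of the hypercube `{-1, 1}^N`. -/
def IsSpin (σ : Fin N → ℝ) : Prop := ∀ i, σ i = 1 ∨ σ i = -1

theorem IsSpin.sq {σ : Fin N → ℝ} (h : IsSpin σ) (i : Fin N) : σ i ^ 2 = 1 := by
  rcases h i with h | h <;> rw [h] <;> norm_num

theorem IsSpin.flipOn {σ : Fin N → ℝ} (h : IsSpin σ) (I : Finset (Fin N)) :
    IsSpin (flipOn I σ) := by
  intro i
  unfold _root_.flipOn
  split_ifs
  · rcases h i with h | h <;> rw [h] <;> simp
  · exact h i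

theorem isSpin_signOn (P : Finset (Fin N)) : IsSpin (signOn P) := by
  intro i; unfold signOn; split_ifs <;> simp

theorem IsSpin.exists_signOn {σ : Fin N → ℝ} (h : IsSpin σ) : ∃ P, σ = signOn P := by
  classical
  refine ⟨Finset.univ.filter fun i => σ i = 1, ?_⟩
  ext i
  rcases h i with h | h <;> simp [signOn, h]

theorem sum_sq_restrictTo (J : Finset (Fin N)) {σ : Fin N → ℝ} (h : IsSpin σ) :
    ∑ i, restrictTo J σ i ^ 2 = J.card := by
  have : ∀ i, restrictTo J σ i ^ 2 = if i ∈ J then 1 else 0 := by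
    intro i; unfold restrictTo; split_ifs <;> simp [h.sq]
  simp [this]

theorem IsSpin.sum_sq {σ : Fin N → ℝ} (h : IsSpin σ) : ∑ i, σ i ^ 2 = N := by
  simp [h.sq]

theorem sum_restrictTo_mul (J : Finset (Fin N)) (σ f : Fin N → ℝ) :
    ∑ i, restrictTo J σ i * f i = ∑ i ∈ J, σ i * f i := by
  simp [restrictTo, ite_mul, Finset.sum_ite_mem]

theorem norm_coupling_restrict_restrict_sq_le (I J : Finset (Fin N)) {σ : Fin N → ℝ}
    (h : IsSpin σ) :
    ‖coupling (restrictTo J σ) (restrictTo I σ)‖ ^ 2 ≤ 4 * J.card * I.card / N := by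
  have := norm_coupling_sq_le (restrictTo J σ) (restrictTo I σ)
  rwa [sum_sq_restrictTo _ h, sum_sq_restrictTo _ h] at this

theorem norm_coupling_restrict_sq_le (J : Finset (Fin N)) {σ τ : Fin N → ℝ}
    (hσ : IsSpin σ) (hτ : IsSpin τ) :
    ‖coupling (restrictTo J σ) τ‖ ^ 2 ≤ 4 * J.card := by
  have := norm_coupling_sq_le (restrictTo J σ) τ
  rw [sum_sq_restrictTo _ hσ, hτ.sum_sq] at this
  refine this.trans ?_
  rcases Nat.eq_zero_or_pos N with h | h
  · subst h; simp
  · have : (0 : ℝ) < N := by exact_mod_cast h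
    rw [mul_div_assoc, div_self this.ne', mul_one]

end Coupling

/-! ### Entropy of small sets of sites -/

section Counting

/-- The upper bound `ρ (1 + log (1 / ρ))` for the binary entropy of `ρ`. -/
noncomputable def entropyBound (ρ : ℝ) : ℝ := ρ * (1 - Real.log ρ)

/-- The subsets of `Fin N` with at most `ρ N` elements. -/
noncomputable def fewSites (N : ℕ) (ρ : ℝ) : Finset (Finset (Fin N)) :=
  open Classical in Finset.univ.filter fun I => (I.card : ℝ) ≤ ρ * N

theorem mem_fewSites {N : ℕ} {ρ : ℝ} {I : Finset (Fin N)} :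
    I ∈ fewSites N ρ ↔ (I.card : ℝ) ≤ ρ * N := by
  simp [fewSites]

/-- Give each subset `I` the weight `ρ ^ |I|`. Every counted set has weight at least `ρ ^ (ρN)`, and
all the weights add up to `(1 + ρ) ^ N ≤ exp (ρN)`. -/
theorem card_fewSites_le (N : ℕ) {ρ : ℝ} (h0 : 0 < ρ) (h1 : ρ ≤ 1) :
    ((fewSites N ρ).card : ℝ) ≤ Real.exp (entropyBound ρ * N) := by
  have hlog : Real.log ρ ≤ 0 := Real.log_nonpos h0.le h1
  have key : ((fewSites N ρ).card : ℝ) * Real.exp (Real.log ρ * (ρ * N)) ≤ (1 + ρ) ^ N := by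
    calc ((fewSites N ρ).card : ℝ) * Real.exp (Real.log ρ * (ρ * N))
        = ∑ I ∈ fewSites N ρ, Real.exp (Real.log ρ * (ρ * N)) := by simp
      _ ≤ ∑ I ∈ fewSites N ρ, ρ ^ I.card := by
          refine Finset.sum_le_sum fun I hI => ?_
          rw [← Real.rpow_natCast, Real.rpow_def_of_pos h0]
          exact Real.exp_le_exp.2 (mul_le_mul_of_nonpos_left (mem_fewSites.1 hI) hlog)
      _ ≤ ∑ I : Finset (Fin N), ρ ^ I.card :=
          Finset.sum_le_univ_sum_of_nonneg fun I => by positivity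
      _ = (1 + ρ) ^ N := by
          have := Fintype.sum_pow_mul_eq_add_pow (Fin N) ρ 1
          simp only [one_pow, mul_one, Fintype.card_fin] at this
          rw [this, add_comm]
  have h2 : (1 + ρ) ^ N ≤ Real.exp (ρ * N) := by
    calc (1 + ρ) ^ N ≤ Real.exp ρ ^ N := by
          gcongr; linarith [Real.add_one_le_exp ρ]
      _ = Real.exp (ρ * N) := by rw [← Real.exp_nat_mul]; ring_nf
  have h3 : ((fewSites N ρ).card : ℝ) ≤
      Real.exp (ρ * N) * Real.exp (-(Real.log ρ * (ρ * N))) := by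
    rw [Real.exp_neg, ← div_eq_mul_inv, le_div_iff₀ (Real.exp_pos _)]
    exact key.trans h2
  refine h3.trans (le_of_eq ?_)
  rw [← Real.exp_add]; congr 1; unfold entropyBound; ring

end Counting

/-! ### Deterministic consequences of being gapped for correlated disorders -/

section Obstruction

variable {N : ℕ}

/-- The direction `a p.1` may depend on the first vector, since the second is independent of it and
the tail bound holds conditionally. This permits configurations chosen by the algorithm from the
first disorder without a union over the hypercube. -/
theorem prod_inner_ge_le {E : Type*} [NormedAddCommGroup E] [InnerProductSpace ℝ E]
    [FiniteDimensional ℝ E] [MeasurableSpace E] [BorelSpace E] {a : E → E} (ha : Measurable a)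
    {t v : ℝ} (ht : 0 ≤ t) (hv : 0 < v) (hav : ∀ x, ‖a x‖ ^ 2 ≤ v) :
    ((stdGaussian E).prod (stdGaussian E)).real {p | t ≤ ⟪a p.1, p.2⟫} ≤
      Real.exp (-(t ^ 2 / (2 * v))) := by
  have hm : MeasurableSet {p : E × E | t ≤ ⟪a p.1, p.2⟫} :=
    measurableSet_le measurable_const (by fun_prop)
  rw [measureReal_def, Measure.prod_apply hm]
  refine ENNReal.toReal_le_of_le_ofReal (Real.exp_pos _).le ?_
  calc ∫⁻ x, stdGaussian E (Prod.mk x ⁻¹' {p : E × E | t ≤ ⟪a p.1, p.2⟫}) ∂(stdGaussian E)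
      ≤ ∫⁻ _, ENNReal.ofReal (Real.exp (-(t ^ 2 / (2 * v)))) ∂(stdGaussian E) := by
        refine lintegral_mono fun x => ?_
        rw [ENNReal.le_ofReal_iff_toReal_le (measure_ne_top _ _) (Real.exp_pos _).le]
        exact stdGaussian_inner_ge_le (a x) ht hv (hav x)
    _ = _ := by simp

/-- A gapped state has local fields at least `γ` on a set of sites with small complement. -/
theorem exists_good_sites {γ δ : ℝ} {g : Disorder N} {σ : Fin N → ℝ}
    (h : σ ∈ gappedStates γ δ g) : IsSpin σ ∧ ∃ B ∈ fewSites N δ,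
      ∀ i ∉ B, γ ≤ σ i * siteField g σ i := by
  classical
  refine ⟨h.1, Finset.univ.filter fun i => σ i * localField g σ i < γ, ?_, ?_⟩
  · rw [mem_fewSites]
    have := h.2
    rwa [show {i : Fin N | σ i * localField g σ i < γ} =
      ((Finset.univ.filter fun i => σ i * localField g σ i < γ : Finset (Fin N)) : Set (Fin N)) by
        ext; simp, Set.ncard_coe_finset] at this
  · intro i hi
    simp only [Finset.mem_filter, Finset.mem_univ, true_and, not_lt] at hi
    rwa [localField_eq_siteField g (h.1 i)] at hi

theorem exists_flipOn {σ τ : Fin N → ℝ} (hσ : IsSpin σ) (hτ : IsSpin τ) :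
    ∃ I : Finset (Fin N), I.card = hammingDist σ τ ∧ τ = flipOn I σ := by
  classical
  refine ⟨Finset.univ.filter fun i => σ i ≠ τ i, by simp [hammingDist], ?_⟩
  ext i
  simp only [flipOn, Finset.mem_filter, Finset.mem_univ, true_and]
  split_ifs with h
  · rcases hσ i with h1 | h1 <;> rcases hτ i with h2 | h2 <;> simp_all
  · push Not at h; exact h.symm

/-- Dichotomy behind the overlap gap for gapped states of correlated disorders. -/
theorem gapped_pair_dichotomy {γ δ q : ℝ} (hq0 : 0 ≤ q) {g z : Disorder N} {σ τ : Fin N → ℝ}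
    (hσ : σ ∈ gappedStates γ δ g) (hτ : τ ∈ gappedStates γ δ (ouStep q g z)) :
    ∃ I J : Finset (Fin N), I.card = hammingDist σ τ ∧ τ = flipOn I σ ∧ J ⊆ I ∧
      (I.card : ℝ) - 2 * δ * N ≤ J.card ∧
      (γ * J.card / 2 ≤ ⟪coupling (restrictTo J σ) (restrictTo I σ), g⟫ ∨
        γ * J.card ≤ ⟪-(√(1 - q ^ 2) • coupling (restrictTo J σ) (flipOn I σ)), z⟫) := by
  classical
  obtain ⟨sσ, B, hB, hBσ⟩ := exists_good_sites hσ
  obtain ⟨sτ, B', hB', hBτ⟩ := exists_good_sites hτ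
  obtain ⟨I, hI, hflip⟩ := exists_flipOn sσ sτ
  -- Flipped sites that are good for both states; at most `2δN` flipped sites are lost.
  set J := I \ (B ∪ B') with hJ
  refine ⟨I, J, hI, hflip, Finset.sdiff_subset, ?_, ?_⟩
  · have h1 : I.card ≤ J.card + (B.card + B'.card) := by
      calc I.card ≤ J.card + (B ∪ B').card := by
            have := Finset.le_card_sdiff (B ∪ B') I
            rw [hJ]
            omega
        _ ≤ _ := by gcongr; exact Finset.card_union_le _ _
    have h2 : (I.card : ℝ) ≤ J.card + (B.card + B'.card) := by exact_mod_cast h1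
    rw [mem_fewSites] at hB hB'
    linarith
  · rw [inner_neg_left, real_inner_smul_left]
    simp only [inner_coupling, sum_restrictTo_mul]
    by_contra hcon
    push Not at hcon
    obtain ⟨hc1, hc2⟩ := hcon
    have e1 : ∀ i ∈ J, σ i * siteField (ouStep q g z) τ i ≤ -γ := by
      intro i hi
      simp only [hJ, Finset.mem_sdiff, Finset.mem_union, not_or] at hi
      have := hBτ i hi.2.2
      have h3 : τ i = -σ i := by rw [hflip]; simp [flipOn, hi.1]
      rw [h3] at this
      linarith
    have e2 : ∀ i ∈ J, γ ≤ σ i * siteField g σ i := by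
      intro i hi
      simp only [hJ, Finset.mem_sdiff, Finset.mem_union, not_or] at hi
      exact hBσ i hi.2.1
    have e3 : flipOn I σ = fun j => σ j - 2 * restrictTo I σ j := by
      ext j; unfold flipOn restrictTo; split_ifs <;> ring
    have s1 : ∑ i ∈ J, σ i * siteField (ouStep q g z) τ i ≤ -(γ * J.card) := by
      calc _ ≤ ∑ i ∈ J, (-γ) := Finset.sum_le_sum e1
        _ = _ := by simp; ring
    have s2 : γ * J.card ≤ ∑ i ∈ J, σ i * siteField g σ i := by
      calc γ * J.card = ∑ i ∈ J, γ := by simp; ring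
        _ ≤ _ := Finset.sum_le_sum e2
    -- Linearity in the disorder together with `τ = σ - 2 σ_I`, where `σ_I` is `σ` restricted to
    -- `I`, splits the new field into the old field, a correction from interactions with `I`, and
    -- the innovation.
    have s3 : ∑ i ∈ J, σ i * siteField (ouStep q g z) τ i =
        q * (∑ i ∈ J, σ i * siteField g σ i) -
        2 * q * (∑ i ∈ J, σ i * siteField g (restrictTo I σ) i) +
        √(1 - q ^ 2) * ∑ i ∈ J, σ i * siteField z (flipOn I σ) i := by
      simp only [Finset.mul_sum, ← Finset.sum_add_distrib, ← Finset.sum_sub_distrib]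
      refine Finset.sum_congr rfl fun i _ => ?_
      rw [siteField_ouStep, hflip]
      nth_rw 1 [e3]
      rw [siteField_sub_two_smul]
      ring
    -- If both alternatives fail, the first two terms of `s3` have nonnegative sum, because twice
    -- the correction is less than `γ |J|`, and the innovation exceeds `-γ |J|`. This contradicts
    -- `s1`.
    nlinarith [mul_nonneg hq0 (sub_nonneg.2 s2), mul_nonneg hq0 (sub_nonneg.2 hc1.le)]

/-- A gapped state of a disorder which is almost independent of `g` is unlikely. -/
theorem gapped_dichotomy_of_small_corr {γ δ q : ℝ} (hγ : 0 < γ) (hδ : δ ≤ 1 / 2) (hq0 : 0 ≤ q)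
    (hq : q ≤ γ / 16) {g z : Disorder N} {τ : Fin N → ℝ}
    (hτ : τ ∈ gappedStates γ δ (ouStep q g z)) :
    ∃ B ∈ fewSites N δ,
      (4 * (N : ℝ) ≤ ⟪coupling (restrictTo Bᶜ τ) τ, g⟫ ∨
        γ * N / 4 ≤ ⟪√(1 - q ^ 2) • coupling (restrictTo Bᶜ τ) τ, z⟫) := by
  obtain ⟨sτ, B, hB, hBτ⟩ := exists_good_sites hτ
  refine ⟨B, hB, ?_⟩
  rw [mem_fewSites] at hB
  have hcard : (N : ℝ) / 2 ≤ Bᶜ.card := by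
    have : B.card + Bᶜ.card = N := by rw [Finset.card_add_card_compl]; simp
    have : (B.card : ℝ) + Bᶜ.card = N := by exact_mod_cast this
    nlinarith [(Nat.cast_nonneg N : (0 : ℝ) ≤ N)]
  rw [real_inner_smul_left]
  simp only [inner_coupling, sum_restrictTo_mul]
  by_contra hcon
  push Not at hcon
  obtain ⟨hc1, hc2⟩ := hcon
  have s2 : γ * (Bᶜ.card : ℝ) ≤ ∑ i ∈ Bᶜ, τ i * siteField (ouStep q g z) τ i := by
    calc γ * (Bᶜ.card : ℝ) = ∑ i ∈ Bᶜ, γ := by simp only [Finset.sum_const, nsmul_eq_mul]; ring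
      _ ≤ _ := Finset.sum_le_sum fun i hi => hBτ i (Finset.mem_compl.1 hi)
  have s3 : ∑ i ∈ Bᶜ, τ i * siteField (ouStep q g z) τ i =
      q * (∑ i ∈ Bᶜ, τ i * siteField g τ i) +
      √(1 - q ^ 2) * ∑ i ∈ Bᶜ, τ i * siteField z τ i := by
    simp only [Finset.mul_sum, ← Finset.sum_add_distrib]
    refine Finset.sum_congr rfl fun i _ => ?_
    rw [siteField_ouStep]; ring
  -- At least `N / 2` good sites force an alignment of `γN/2`. With `q ≤ γ / 16` the old disorder
  -- supplies at most `γN/4`, and the innovation would have to supply the rest.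
  have h4 : q * (∑ i ∈ Bᶜ, τ i * siteField g τ i) ≤ γ / 16 * (4 * N) := by
    calc _ ≤ q * (4 * N) := by gcongr
      _ ≤ _ := by gcongr
  nlinarith

end Obstruction

/-! ### Measurability of the events involved -/

section Measurability

variable {N : ℕ} {α : Type*} [MeasurableSpace α]

theorem measurable_localField {f : α → Disorder N} {B : α → Fin N → ℝ} (hf : Measurable f)
    (hB : Measurable B) (i : Fin N) : Measurable fun a => localField (f a) (B a) i := by
  have hflip : ∀ j, Measurable fun a => flipSpin (B a) i j := by
    intro j
    by_cases h : j = i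
    · subst h; simp only [flipSpin, Function.update_self]; fun_prop
    · simp only [flipSpin, Function.update_of_ne h]; fun_prop
  unfold localField hamiltonian
  fun_prop

theorem measurableSet_gapped {f : α → Disorder N} {B : α → Fin N → ℝ} (γ δ : ℝ)
    (hf : Measurable f) (hB : Measurable B) :
    MeasurableSet {a | B a ∈ gappedStates γ δ (f a)} := by
  classical
  have h : {a | B a ∈ gappedStates γ δ (f a)} =
      (⋂ i, {a | B a i = 1} ∪ {a | B a i = -1}) ∩
      {a | (∑ i, if B a i * localField (f a) (B a) i < γ then (1 : ℝ) else 0) ≤ δ * N} := by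
    ext a
    have hc : ({i : Fin N | B a i * localField (f a) (B a) i < γ}.ncard : ℝ) =
        ∑ i, if B a i * localField (f a) (B a) i < γ then (1 : ℝ) else 0 := by
      rw [show {i : Fin N | B a i * localField (f a) (B a) i < γ} =
        ((Finset.univ.filter fun i => B a i * localField (f a) (B a) i < γ : Finset (Fin N)) :
          Set (Fin N)) by ext; simp, Set.ncard_coe_finset]
      simp
    simp only [gappedStates, Set.mem_ofPred_eq, hc, Set.mem_inter_iff, Set.mem_iInter,
      Set.mem_union]
  rw [h]
  refine (MeasurableSet.iInter fun i => ?_).inter ?_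
  · have hi : Measurable fun a => B a i := by fun_prop
    exact (hi (measurableSet_singleton _)).union (hi (measurableSet_singleton _))
  · refine measurableSet_le (Finset.measurable_sum _ fun i _ => ?_) measurable_const
    refine Measurable.ite (measurableSet_lt ?_ measurable_const) measurable_const measurable_const
    have := measurable_localField hf hB i
    fun_prop

theorem hammingDist_eq_sum (σ τ : Fin N → ℝ) :
    (hammingDist σ τ : ℝ) = ∑ i, if σ i = τ i then (0 : ℝ) else 1 := by
  simp only [hammingDist, Finset.card_filter, Nat.cast_sum, Nat.cast_ite]
  refine Finset.sum_congr rfl fun i _ => ?_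
  by_cases h : σ i = τ i <;> simp [h]

theorem measurable_hammingDist {B B' : α → Fin N → ℝ} (hB : Measurable B) (hB' : Measurable B') :
    Measurable fun a => (hammingDist (B a) (B' a) : ℝ) := by
  simp only [hammingDist_eq_sum]
  refine Finset.measurable_sum _ fun i _ => ?_
  exact Measurable.ite (measurableSet_eq_fun (by fun_prop) (by fun_prop)) measurable_const
    measurable_const

theorem measurable_coupling {u v : α → Fin N → ℝ} (hu : Measurable u) (hv : Measurable v) :
    Measurable fun a => coupling (u a) (v a) := by
  have : Measurable fun a => fun k : Fin N × Fin N =>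
      if k.1 = k.2 then 0 else (u a k.1 * v a k.2 + u a k.2 * v a k.1) / √(N : ℝ) := by
    refine measurable_pi_lambda _ fun k => ?_
    split_ifs <;> fun_prop
  exact (WithLp.measurable_toLp 2 _).comp this

theorem measurable_restrictTo (J : Finset (Fin N)) : Measurable (restrictTo J) := by
  refine measurable_pi_lambda _ fun k => ?_
  unfold restrictTo
  split_ifs <;> fun_prop

theorem measurable_flipOn (J : Finset (Fin N)) : Measurable (flipOn J) := by
  refine measurable_pi_lambda _ fun k => ?_
  unfold flipOn
  split_ifs <;> fun_prop

end Measurability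

/-! ### First moment bounds for gapped pairs -/

section FirstMoment

variable {N : ℕ}

theorem measureReal_exists_le_card_mul {α κ : Type*} [MeasurableSpace α] (μ : Measure α)
    [IsFiniteMeasure μ] (s : Finset κ) (A : κ → Set α) {ε : ℝ} (h : ∀ k ∈ s, μ.real (A k) ≤ ε) :
    μ.real {a | ∃ k ∈ s, a ∈ A k} ≤ s.card * ε := by
  have : {a | ∃ k ∈ s, a ∈ A k} = ⋃ k ∈ s, A k := by ext; simp
  rw [this]
  refine (measureReal_biUnion_finset_le s A).trans ?_
  calc _ ≤ ∑ k ∈ s, ε := Finset.sum_le_sum h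
    _ = _ := by simp

theorem ouPair_real_apply {E : Type*} [NormedAddCommGroup E] [InnerProductSpace ℝ E]
    [FiniteDimensional ℝ E] [MeasurableSpace E] [BorelSpace E] (q : ℝ) {S : Set (E × E)}
    (hS : MeasurableSet S) : (ouPair E q).real S =
      ((stdGaussian E).prod (stdGaussian E)).real {p | (p.1, ouStep q p.1 p.2) ∈ S} := by
  rw [ouPair, map_measureReal_apply (by fun_prop) hS]; rfl

theorem prod_real_fst {α β : Type*} [MeasurableSpace α] [MeasurableSpace β] (μ : Measure α)
    (ν : Measure β) [IsProbabilityMeasure μ] [IsProbabilityMeasure ν] (S : Set α) :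
    (μ.prod ν).real {p | p.1 ∈ S} = μ.real S := by
  have : {p : α × β | p.1 ∈ S} = S ×ˢ Set.univ := by ext; simp
  rw [this, measureReal_prod_prod]; simp

/-- Gapped states of two correlated disorders are unlikely to have an intermediate distance. -/
theorem ouPair_gapped_annulus_le {B : Disorder N → Fin N → ℝ} (hB : Measurable B)
    (hs : ∀ g, IsSpin (B g)) {γ δ ρ q v : ℝ} (hγ : 0 < γ) (hρ0 : 0 < ρ) (hρ1 : ρ ≤ 1)
    (hδ : δ ≤ ρ / 8) (hq0 : 0 ≤ q) (hq1 : q ≤ 1) (hv0 : 0 < v) (hv : 1 - q ^ 2 ≤ v)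
    (hN : 0 < N) :
    (ouPair (Disorder N) q).real {p | B p.1 ∈ gappedStates γ δ p.1 ∧
      B p.2 ∈ gappedStates γ δ p.2 ∧ ρ / 2 * N < hammingDist (B p.1) (B p.2) ∧
      hammingDist (B p.1) (B p.2) ≤ ρ * N} ≤
      Real.exp (3 * entropyBound ρ * N - γ ^ 2 * N / 512) +
      Real.exp (2 * entropyBound ρ * N - γ ^ 2 * ρ * N / (128 * v)) := by
  classical
  have hN' : (0 : ℝ) < N := by exact_mod_cast hN
  have hmeas : MeasurableSet {p : Disorder N × Disorder N | B p.1 ∈ gappedStates γ δ p.1 ∧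
      B p.2 ∈ gappedStates γ δ p.2 ∧ ρ / 2 * N < hammingDist (B p.1) (B p.2) ∧
      hammingDist (B p.1) (B p.2) ≤ ρ * N} := by
    have hd := measurable_hammingDist (hB.comp (measurable_fst (β := Disorder N)))
      (hB.comp (measurable_snd (α := Disorder N)))
    exact (measurableSet_gapped γ δ measurable_fst (hB.comp measurable_fst)).inter
      ((measurableSet_gapped γ δ measurable_snd (hB.comp measurable_snd)).inter
      ((measurableSet_lt measurable_const hd).inter (measurableSet_le hd measurable_const)))
  rw [ouPair_real_apply q hmeas]
  set F := fewSites N ρ with hF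
  -- The interactions inside `I` see only the spins on `I`, recorded by the small set `P ∩ I`. Three
  -- small sets replace an enumeration of all configurations; each costs `entropyBound ρ`.
  let A₁ : Finset (Fin N) × Finset (Fin N) × Finset (Fin N) → Set (Disorder N) := fun k =>
    {g | γ * ρ * N / 8 ≤ ⟪coupling (restrictTo k.2.1 (signOn k.2.2))
      (restrictTo k.1 (signOn k.2.2)), g⟫}
  -- The configuration `B p.1` is independent of the innovation `p.2`, so the union runs over `I`
  -- and `J` only.
  let A₂ : Finset (Fin N) × Finset (Fin N) → Set (Disorder N × Disorder N) := fun k =>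
    {p | γ * ρ * N / 4 ≤
      ⟪-(√(1 - q ^ 2) • coupling (restrictTo k.2 (B p.1)) (flipOn k.1 (B p.1))), p.2⟫}
  have hsub : {p : Disorder N × Disorder N | (p.1, ouStep q p.1 p.2) ∈
      {p : Disorder N × Disorder N | B p.1 ∈ gappedStates γ δ p.1 ∧
      B p.2 ∈ gappedStates γ δ p.2 ∧ ρ / 2 * N < hammingDist (B p.1) (B p.2) ∧
      hammingDist (B p.1) (B p.2) ≤ ρ * N}} ⊆
      {p | p.1 ∈ {g | ∃ k ∈ F ×ˢ F ×ˢ F, g ∈ A₁ k}} ∪ {p | ∃ k ∈ F ×ˢ F, p ∈ A₂ k} := by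
    rintro ⟨g, z⟩ ⟨h1, h2, h3, h4⟩
    simp only at h1 h2 h3 h4
    obtain ⟨I, J, hI, -, hJI, hJ, hor⟩ := gapped_pair_dichotomy hq0 h1 h2
    have hIF : I ∈ F := by rw [hF, mem_fewSites, hI]; exact h4
    have hJle : (J.card : ℝ) ≤ I.card := by exact_mod_cast Finset.card_le_card hJI
    have hJF : J ∈ F := by
      rw [hF, mem_fewSites]; rw [hF, mem_fewSites] at hIF; exact hJle.trans hIF
    have hJc : ρ * N / 4 ≤ J.card := by
      rw [hI] at hJ
      have : 2 * δ * N ≤ ρ / 4 * N := by gcongr; linarith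
      linarith
    rcases hor with h | h
    · left
      obtain ⟨P, hP⟩ := (hs g).exists_signOn
      have hPI : ∀ K ⊆ I, restrictTo K (B g) = restrictTo K (signOn (P ∩ I)) := by
        intro K hK
        ext i
        unfold restrictTo
        split_ifs with hi
        · rw [hP]; simp [signOn, hK hi]
        · rfl
      refine ⟨(I, J, P ∩ I), ?_, ?_⟩
      · simp only [Finset.mem_product]
        refine ⟨hIF, hJF, ?_⟩
        rw [hF, mem_fewSites] at hIF ⊢
        have : ((P ∩ I).card : ℝ) ≤ I.card := by
          exact_mod_cast Finset.card_le_card Finset.inter_subset_right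
        exact this.trans hIF
      · simp only [A₁, Set.mem_ofPred_eq]
        rw [← hPI I subset_rfl, ← hPI J hJI]
        refine le_trans ?_ h
        have := mul_le_mul_of_nonneg_left hJc hγ.le
        linarith
    · right
      refine ⟨(I, J), Finset.mem_product.2 ⟨hIF, hJF⟩, ?_⟩
      simp only [A₂, Set.mem_ofPred_eq]
      refine le_trans ?_ h
      have := mul_le_mul_of_nonneg_left hJc hγ.le
      linarith
  refine (measureReal_mono hsub).trans ((measureReal_union_le _ _).trans (add_le_add ?_ ?_))
  · rw [prod_real_fst]
    refine (measureReal_exists_le_card_mul (stdGaussian (Disorder N)) (F ×ˢ F ×ˢ F) A₁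
      (ε := Real.exp (-(γ ^ 2 * N / 512))) ?_).trans ?_
    · intro k hk
      simp only [Finset.mem_product, hF, mem_fewSites] at hk
      -- Against the variance bound `4ρ²N` the threshold `γρN/8` costs `exp (-γ²N/512)`. The
      -- cancellation of `ρ` lets a small `ρ` make the entropy negligible.
      have hb := stdGaussian_inner_ge_le (coupling (restrictTo k.2.1 (signOn k.2.2))
        (restrictTo k.1 (signOn k.2.2))) (t := γ * ρ * N / 8) (v := 4 * ρ ^ 2 * N)
        (by positivity) (by positivity) (by
          refine (norm_coupling_restrict_restrict_sq_le _ _ (isSpin_signOn _)).trans ?_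
          rw [div_le_iff₀ hN']
          calc 4 * (k.2.1.card : ℝ) * k.1.card ≤ 4 * (ρ * N) * (ρ * N) := by
                gcongr
                · exact hk.2.1
                · exact hk.1
            _ = _ := by ring)
      refine hb.trans (le_of_eq ?_)
      congr 2
      field_simp
      ring
    · have hc := card_fewSites_le N hρ0 hρ1
      rw [Finset.card_product, Finset.card_product]
      push_cast
      calc _ ≤ (Real.exp (entropyBound ρ * N) * (Real.exp (entropyBound ρ * N) *
            Real.exp (entropyBound ρ * N))) * Real.exp (-(γ ^ 2 * N / 512)) := by gcongr
        _ = _ := by simp only [← Real.exp_add]; congr 1; ring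
  · refine (measureReal_exists_le_card_mul _ (F ×ˢ F) A₂
      (ε := Real.exp (-(γ ^ 2 * ρ * N / (128 * v)))) ?_).trans ?_
    · intro k hk
      simp only [Finset.mem_product, hF, mem_fewSites] at hk
      have hmc : Measurable fun g => -(√(1 - q ^ 2) •
          coupling (restrictTo k.2 (B g)) (flipOn k.1 (B g))) := by
        have h : Measurable fun g => coupling (restrictTo k.2 (B g)) (flipOn k.1 (B g)) :=
          measurable_coupling ((measurable_restrictTo k.2).comp hB)
            ((measurable_flipOn k.1).comp hB)
        fun_prop
      have hb := prod_inner_ge_le hmc (t := γ * ρ * N / 4) (v := 4 * v * ρ * N)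
        (by positivity) (by positivity) (by
          intro g
          rw [norm_neg, norm_smul, mul_pow, Real.norm_eq_abs, sq_abs,
            Real.sq_sqrt (one_sub_sq_nonneg hq0 hq1)]
          calc (1 - q ^ 2) * ‖coupling (restrictTo k.2 (B g)) (flipOn k.1 (B g))‖ ^ 2
              ≤ v * (4 * k.2.card) := by
                gcongr
                exact norm_coupling_restrict_sq_le _ (hs g) ((hs g).flipOn _)
            _ ≤ v * (4 * (ρ * N)) := by gcongr; exact hk.2
            _ = _ := by ring)
      refine hb.trans (le_of_eq ?_)
      congr 2
      field_simp
      ring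
    · have hc := card_fewSites_le N hρ0 hρ1
      rw [Finset.card_product]
      push_cast
      calc _ ≤ (Real.exp (entropyBound ρ * N) * Real.exp (entropyBound ρ * N)) *
            Real.exp (-(γ ^ 2 * ρ * N / (128 * v))) := by gcongr
        _ = _ := by simp only [← Real.exp_add]; congr 1; ring

/-- Gapped states of two nearly independent disorders are unlikely to be close. -/
theorem ouPair_gapped_close_le {B : Disorder N → Fin N → ℝ} (hB : Measurable B)
    (hs : ∀ g, IsSpin (B g)) {γ δ ρ q : ℝ} (hγ : 0 < γ) (hρ0 : 0 < ρ) (hρ1 : ρ ≤ 1 / 2)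
    (hδ : δ ≤ ρ) (hq0 : 0 ≤ q) (hq1 : q ≤ 1) (hq : q ≤ γ / 16) (hN : 0 < N) :
    (ouPair (Disorder N) q).real {p | B p.2 ∈ gappedStates γ δ p.2 ∧
      hammingDist (B p.1) (B p.2) ≤ ρ * N} ≤
      Real.exp (-(N / 2)) + Real.exp (2 * entropyBound ρ * N - γ ^ 2 * N / 128) := by
  classical
  have hN' : (0 : ℝ) < N := by exact_mod_cast hN
  have hmeas : MeasurableSet {p : Disorder N × Disorder N | B p.2 ∈ gappedStates γ δ p.2 ∧
      hammingDist (B p.1) (B p.2) ≤ ρ * N} := by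
    have hd := measurable_hammingDist (hB.comp (measurable_fst (β := Disorder N)))
      (hB.comp (measurable_snd (α := Disorder N)))
    exact (measurableSet_gapped γ δ measurable_snd (hB.comp measurable_snd)).inter
      (measurableSet_le hd measurable_const)
  rw [ouPair_real_apply q hmeas]
  set F := fewSites N ρ with hF
  -- All `4 ^ N` choices of sites and configuration are affordable: threshold `4N` against variance
  -- `4N` gives `exp (-2N)`, and `2 log 2 < 3/2` leaves `exp (-N/2)`.
  let A₁ : Finset (Fin N) × Finset (Fin N) → Set (Disorder N) := fun k =>
    {g | 4 * (N : ℝ) ≤ ⟪coupling (restrictTo k.1 (signOn k.2)) (signOn k.2), g⟫}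
  -- Closeness expresses `B p.2` as `B p.1` with a small set `k.1` flipped. The direction then
  -- depends only on `p.1` and on two small sets.
  let A₂ : Finset (Fin N) × Finset (Fin N) → Set (Disorder N × Disorder N) := fun k =>
    {p | γ * N / 4 ≤
      ⟪√(1 - q ^ 2) • coupling (restrictTo k.2ᶜ (flipOn k.1 (B p.1))) (flipOn k.1 (B p.1)), p.2⟫}
  have hsub : {p : Disorder N × Disorder N | (p.1, ouStep q p.1 p.2) ∈
      {p : Disorder N × Disorder N | B p.2 ∈ gappedStates γ δ p.2 ∧
      hammingDist (B p.1) (B p.2) ≤ ρ * N}} ⊆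
      {p | p.1 ∈ {g | ∃ k ∈ (Finset.univ : Finset (Finset (Fin N) × Finset (Fin N))), g ∈ A₁ k}} ∪
      {p | ∃ k ∈ F ×ˢ F, p ∈ A₂ k} := by
    rintro ⟨g, z⟩ ⟨h2, h4⟩
    simp only at h2 h4
    obtain ⟨D, hD, hor⟩ := gapped_dichotomy_of_small_corr hγ (by linarith) hq0 hq h2
    rcases hor with h | h
    · left
      obtain ⟨P, hP⟩ := (hs (ouStep q g z)).exists_signOn
      refine ⟨(Dᶜ, P), Finset.mem_univ _, ?_⟩
      simp only [A₁, Set.mem_ofPred_eq]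
      rw [← hP]
      exact h
    · right
      obtain ⟨I, hI, hflip⟩ := exists_flipOn (hs g) (hs (ouStep q g z))
      refine ⟨(I, D), Finset.mem_product.2 ⟨?_, ?_⟩, ?_⟩
      · rw [hF, mem_fewSites, hI]; exact h4
      · rw [mem_fewSites] at hD
        rw [hF, mem_fewSites]
        exact hD.trans (by gcongr)
      · simp only [A₂, Set.mem_ofPred_eq]
        rw [← hflip]
        exact h
  refine (measureReal_mono hsub).trans ((measureReal_union_le _ _).trans (add_le_add ?_ ?_))
  · rw [prod_real_fst]
    refine (measureReal_exists_le_card_mul (stdGaussian (Disorder N)) Finset.univ A₁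
      (ε := Real.exp (-(2 * N))) ?_).trans ?_
    · intro k hk
      have hb := stdGaussian_inner_ge_le (coupling (restrictTo k.1 (signOn k.2))
        (signOn k.2)) (t := 4 * N) (v := 4 * N)
        (by positivity) (by positivity) (by
          refine (norm_coupling_restrict_sq_le _ (isSpin_signOn _) (isSpin_signOn _)).trans ?_
          have := Finset.card_le_univ k.1
          simp only [Fintype.card_fin] at this
          gcongr)
      refine hb.trans (le_of_eq ?_)
      congr 2
      field_simp
      norm_num
    · have h4 : ((Finset.univ : Finset (Finset (Fin N) × Finset (Fin N))).card : ℝ) =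
          Real.exp (2 * Real.log 2 * N) := by
        rw [Finset.card_univ, Fintype.card_prod, Fintype.card_finset, Fintype.card_fin]
        push_cast
        rw [mul_comm (2 * Real.log 2), Real.exp_nat_mul, mul_comm 2 (Real.log 2), Real.exp_mul,
          Real.exp_log two_pos, ← mul_pow]
        norm_num
      rw [h4, ← Real.exp_add]
      apply Real.exp_le_exp.2
      have := Real.log_two_lt_d9
      nlinarith
  · refine (measureReal_exists_le_card_mul _ (F ×ˢ F) A₂
      (ε := Real.exp (-(γ ^ 2 * N / 128))) ?_).trans ?_
    · intro k hk
      have hmf : Measurable fun g => flipOn k.1 (B g) := (measurable_flipOn k.1).comp hB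
      have hmc : Measurable fun g => √(1 - q ^ 2) •
          coupling (restrictTo k.2ᶜ (flipOn k.1 (B g))) (flipOn k.1 (B g)) := by
        have h : Measurable fun g =>
            coupling (restrictTo k.2ᶜ (flipOn k.1 (B g))) (flipOn k.1 (B g)) :=
          measurable_coupling ((measurable_restrictTo k.2ᶜ).comp hmf) hmf
        fun_prop
      have hb := prod_inner_ge_le hmc (t := γ * N / 4) (v := 4 * N)
        (by positivity) (by positivity) (by
          intro g
          rw [norm_smul, mul_pow, Real.norm_eq_abs, sq_abs,
            Real.sq_sqrt (one_sub_sq_nonneg hq0 hq1)]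
          have := Finset.card_le_univ k.2ᶜ
          simp only [Fintype.card_fin] at this
          calc (1 - q ^ 2) * ‖coupling (restrictTo k.2ᶜ (flipOn k.1 (B g))) _‖ ^ 2
              ≤ 1 * (4 * (k.2ᶜ.card : ℝ)) := by
                gcongr
                · nlinarith
                · exact norm_coupling_restrict_sq_le _ ((hs g).flipOn _) ((hs g).flipOn _)
            _ ≤ 1 * (4 * N) := by gcongr
            _ = _ := by ring)
      refine hb.trans (le_of_eq ?_)
      congr 2
      field_simp
      norm_num
    · have hc := card_fewSites_le N hρ0 (hρ1.trans (by norm_num))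
      rw [Finset.card_product]
      push_cast
      calc _ ≤ (Real.exp (entropyBound ρ * N) * Real.exp (entropyBound ρ * N)) *
            Real.exp (-(γ ^ 2 * N / 128)) := by gcongr
        _ = _ := by simp only [← Real.exp_add]; congr 1; ring

end FirstMoment

/-! ### From the overlap gap to a bound by one-step instability -/

section Chain

variable {N : ℕ}

/-- A path with short steps that avoids intermediate distances over windows of length `b` stays
close to its starting point. -/
theorem hammingDist_le_of_gap {σ : ℕ → Fin N → ℝ} {b j : ℕ} {η : ℝ} (hη : 0 ≤ η)
    (hstep : ∀ k < j * b, (hammingDist (σ k) (σ (k + 1)) : ℝ) ≤ η)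
    (hgap : ∀ s t, s ≤ t → t ≤ s + b → t ≤ j * b → η < hammingDist (σ s) (σ t) →
      2 * η < hammingDist (σ s) (σ t)) :
    (hammingDist (σ 0) (σ (j * b)) : ℝ) ≤ j * η := by
  have hwin : ∀ s n, n ≤ b → s + n ≤ j * b → (hammingDist (σ s) (σ (s + n)) : ℝ) ≤ η := by
    intro s n
    induction n with
    | zero => intro _ _; simpa using hη
    | succ n ih =>
      intro hn hs
      by_contra hcon
      push Not at hcon
      -- The first time the distance exceeded `η` it would exceed `2η`, although it was at most `η`
      -- before and one step adds at most `η`.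
      have h1 := hgap s (s + (n + 1)) (by omega) (by omega) hs hcon
      have h2 := ih (by omega) (by omega)
      have h3 := hstep (s + n) (by omega)
      have h4 : (hammingDist (σ s) (σ (s + (n + 1))) : ℝ) ≤
          hammingDist (σ s) (σ (s + n)) + hammingDist (σ (s + n)) (σ (s + n + 1)) := by
        exact_mod_cast hammingDist_triangle _ _ _
      linarith
  have hacc : ∀ i ≤ j, (hammingDist (σ 0) (σ (i * b)) : ℝ) ≤ i * η := by
    intro i
    induction i with
    | zero => intro _; simp
    | succ i ih =>
      intro hi
      have h1 := ih (by omega)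
      have hle : (i + 1) * b ≤ j * b := Nat.mul_le_mul_right b hi
      have h2 := hwin (i * b) b le_rfl (by rw [← Nat.succ_mul]; exact hle)
      have h4 : (hammingDist (σ 0) (σ ((i + 1) * b)) : ℝ) ≤
          hammingDist (σ 0) (σ (i * b)) + hammingDist (σ (i * b)) (σ (i * b + b)) := by
        rw [Nat.succ_mul]
        exact_mod_cast hammingDist_triangle _ _ _
      push_cast
      linarith
  exact hacc j le_rfl

/-- Bounds the union over pairs of times by `5 ^ K`, so that taking the `K`-th root costs only a
factor `5`. -/
theorem sq_add_one_le_five_pow {n : ℕ} (hn : 1 ≤ n) : ((n : ℝ) + 1) ^ 2 + 1 ≤ 5 ^ n := by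
  induction n, hn using Nat.le_induction with
  | base => norm_num
  | succ n hn ih =>
    have : (1 : ℝ) ≤ n := by exact_mod_cast hn
    rw [pow_succ (5 : ℝ)]
    push_cast
    nlinarith

/-- Let `A` be the set of edges with both ends gapped and a short move. Positive correlation bounds
`P(S)²` by the probability of a long move plus `P(A)`. By the path inequality, `P(A) ^ K` is at most
the probability that all `K` edges lie in `A`. Such a path either has two times within one window at
an intermediate distance, or, after `r` windows, ends at a gapped state close to its start. Both are
rare, and a `K`-th root finishes. -/
theorem success_sq_le_of_gap {B : Disorder N → Fin N → ℝ} (hB : Measurable B)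
    {γ δ ρ ρ' q ε : ℝ} {r b : ℕ} {m : ℕ} (hm : r * b = 2 ^ m) (hρ : 0 ≤ ρ)
    (hρ' : r * (ρ / 2) ≤ ρ') (hq0 : 0 ≤ q) (hq1 : q ≤ 1) (hε : 0 ≤ ε)
    (hann : ∀ n ≤ b, (ouPair (Disorder N) (q ^ n)).real {p | B p.1 ∈ gappedStates γ δ p.1 ∧
      B p.2 ∈ gappedStates γ δ p.2 ∧ ρ / 2 * N < hammingDist (B p.1) (B p.2) ∧
      hammingDist (B p.1) (B p.2) ≤ ρ * N} ≤ ε)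
    (hclose : (ouPair (Disorder N) (q ^ 2 ^ m)).real {p | B p.2 ∈ gappedStates γ δ p.2 ∧
      hammingDist (B p.1) (B p.2) ≤ ρ' * N} ≤ ε) :
    ((stdGaussian (Disorder N)).real {g | B g ∈ gappedStates γ δ g}) ^ 2 ≤
      (ouPair (Disorder N) q).real {p | ρ / 2 * N < hammingDist (B p.1) (B p.2)} +
      5 * ε ^ ((1 : ℝ) / 2 ^ m) := by
  have hd : Measurable fun p : Disorder N × Disorder N =>
      (hammingDist (B p.1) (B p.2) : ℝ) := measurable_hammingDist
    (hB.comp (measurable_fst (β := Disorder N))) (hB.comp (measurable_snd (α := Disorder N)))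
  have hS : MeasurableSet {g | B g ∈ gappedStates γ δ g} :=
    measurableSet_gapped γ δ measurable_id hB
  set S := {g | B g ∈ gappedStates γ δ g} with hSdef
  set K := 2 ^ m with hK
  set A : Set (Disorder N × Disorder N) :=
    (S ×ˢ S) ∩ {p | (hammingDist (B p.1) (B p.2) : ℝ) ≤ ρ / 2 * N} with hA
  have hAm : MeasurableSet A := (hS.prod hS).inter (measurableSet_le hd measurable_const)
  have hAsymm : ∀ p, p.swap ∈ A ↔ p ∈ A := by
    rintro ⟨x, y⟩
    simp only [hA, Prod.swap_prod_mk, Set.mem_inter_iff, Set.mem_prod, Set.mem_ofPred_eq,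
      hammingDist_comm (B y) (B x)]
    tauto
  let C : ℕ × ℕ → Set (ℕ → Disorder N) := fun k => {ω | k.1 ≤ k.2 ∧ k.2 ≤ k.1 + b ∧
    (ω k.1, ω k.2) ∈ {p : Disorder N × Disorder N | B p.1 ∈ gappedStates γ δ p.1 ∧
      B p.2 ∈ gappedStates γ δ p.2 ∧ ρ / 2 * N < hammingDist (B p.1) (B p.2) ∧
      hammingDist (B p.1) (B p.2) ≤ ρ * N}}
  let C' : Set (ℕ → Disorder N) := {ω | (ω 0, ω K) ∈ {p : Disorder N × Disorder N |
    B p.2 ∈ gappedStates γ δ p.2 ∧ hammingDist (B p.1) (B p.2) ≤ ρ' * N}}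
  have hsub : {ω : ℕ → Disorder N | ∀ k < K, (ω k, ω (k + 1)) ∈ A} ⊆
      {ω | ∃ k ∈ Finset.range (K + 1) ×ˢ Finset.range (K + 1), ω ∈ C k} ∪ C' := by
    intro ω hω
    by_contra hcon
    simp only [Set.mem_union, not_or] at hcon
    obtain ⟨h1, h2⟩ := hcon
    have hKpos : 0 < K := by positivity
    have hgood : ∀ k ≤ K, ω k ∈ S := by
      intro k hk
      rcases Nat.lt_or_eq_of_le hk with h | h
      · exact (hω k h).1.1
      · obtain ⟨l, rfl⟩ : ∃ l, k = l + 1 := ⟨k - 1, by omega⟩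
        exact (hω l (by omega)).1.2
    apply h2
    refine ⟨hgood K le_rfl, ?_⟩
    have := hammingDist_le_of_gap (σ := fun k => B (ω k)) (b := b) (j := r) (η := ρ / 2 * N)
      (by positivity) (fun k hk => (hω k (by omega)).2) (by
        intro s t hst htb ht hlt
        by_contra hcon
        push Not at hcon
        refine h1 ⟨(s, t), ?_, hst, htb, hgood s (by omega), hgood t (by omega), hlt, ?_⟩
        · simp only [Finset.mem_product, Finset.mem_range]; omega
        · linarith)
    rw [hm] at this
    refine this.trans ?_
    rw [← mul_assoc]
    gcongr
  have hAnn : MeasurableSet {p : Disorder N × Disorder N | B p.1 ∈ gappedStates γ δ p.1 ∧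
      B p.2 ∈ gappedStates γ δ p.2 ∧ ρ / 2 * N < hammingDist (B p.1) (B p.2) ∧
      hammingDist (B p.1) (B p.2) ≤ ρ * N} :=
    (measurableSet_gapped γ δ measurable_fst (hB.comp measurable_fst)).inter
      ((measurableSet_gapped γ δ measurable_snd (hB.comp measurable_snd)).inter
      ((measurableSet_lt measurable_const hd).inter (measurableSet_le hd measurable_const)))
  have hClose : MeasurableSet {p : Disorder N × Disorder N | B p.2 ∈ gappedStates γ δ p.2 ∧
      hammingDist (B p.1) (B p.2) ≤ ρ' * N} :=
    (measurableSet_gapped γ δ measurable_snd (hB.comp measurable_snd)).inter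
      (measurableSet_le hd measurable_const)
  have hpath : (pathLaw (Disorder N) q K).real {ω | ∀ k < K, (ω k, ω (k + 1)) ∈ A} ≤
      (((K : ℝ) + 1) ^ 2 + 1) * ε := by
    refine (measureReal_mono hsub).trans ((measureReal_union_le _ _).trans ?_)
    rw [add_mul]
    refine add_le_add ?_ ?_
    · refine (measureReal_exists_le_card_mul _ _ C (ε := ε) ?_).trans (le_of_eq ?_)
      · rintro ⟨s, t⟩ hst
        simp only [Finset.mem_product, Finset.mem_range] at hst
        by_cases h : s ≤ t ∧ t ≤ s + b
        · refine le_trans ?_ (hann (t - s) (by omega))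
          rw [← pathLaw_map_pair_of_le hq0 hq1 h.1 (by omega : t ≤ K)]
          rw [map_measureReal_apply (by fun_prop) hAnn]
          exact measureReal_mono fun ω hω => hω.2.2
        · have : C (s, t) = ∅ := by
            ext ω
            simp only [C, Set.mem_ofPred_eq, Set.mem_empty_iff_false, iff_false]
            tauto
          rw [this]; simpa using hε
      · rw [Finset.card_product, Finset.card_range]; push_cast; ring
    · rw [one_mul]
      refine le_trans ?_ hclose
      have h := pathLaw_map_pair_of_le (E := Disorder N) hq0 hq1 (Nat.zero_le K) le_rfl
      rw [Nat.sub_zero] at h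
      rw [← h, map_measureReal_apply (by fun_prop) hClose]
      exact measureReal_mono fun ω hω => hω
  have hpow := ouPair_pow_le_pathLaw hq0 hq1 hAm hAsymm m
  have hpow' : ((ouPair (Disorder N) q).real A) ^ K ≤ (((K : ℝ) + 1) ^ 2 + 1) * ε := by
    refine le_trans ?_ hpath
    rw [measureReal_def, measureReal_def, ← ENNReal.toReal_pow]
    exact ENNReal.toReal_mono (measure_ne_top _ _) hpow
  have hroot : (ouPair (Disorder N) q).real A ≤ 5 * ε ^ ((1 : ℝ) / 2 ^ m) := by
    have hK1 : 1 ≤ K := Nat.one_le_two_pow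
    have hK2 := sq_add_one_le_five_pow hK1
    refine (pow_le_pow_iff_left₀ measureReal_nonneg (by positivity) (by omega : K ≠ 0)).1 ?_
    refine hpow'.trans ?_
    rw [mul_pow, ← Real.rpow_natCast (ε ^ ((1 : ℝ) / 2 ^ m)), ← Real.rpow_mul hε]
    have hone : (1 : ℝ) / 2 ^ m * (K : ℕ) = 1 := by
      rw [hK]; push_cast; field_simp
    rw [hone, Real.rpow_one]
    gcongr
  have hmain : (stdGaussian (Disorder N)).real S ^ 2 ≤ (ouPair (Disorder N) q).real (S ×ˢ S) := by
    rw [measureReal_def, measureReal_def, ← ENNReal.toReal_pow]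
    exact ENNReal.toReal_mono (measure_ne_top _ _) (sq_measure_le_ouPair hq0 hq1 hS)
  refine hmain.trans ?_
  have hcov : S ×ˢ S ⊆ {p | ρ / 2 * N < (hammingDist (B p.1) (B p.2) : ℝ)} ∪ A := by
    intro p hp
    by_cases h : ρ / 2 * N < (hammingDist (B p.1) (B p.2) : ℝ)
    · exact Or.inl h
    · exact Or.inr ⟨hp, not_lt.1 h⟩
  refine (measureReal_mono hcov).trans ((measureReal_union_le _ _).trans ?_)
  gcongr

theorem tendsto_entropyBound : Tendsto entropyBound (𝓝[>] 0) (𝓝 0) := by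
  have h1 : Tendsto (fun ρ : ℝ => Real.log ρ * ρ) (𝓝[>] 0) (𝓝 0) :=
    by
    simpa using tendsto_log_mul_rpow_nhdsGT_zero one_pos
  have h2 : Tendsto (fun ρ : ℝ => ρ) (𝓝[>] 0) (𝓝 0) := tendsto_nhdsWithin_of_tendsto_nhds tendsto_id
  have := h2.sub h1
  simp only [sub_zero] at this
  refine this.congr fun ρ => ?_
  unfold entropyBound; ring

/-- The success probability of a deterministic map to the hypercube is controlled by its
instability along one step of a fine Gaussian chain. -/
theorem exists_success_sq_le {γ : ℝ} (hγ : 0 < γ) : ∃ δ ρ T c : ℝ, ∃ r : ℕ, 0 < δ ∧ 0 < ρ ∧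
    0 < T ∧ 0 < c ∧ ∀ N : ℕ, 0 < N → ∀ B : Disorder N → Fin N → ℝ, Measurable B →
    (∀ g, IsSpin (B g)) → ∀ m : ℕ, r ≤ m →
    ((stdGaussian (Disorder N)).real {g | B g ∈ gappedStates γ δ g}) ^ 2 ≤
      (ouPair (Disorder N) (Real.exp (-(T / 2 ^ m)))).real
        {p | ρ * N < hammingDist (B p.1) (B p.2)} + 10 * Real.exp (-(c * N / 2 ^ m)) := by
  -- Total time of the chain, long enough that the end-to-end correlation `exp (-T)` is at most `γ /
  -- 16`.
  set T := |Real.log (16 / γ)| + 1 with hT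
  have hTpos : 0 < T := by positivity
  have hexpT : Real.exp (-T) ≤ γ / 16 := by
    have h1 : Real.log (16 / γ) ≤ T := (le_abs_self _).trans (by linarith)
    rw [Real.exp_neg, inv_le_comm₀ (Real.exp_pos _) (by positivity), inv_div]
    calc 16 / γ = Real.exp (Real.log (16 / γ)) := (Real.exp_log (by positivity)).symm
      _ ≤ _ := Real.exp_le_exp.2 h1
  have hent : ∀ x : ℝ, 0 < x → ∀ᶠ ρ in 𝓝[>] (0 : ℝ), entropyBound ρ < x := fun x hx =>
    tendsto_entropyBound.eventually_lt_const hx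
  have hsmall : ∀ x : ℝ, 0 < x → ∀ᶠ ρ in 𝓝[>] (0 : ℝ), ρ < x := fun x hx =>
    (tendsto_nhdsWithin_of_tendsto_nhds tendsto_id).eventually_lt_const hx
  have hposv : ∀ᶠ ρ in 𝓝[>] (0 : ℝ), 0 < ρ := eventually_mem_nhdsWithin
  -- `ρ'` is the total displacement still incompatible with being gapped at the far end: its entropy
  -- is dominated by `γ² N / 128`.
  obtain ⟨ρ', hρ'0, hρ'1, hρ'2⟩ := (hposv.and ((hsmall (1 / 2) (by norm_num)).and
    (hent (γ ^ 2 / 512) (by positivity)))).exists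
  -- `hρ2` lets the entropy lose against the `ρ`-free exponent. `hρ3` and `hρ4` keep the
  -- displacement accumulated over all windows below `ρ'`, which is possible because `entropyBound ρ
  -- → 0`.
  obtain ⟨ρ, hρ0, hρ1, hρ2, hρ3, hρ4⟩ := (hposv.and ((hsmall ρ' hρ'0).and
    ((hent (γ ^ 2 / 3072) (by positivity)).and ((hsmall (ρ' / 2) (by positivity)).and
    (hent (ρ' / 2 / (768 * T / γ ^ 2)) (by positivity)))))).exists
  have hlog : Real.log ρ ≤ 0 := Real.log_nonpos hρ0.le (by linarith)
  have hEpos : 0 < entropyBound ρ := mul_pos hρ0 (by linarith)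
  -- With `2 ^ (r + 1)` windows, `1 - q²` within a window is at most `2T / 2 ^ (r + 1) ≤ γ² / (384
  -- (1 - log ρ))`, so the innovation exponent is at least `3 * entropyBound ρ`. The upper bound on
  -- `2 ^ r` limits the accumulated displacement.
  obtain ⟨r, hr1, hr2⟩ := exists_nat_pow_near (x := 768 * T * (1 - Real.log ρ) / γ ^ 2 + 1)
    (by have : 0 ≤ 768 * T * (1 - Real.log ρ) / γ ^ 2 := by
          apply div_nonneg _ (by positivity); apply mul_nonneg (by positivity); linarith
        linarith) one_lt_two
  -- Each entry is the margin left in one of the first moment exponents after the entropy is paid.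
  set c := min (γ ^ 2 / 1024) (min (entropyBound ρ) (1 / 2)) with hc
  have hcpos : 0 < c := by
    rw [hc]; refine lt_min (by positivity) (lt_min hEpos (by norm_num))
  have hc1 : c ≤ γ ^ 2 / 1024 := min_le_left _ _
  have hc2 : c ≤ entropyBound ρ := (min_le_right _ _).trans (min_le_left _ _)
  have hc3 : c ≤ 1 / 2 := (min_le_right _ _).trans (min_le_right _ _)
  refine ⟨ρ / 8, ρ / 2, T, c, r + 1, by positivity, by positivity, hTpos, hcpos, ?_⟩
  intro N hN B hB hs m hm
  have hN' : (0 : ℝ) < N := by exact_mod_cast hN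
  set q := Real.exp (-(T / 2 ^ m)) with hq
  have hq0 : 0 ≤ q := (Real.exp_pos _).le
  have hq1 : q ≤ 1 := Real.exp_le_one_iff.2 (by have : 0 < T / 2 ^ m := by positivity
                                                linarith)
  have hqpow : ∀ n : ℕ, q ^ n = Real.exp (-(T * (n / 2 ^ m))) := by
    intro n; rw [hq, ← Real.exp_nat_mul]; congr 1; ring
  have hbm : 2 ^ (r + 1) * 2 ^ (m - (r + 1)) = 2 ^ m := by
    rw [← pow_add]; congr 1; omega
  have hbmR : (2 : ℝ) ^ (r + 1) * 2 ^ (m - (r + 1)) = 2 ^ m := by exact_mod_cast hbm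
  have key := success_sq_le_of_gap (γ := γ) (δ := ρ / 8) (ρ := ρ) (ρ' := ρ')
    (ε := 2 * Real.exp (-(c * N))) (r := 2 ^ (r + 1)) (b := 2 ^ (m - (r + 1))) (m := m)
    hB hbm hρ0.le ?_ hq0 hq1 (by positivity) ?_ ?_
  · refine key.trans (add_le_add le_rfl ?_)
    have h2 : ((2 : ℝ)) ^ ((1 : ℝ) / 2 ^ m) ≤ 2 := by
      calc ((2 : ℝ)) ^ ((1 : ℝ) / 2 ^ m) ≤ 2 ^ (1 : ℝ) := by
            apply Real.rpow_le_rpow_of_exponent_le one_le_two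
            rw [div_le_one (by positivity)]
            exact one_le_pow₀ one_le_two
        _ = 2 := Real.rpow_one 2
    rw [Real.mul_rpow two_pos.le (Real.exp_pos _).le, ← Real.exp_mul]
    have h3 : -(c * N) * ((1 : ℝ) / 2 ^ m) = -(c * N / 2 ^ m) := by ring
    rw [h3]
    nlinarith [Real.exp_pos (-(c * N / 2 ^ m))]
  · push_cast
    have h1 : (2 : ℝ) ^ (r + 1) * (ρ / 2) = 2 ^ r * ρ := by rw [pow_succ]; ring
    rw [h1]
    calc (2 : ℝ) ^ r * ρ ≤ (768 * T * (1 - Real.log ρ) / γ ^ 2 + 1) * ρ := by gcongr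
      _ = 768 * T / γ ^ 2 * entropyBound ρ + ρ := by unfold entropyBound; ring
      _ ≤ ρ' / 2 + ρ' / 2 := by
          gcongr
          have := (lt_div_iff₀ (by positivity)).1 hρ4
          linarith
      _ = ρ' := by ring
  · intro n hn
    set v := 2 * T / 2 ^ (r + 1) with hv
    have hvpos : 0 < v := by positivity
    have hnb : (n : ℝ) / 2 ^ m ≤ 1 / 2 ^ (r + 1) := by
      rw [div_le_div_iff₀ (by positivity) (by positivity), one_mul, ← hbmR]
      have : (n : ℝ) ≤ 2 ^ (m - (r + 1)) := by exact_mod_cast hn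
      nlinarith [pow_pos (two_pos : (0 : ℝ) < 2) (r + 1)]
    have hqv : 1 - (q ^ n) ^ 2 ≤ v := by
      rw [hqpow, ← Real.exp_nat_mul]
      have := Real.add_one_le_exp ((2 : ℕ) * -(T * (n / 2 ^ m)))
      have h5 : T * (n / 2 ^ m) ≤ T * (1 / 2 ^ (r + 1)) := by gcongr
      have h6 : v = 2 * (T * (1 / 2 ^ (r + 1))) := by rw [hv]; ring
      push_cast at this ⊢
      linarith
    refine (ouPair_gapped_annulus_le hB hs hγ hρ0 (by linarith) le_rfl (pow_nonneg hq0 n)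
      (pow_le_one₀ hq0 hq1) hvpos hqv hN).trans ?_
    rw [two_mul (Real.exp _)]
    refine add_le_add (Real.exp_le_exp.2 ?_) (Real.exp_le_exp.2 ?_)
    · have : (3 * entropyBound ρ + c) * N ≤ γ ^ 2 / 512 * N := by gcongr; linarith
      linarith
    · have hvle : v ≤ γ ^ 2 / (384 * (1 - Real.log ρ)) := by
        rw [hv, div_le_div_iff₀ (by positivity) (by
          apply mul_pos (by norm_num); linarith)]
        have h7 : 768 * T * (1 - Real.log ρ) / γ ^ 2 ≤ 2 ^ (r + 1) := by linarith
        rw [div_le_iff₀ (by positivity)] at h7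
        linarith
      have h8 : 3 * entropyBound ρ ≤ γ ^ 2 * ρ / (128 * v) := by
        rw [le_div_iff₀ (by positivity)]
        rw [le_div_iff₀ (by apply mul_pos (by norm_num); linarith)] at hvle
        unfold entropyBound
        have := mul_le_mul_of_nonneg_left hvle hρ0.le
        linarith
      have h9 : γ ^ 2 * ρ * N / (128 * v) = γ ^ 2 * ρ / (128 * v) * N := by ring
      rw [h9]
      have : (2 * entropyBound ρ + c) * N ≤ γ ^ 2 * ρ / (128 * v) * N := by gcongr; linarith
      linarith
  · have hqK : q ^ 2 ^ m ≤ γ / 16 := by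
      rw [hqpow]; push_cast; rw [div_self (by positivity), mul_one]; exact hexpT
    refine (ouPair_gapped_close_le hB hs hγ hρ'0 hρ'1.le (by linarith) (pow_nonneg hq0 _)
      (pow_le_one₀ hq0 hq1) hqK hN).trans ?_
    rw [two_mul (Real.exp _)]
    refine add_le_add (Real.exp_le_exp.2 ?_) (Real.exp_le_exp.2 ?_)
    · have : c * N ≤ 1 / 2 * N := by gcongr
      linarith
    · have : (2 * entropyBound ρ' + c) * N ≤ γ ^ 2 / 128 * N := by gcongr; linarith
      linarith

end Chain

/-! ### Randomised rounding and averaging over auxiliary randomness -/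

section Rounding

variable {N : ℕ}

instance isProbabilityMeasure_uniformThreshold :
    IsProbabilityMeasure (cond volume (Set.Icc (-1 : ℝ) 1)) :=
  cond_isProbabilityMeasure_of_finite (by simp) (by simp)

instance isProbabilityMeasure_roundingLaw (N : ℕ) : IsProbabilityMeasure (roundingLaw N) := by
  unfold roundingLaw; infer_instance

theorem isSpin_roundSpins (u : Fin N → ℝ) (x : EuclideanSpace ℝ (Fin N)) :
    IsSpin (roundSpins u x) := by
  intro i; unfold roundSpins; split_ifs <;> simp

theorem measurable_roundSpins {α : Type*} [MeasurableSpace α] {u : α → Fin N → ℝ}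
    {x : α → EuclideanSpace ℝ (Fin N)} (hu : Measurable u) (hx : Measurable x) :
    Measurable fun a => roundSpins (u a) (x a) := by
  refine measurable_pi_lambda _ fun i => ?_
  unfold roundSpins
  exact Measurable.ite (measurableSet_le (by fun_prop) (by fun_prop)) measurable_const
    measurable_const

/-- A separating threshold lies between `a` and `b`, and the uniform density is `1 / 2`. -/
theorem uniformThreshold_separates_le (a b : ℝ) :
    (cond volume (Set.Icc (-1 : ℝ) 1)).real {u | ¬(u ≤ a ↔ u ≤ b)} ≤ |a - b| / 2 := by
  have hsub : {u : ℝ | ¬(u ≤ a ↔ u ≤ b)} ⊆ Set.uIoc a b := by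
    intro u hu
    simp only [Set.mem_ofPred_eq, Set.mem_uIoc] at hu ⊢
    by_cases h1 : u ≤ a <;> by_cases h2 : u ≤ b <;> simp_all
  refine (measureReal_mono hsub).trans ?_
  rw [measureReal_def, cond_apply measurableSet_Icc, ENNReal.toReal_mul]
  have h1 : ((volume (Set.Icc (-1 : ℝ) 1))⁻¹).toReal = 1 / 2 := by
    rw [Real.volume_Icc, ENNReal.toReal_inv, ENNReal.toReal_ofReal (by norm_num)]; norm_num
  rw [h1]
  have h2 : (volume (Set.Icc (-1 : ℝ) 1 ∩ Set.uIoc a b)).toReal ≤ |a - b| := by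
    calc (volume (Set.Icc (-1 : ℝ) 1 ∩ Set.uIoc a b)).toReal ≤ (volume (Set.uIoc a b)).toReal := by
          apply ENNReal.toReal_mono
          · rw [Real.volume_uIoc]; exact ENNReal.ofReal_ne_top
          · exact measure_mono Set.inter_subset_right
      _ = |a - b| := by
          rw [Real.volume_uIoc, ENNReal.toReal_ofReal (abs_nonneg _), abs_sub_comm]
  linarith

/-- Chernoff bound for the number of coordinates separated by the random thresholds. -/
theorem roundingLaw_hammingDist_gt_le (x y : EuclideanSpace ℝ (Fin N)) (t : ℝ) :
    (roundingLaw N).real {u | t < hammingDist (roundSpins u x) (roundSpins u y)} ≤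
      Real.exp (√N * ‖x - y‖ - t) := by
  classical
  let b : Fin N → ℝ → ℝ := fun i s => if (s ≤ x i ↔ s ≤ y i) then 0 else 1
  have hbm : ∀ i, Measurable (b i) := fun i => Measurable.ite (by
    have h1 : MeasurableSet {s : ℝ | s ≤ x i} := measurableSet_Iic
    have h2 : MeasurableSet {s : ℝ | s ≤ y i} := measurableSet_Iic
    have : {s : ℝ | s ≤ x i ↔ s ≤ y i} =
      ({s : ℝ | s ≤ x i} ∩ {s : ℝ | s ≤ y i}) ∪ ({s : ℝ | s ≤ x i}ᶜ ∩ {s : ℝ | s ≤ y i}ᶜ) := by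
      ext s; simp only [Set.mem_ofPred_eq, Set.mem_union, Set.mem_inter_iff, Set.mem_compl_iff]
      tauto
    rw [this]
    exact (h1.inter h2).union (h1.compl.inter h2.compl)) measurable_const measurable_const
  have hham : ∀ u : Fin N → ℝ, (hammingDist (roundSpins u x) (roundSpins u y) : ℝ) =
      ∑ i, b i (u i) := by
    intro u
    rw [hammingDist_eq_sum]
    simp only [b, roundSpins]
    refine Finset.sum_congr rfl fun i _ => ?_
    by_cases h1 : u i ≤ x i <;> by_cases h2 : u i ≤ y i <;> simp [h1, h2] <;> norm_num
  have hb1 : ∀ i s, b i s ≤ 1 := by intro i s; simp only [b]; split_ifs <;> norm_num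
  have hint : Integrable (fun u : Fin N → ℝ => Real.exp (1 * ∑ i, b i (u i))) (roundingLaw N) := by
    refine Integrable.of_bound (C := Real.exp N) ?_ ?_
    · refine Measurable.aestronglyMeasurable ?_
      fun_prop
    · refine Eventually.of_forall fun u => ?_
      rw [Real.norm_eq_abs, abs_of_pos (Real.exp_pos _)]
      apply Real.exp_le_exp.2
      rw [one_mul]
      calc ∑ i, b i (u i) ≤ ∑ _i : Fin N, (1 : ℝ) := Finset.sum_le_sum fun i _ => hb1 i _
        _ = N := by simp
  have hsub : {u | t < (hammingDist (roundSpins u x) (roundSpins u y) : ℝ)} ⊆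
      {u | t ≤ ∑ i, b i (u i)} := by
    intro u hu
    have : t < ∑ i, b i (u i) := by rw [← hham]; exact hu
    exact this.le
  refine (measureReal_mono hsub).trans
    ((measure_ge_le_exp_mul_mgf t zero_le_one hint).trans ?_)
  have hone : ∀ i, ∫ s, Real.exp (b i s) ∂(cond volume (Set.Icc (-1 : ℝ) 1)) ≤
      Real.exp |x i - y i| := by
    intro i
    have e1 : ∀ s, Real.exp (b i s) =
        1 + (Real.exp 1 - 1) * Set.indicator {u | ¬(u ≤ x i ↔ u ≤ y i)} (fun _ => (1 : ℝ)) s := by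
      intro s
      by_cases h : (s ≤ x i ↔ s ≤ y i) <;> simp [b, Set.indicator, h]
    have hms : MeasurableSet {u | ¬(u ≤ x i ↔ u ≤ y i)} := by
      have : {u | ¬(u ≤ x i ↔ u ≤ y i)} = (b i) ⁻¹' {1} := by
        ext s; by_cases h : (s ≤ x i ↔ s ≤ y i) <;> simp [b, h]
      rw [this]; exact hbm i (measurableSet_singleton _)
    simp_rw [e1]
    rw [integral_add (integrable_const _) (Integrable.const_mul
      ((integrable_const (1 : ℝ)).indicator hms) _), integral_const_mul,
      integral_indicator_const _ hms]
    simp only [integral_const, probReal_univ, smul_eq_mul, mul_one]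
    -- Since `e - 1 < 2`, the factor is at most `1 + |x i - y i| ≤ exp |x i - y i|`.
    have h1 := uniformThreshold_separates_le (x i) (y i)
    have h2 := Real.add_one_le_exp |x i - y i|
    have h3 := Real.exp_one_lt_d9
    have h4 : 1 < Real.exp 1 := Real.one_lt_exp_iff.2 one_pos
    nlinarith [abs_nonneg (x i - y i)]
  have hmgf : mgf (fun u : Fin N → ℝ => ∑ i, b i (u i)) (roundingLaw N) 1 ≤
      Real.exp (√N * ‖x - y‖) := by
    unfold mgf roundingLaw
    simp only [one_mul, Real.exp_sum]
    rw [integral_fintype_prod_eq_prod (f := fun i s => Real.exp (b i s))]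
    calc _ ≤ ∏ i, Real.exp |x i - y i| :=
          Finset.prod_le_prod (fun i _ => integral_nonneg fun s => (Real.exp_pos _).le)
            fun i _ => hone i
      _ = Real.exp (∑ i, |x i - y i|) := (Real.exp_sum _ _).symm
      _ ≤ _ := by
          apply Real.exp_le_exp.2
          have hcs := Finset.sum_mul_sq_le_sq_mul_sq Finset.univ (fun _ => (1 : ℝ))
            (fun i => |x i - y i|)
          simp only [one_mul, one_pow, Finset.sum_const, Finset.card_univ, Fintype.card_fin,
            nsmul_eq_mul, mul_one, sq_abs] at hcs
          rw [EuclideanSpace.norm_eq, ← Real.sqrt_mul (Nat.cast_nonneg N)]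
          apply Real.le_sqrt_of_sq_le
          simpa using hcs
  calc _ ≤ Real.exp (-1 * t) * Real.exp (√N * ‖x - y‖) := by gcongr
    _ = _ := by rw [← Real.exp_add]; congr 1; ring

/-- The same thresholds round both outputs. When these are within `(ρ / 2) √N`, the expected Hamming
distance is below half of `ρN`, and the Chernoff bound handles the excess. -/
theorem prod_roundingLaw_hammingDist_gt_le {X : Type*} [MeasurableSpace X] (μ : Measure X)
    [IsProbabilityMeasure μ] {f h : X → EuclideanSpace ℝ (Fin N)} (hf : Measurable f)
    (hh : Measurable h) {ρ : ℝ} :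
    (μ.prod (roundingLaw N)).real
      {z | ρ * N < hammingDist (roundSpins z.2 (f z.1)) (roundSpins z.2 (h z.1))} ≤
      μ.real {x | ρ / 2 * √N < ‖f x - h x‖} + Real.exp (-(ρ / 2 * N)) := by
  have hm : MeasurableSet {z : X × (Fin N → ℝ) |
      ρ * N < hammingDist (roundSpins z.2 (f z.1)) (roundSpins z.2 (h z.1))} :=
    measurableSet_lt measurable_const (measurable_hammingDist
      (measurable_roundSpins measurable_snd (hf.comp measurable_fst))
      (measurable_roundSpins measurable_snd (hh.comp measurable_fst)))
  set S := {x | ρ / 2 * √N < ‖f x - h x‖} with hS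
  have hSm : MeasurableSet S := measurableSet_lt measurable_const (by fun_prop)
  rw [measureReal_def, Measure.prod_apply hm]
  have hle : ∀ x, roundingLaw N (Prod.mk x ⁻¹' {z : X × (Fin N → ℝ) |
      ρ * N < hammingDist (roundSpins z.2 (f z.1)) (roundSpins z.2 (h z.1))}) ≤
      S.indicator 1 x + ENNReal.ofReal (Real.exp (-(ρ / 2 * N))) := by
    intro x
    by_cases hx : x ∈ S
    · rw [Set.indicator_of_mem hx]
      exact prob_le_one.trans (le_add_of_nonneg_right zero_le)
    · rw [Set.indicator_of_notMem hx, zero_add,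
        ENNReal.le_ofReal_iff_toReal_le (measure_ne_top _ _) (Real.exp_pos _).le]
      refine (roundingLaw_hammingDist_gt_le (f x) (h x) (ρ * N)).trans (Real.exp_le_exp.2 ?_)
      have h1 : ‖f x - h x‖ ≤ ρ / 2 * √N := not_lt.1 hx
      have h2 : √(N : ℝ) * √N = N := Real.mul_self_sqrt (Nat.cast_nonneg N)
      have h3 := mul_le_mul_of_nonneg_left h1 (Real.sqrt_nonneg N)
      have h4 : √(N : ℝ) * (ρ / 2 * √N) = ρ / 2 * N := by linear_combination ρ / 2 * h2
      linarith
  have := lintegral_mono (μ := μ) hle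
  rw [lintegral_add_right _ measurable_const, lintegral_indicator_one hSm, lintegral_const,
    measure_univ, mul_one] at this
  have h2 := ENNReal.toReal_mono (by simp) this
  rwa [ENNReal.toReal_add (measure_ne_top _ _) ENNReal.ofReal_ne_top,
    ENNReal.toReal_ofReal (Real.exp_pos _).le] at h2

/-- For each frozen `w` the map `g ↦ B g w` is deterministic, so the chain bound applies to it.
Averaging over `w` preserves the inequality because `(E f)² ≤ E f²`. -/
theorem prod_success_sq_le {W : Type*} [MeasurableSpace W] (lam : Measure W)
    [IsProbabilityMeasure lam] {γ δ ρ q ε : ℝ} (hε : 0 ≤ ε)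
    {B : Disorder N → W → Fin N → ℝ} (hB : Measurable fun z : Disorder N × W => B z.1 z.2)
    (h : ∀ w, ((stdGaussian (Disorder N)).real {g | B g w ∈ gappedStates γ δ g}) ^ 2 ≤
      (ouPair (Disorder N) q).real {p | ρ * N < hammingDist (B p.1 w) (B p.2 w)} + ε) :
    (((stdGaussian (Disorder N)).prod lam).real {z | B z.1 z.2 ∈ gappedStates γ δ z.1}) ^ 2 ≤
      ((ouPair (Disorder N) q).prod lam).real
        {z | ρ * N < hammingDist (B z.1.1 z.2) (B z.1.2 z.2)} + ε := by
  have hm1 : MeasurableSet {z : Disorder N × W | B z.1 z.2 ∈ gappedStates γ δ z.1} :=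
    measurableSet_gapped γ δ measurable_fst hB
  have hm2 : MeasurableSet {z : (Disorder N × Disorder N) × W |
      ρ * N < hammingDist (B z.1.1 z.2) (B z.1.2 z.2)} := by
    refine measurableSet_lt measurable_const (measurable_hammingDist ?_ ?_)
    · exact hB.comp (by fun_prop : Measurable fun z : (Disorder N × Disorder N) × W =>
        (z.1.1, z.2))
    · exact hB.comp (by fun_prop : Measurable fun z : (Disorder N × Disorder N) × W =>
        (z.1.2, z.2))
  have key : (((stdGaussian (Disorder N)).prod lam) {z | B z.1 z.2 ∈ gappedStates γ δ z.1}) ^ 2 ≤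
      ((ouPair (Disorder N) q).prod lam)
        {z | ρ * N < hammingDist (B z.1.1 z.2) (B z.1.2 z.2)} + ENNReal.ofReal ε := by
    rw [Measure.prod_apply_symm hm1, Measure.prod_apply_symm hm2]
    refine (sq_lintegral_le_lintegral_sq (measurable_measure_prodMk_right hm1)).trans ?_
    calc _ ≤ ∫⁻ w, (ouPair (Disorder N) q) ((fun x => (x, w)) ⁻¹'
          {z | ρ * N < hammingDist (B z.1.1 z.2) (B z.1.2 z.2)}) + ENNReal.ofReal ε ∂lam := by
          refine lintegral_mono fun w => ?_
          rw [← sq]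
          have hw := h w
          rw [measureReal_def, measureReal_def, ← ENNReal.toReal_pow] at hw
          rw [← ENNReal.ofReal_toReal (measure_ne_top (ouPair (Disorder N) q) _),
            ← ENNReal.ofReal_add ENNReal.toReal_nonneg hε,
            ENNReal.le_ofReal_iff_toReal_le (by finiteness) (by positivity)]
          exact hw
      _ = _ := by
          rw [lintegral_add_right _ measurable_const, lintegral_const, measure_univ, mul_one]
  have h2 := ENNReal.toReal_mono (by finiteness) key
  rwa [ENNReal.toReal_add (measure_ne_top _ _) ENNReal.ofReal_ne_top,
    ENNReal.toReal_ofReal hε, ENNReal.toReal_pow] at h2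

end Rounding

/-- The success probability of a rounded algorithm is controlled by its instability along one step
of a fine Gaussian chain. -/
theorem exists_rounded_success_sq_le {γ : ℝ} (hγ : 0 < γ) : ∃ δ ρ T c : ℝ, ∃ r : ℕ, 0 < δ ∧
    0 < ρ ∧ 0 < T ∧ 0 < c ∧ ∀ N : ℕ, 0 < N → ∀ m : ℕ, r ≤ m →
    (∀ (Ω : Type*) [MeasurableSpace Ω] (ν : Measure Ω) [IsProbabilityMeasure ν]
      (A : Disorder N → Ω → EuclideanSpace ℝ (Fin N)),
      Measurable (fun z : Disorder N × Ω => A z.1 z.2) →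
      randomizedSuccess ν γ δ A ^ 2 ≤
        ((ouPair (Disorder N) (Real.exp (-(T / 2 ^ m)))).prod ν).real
          {z | ρ * √N < ‖A z.1.1 z.2 - A z.1.2 z.2‖} +
        (Real.exp (-(ρ * N)) + 10 * Real.exp (-(c * N / 2 ^ m)))) ∧
    (∀ A : Disorder N → EuclideanSpace ℝ (Fin N), Measurable A →
      deterministicSuccess γ δ A ^ 2 ≤
        (ouPair (Disorder N) (Real.exp (-(T / 2 ^ m)))).real
          {p | ρ * √N < ‖A p.1 - A p.2‖} +
        (Real.exp (-(ρ * N)) + 10 * Real.exp (-(c * N / 2 ^ m)))) := by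
  obtain ⟨δ, ρ, T, c, r, hδ, hρ, hT, hc, h⟩ := exists_success_sq_le hγ
  refine ⟨δ, ρ / 2, T, c, r, hδ, by positivity, hT, hc, fun N hN m hm => ⟨?_, ?_⟩⟩
  · intro Ω _ ν _ A hA
    set q := Real.exp (-(T / 2 ^ m)) with hq
    have hB : Measurable fun z : Disorder N × (Ω × (Fin N → ℝ)) =>
        roundSpins z.2.2 (A z.1 z.2.1) :=
      measurable_roundSpins (by fun_prop)
        (hA.comp (by fun_prop : Measurable fun z : Disorder N × (Ω × (Fin N → ℝ)) =>
          (z.1, z.2.1)))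
    -- Both the internal randomness and the thresholds are frozen, hence shared by the two ends of a
    -- step.
    have h1 := prod_success_sq_le (ν.prod (roundingLaw N)) (γ := γ) (δ := δ) (ρ := ρ) (q := q)
      (ε := 10 * Real.exp (-(c * N / 2 ^ m))) (by positivity)
      (B := fun g w => roundSpins w.2 (A g w.1)) hB (fun w => h N hN _
        (hB.comp (by fun_prop : Measurable fun g : Disorder N => (g, w)))
        (fun g => isSpin_roundSpins _ _) m hm)
    rw [randomizedSuccess, disorderLaw_eq_stdGaussian]
    refine h1.trans ?_
    rw [← add_assoc]
    refine add_le_add ?_ le_rfl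
    have h2 := prod_roundingLaw_hammingDist_gt_le ((ouPair (Disorder N) q).prod ν) (ρ := ρ)
      (f := fun z => A z.1.1 z.2) (h := fun z => A z.1.2 z.2)
      (hA.comp (by fun_prop : Measurable fun z : (Disorder N × Disorder N) × Ω => (z.1.1, z.2)))
      (hA.comp (by fun_prop : Measurable fun z : (Disorder N × Disorder N) × Ω => (z.1.2, z.2)))
    refine le_trans (le_of_eq ?_) h2
    rw [measureReal_def, measureReal_def, ← (measurePreserving_prodAssoc (ouPair (Disorder N) q) ν
      (roundingLaw N)).measure_preimage_equiv]
    rfl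
  · intro A hA
    set q := Real.exp (-(T / 2 ^ m)) with hq
    have hB : Measurable fun z : Disorder N × (Fin N → ℝ) => roundSpins z.2 (A z.1) :=
      measurable_roundSpins (by fun_prop) (by fun_prop)
    have h1 := prod_success_sq_le (roundingLaw N) (γ := γ) (δ := δ) (ρ := ρ) (q := q)
      (ε := 10 * Real.exp (-(c * N / 2 ^ m))) (by positivity)
      (B := fun g w => roundSpins w (A g)) hB (fun w => h N hN _
        (hB.comp (by fun_prop : Measurable fun g : Disorder N => (g, w)))
        (fun g => isSpin_roundSpins _ _) m hm)
    rw [deterministicSuccess, disorderLaw_eq_stdGaussian]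
    refine h1.trans ?_
    rw [← add_assoc]
    refine add_le_add ?_ le_rfl
    exact prod_roundingLaw_hammingDist_gt_le (ouPair (Disorder N) q) (ρ := ρ)
      (f := fun z => A z.1) (h := fun z => A z.2) (by fun_prop) (by fun_prop)

/-! ### The circular arc between two independent Gaussian inputs -/

section Arc

variable {E : Type*} [NormedAddCommGroup E] [InnerProductSpace ℝ E]

/-- A point of the circle through `x` and `y`. -/
noncomputable def arc (x y : E) (θ : ℝ) : E := Real.cos θ • x + Real.sin θ • y

/-- The velocity of `arc`. -/
noncomputable def arcVelocity (x y : E) (θ : ℝ) : E := Real.cos θ • y - Real.sin θ • x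

theorem hasDerivAt_arc (x y : E) (θ : ℝ) : HasDerivAt (arc x y) (arcVelocity x y θ) θ := by
  have h := ((Real.hasDerivAt_cos θ).smul_const x).add ((Real.hasDerivAt_sin θ).smul_const y)
  refine h.congr_deriv ?_
  unfold arcVelocity
  module

theorem norm_arcVelocity_le (x y : E) (θ : ℝ) : ‖arcVelocity x y θ‖ ≤ ‖x‖ + ‖y‖ := by
  refine (norm_sub_le _ _).trans ?_
  rw [norm_smul, norm_smul, add_comm]
  refine add_le_add ?_ ?_
  · exact mul_le_of_le_one_left (norm_nonneg _) (Real.abs_sin_le_one θ)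
  · exact mul_le_of_le_one_left (norm_nonneg _) (Real.abs_cos_le_one θ)

theorem lipschitzWith_arc (x y : E) : LipschitzWith (‖x‖₊ + ‖y‖₊) (arc x y) := by
  refine lipschitzWith_of_nnnorm_deriv_le (fun θ => (hasDerivAt_arc x y θ).differentiableAt)
    fun θ => ?_
  rw [(hasDerivAt_arc x y θ).deriv]
  exact norm_arcVelocity_le x y θ

theorem continuous_arc : Continuous fun p : (E × E) × ℝ => arc p.1.1 p.1.2 p.2 := by
  unfold arc; fun_prop

theorem continuous_arcVelocity :
    Continuous fun p : (E × E) × ℝ => arcVelocity p.1.1 p.1.2 p.2 := by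
  unfold arcVelocity; fun_prop

variable {F : Type*} [NormedAddCommGroup F] [InnerProductSpace ℝ F]

/-- The speed of the image of `arc` under `A`. -/
noncomputable def arcSpeed (A : E → F) (p : E × E) (θ : ℝ) : ℝ :=
  ‖fderiv ℝ A (arc p.1 p.2 θ) (arcVelocity p.1 p.2 θ)‖

theorem arcSpeed_nonneg (A : E → F) (p : E × E) (θ : ℝ) : 0 ≤ arcSpeed A p θ := norm_nonneg _

theorem arcSpeed_le {A : E → F} {C : ℝ≥0} (hA : LipschitzWith C A) (p : E × E) (θ : ℝ) :
    arcSpeed A p θ ≤ C * (‖p.1‖ + ‖p.2‖) := by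
  refine (ContinuousLinearMap.le_opNorm _ _).trans ?_
  gcongr
  · exact norm_fderiv_le_of_lipschitz ℝ hA
  · exact norm_arcVelocity_le _ _ _

end Arc

/-! ### Exponential moments for increments of Lipschitz maps -/

section LipschitzStability

theorem pi_fin_absolutelyContinuous {μ ν : Measure ℝ} [SigmaFinite μ] [SigmaFinite ν] (h : μ ≪ ν)
    (n : ℕ) : (Measure.pi fun _ : Fin n => μ) ≪ (Measure.pi fun _ : Fin n => ν) := by
  induction n with
  | zero => rw [Measure.pi_of_empty, Measure.pi_of_empty]
  | succ n ih =>
    have h1 := (measurePreserving_piFinSuccAbove (fun _ : Fin (n + 1) => μ) 0).symm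
    have h2 := (measurePreserving_piFinSuccAbove (fun _ : Fin (n + 1) => ν) 0).symm
    rw [← h1.map_eq, ← h2.map_eq]
    exact (h.prod ih).map (MeasurableEquiv.measurable _)

variable {E : Type*} [NormedAddCommGroup E] [InnerProductSpace ℝ E] [FiniteDimensional ℝ E]
  [MeasurableSpace E] [BorelSpace E]

/-- Rademacher's theorem in orthonormal coordinates, transferred by absolute continuity of the
Gaussian measure. -/
theorem LipschitzWith.ae_differentiableAt_stdGaussian {F : Type*} [NormedAddCommGroup F]
    [NormedSpace ℝ F] [FiniteDimensional ℝ F] {A : E → F} {C : ℝ≥0} (hA : LipschitzWith C A) :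
    ∀ᵐ x ∂(stdGaussian E), DifferentiableAt ℝ A x := by
  let e := (stdOrthonormalBasis ℝ E).toBasis.equivFunL.symm
  have he : (fun x : Fin (Module.finrank ℝ E) → ℝ => ∑ i, x i • stdOrthonormalBasis ℝ E i) = e := by
    ext x
    change _ = (stdOrthonormalBasis ℝ E).toBasis.equivFun.symm x
    rw [Module.Basis.equivFun_symm_apply]
    simp
  have h1 : ∀ᵐ x : Fin (Module.finrank ℝ E) → ℝ, DifferentiableAt ℝ (A ∘ e) x :=
    (hA.comp e.lipschitz).ae_differentiableAt
  have h2 : (Measure.pi fun _ : Fin (Module.finrank ℝ E) => gaussianReal 0 1) ≪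
      (volume : Measure (Fin (Module.finrank ℝ E) → ℝ)) :=
    pi_fin_absolutelyContinuous (gaussianReal_absolutelyContinuous 0 one_ne_zero) _
  rw [stdGaussian, he, ae_map_iff e.continuous.aemeasurable
    (measurableSet_of_differentiableAt ℝ A)]
  filter_upwards [h2.ae_le h1] with x hx
  exact (e.comp_right_differentiableAt_iff).1 hx

variable {F : Type*} [NormedAddCommGroup F] [InnerProductSpace ℝ F] [FiniteDimensional ℝ F]

theorem measurable_norm_fderiv_apply (A : E → F) :
    Measurable fun z : E × E => ‖fderiv ℝ A z.1 z.2‖ := by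
  have h1 : Measurable fun z : E × E => fderiv ℝ A z.1 :=
    (measurable_fderiv ℝ A).comp measurable_fst
  have h3 : Measurable fun w : (E →L[ℝ] F) × E => ‖w.1 w.2‖ :=
    (isBoundedBilinearMap_apply.continuous.norm).measurable
  exact h3.comp (h1.prodMk measurable_snd)

theorem measurable_arcSpeed (A : E → F) :
    Measurable fun z : (E × E) × ℝ => arcSpeed A z.1 z.2 :=
  (measurable_norm_fderiv_apply A).comp
    (continuous_arc.measurable.prodMk continuous_arcVelocity.measurable)

theorem measurable_arcSpeed_right (A : E → F) (p : E × E) : Measurable (arcSpeed A p) := by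
  have h : Measurable fun θ : ℝ => (p, θ) := by fun_prop
  simpa only [Function.comp_def] using (measurable_arcSpeed A).comp h

theorem norm_sub_le_integral_arcSpeed {A : E → F} {C : ℝ≥0} (hA : LipschitzWith C A) {p : E × E}
    {φ : ℝ} (hφ : 0 ≤ φ) (hd : ∀ᵐ θ : ℝ, DifferentiableAt ℝ A (arc p.1 p.2 θ)) :
    ‖A (arc p.1 p.2 φ) - A p.1‖ ≤ ∫ θ in (0 : ℝ)..φ, arcSpeed A p θ := by
  set Δ := A (arc p.1 p.2 φ) - A p.1 with hΔ
  rcases eq_or_ne Δ 0 with h0 | h0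
  · rw [h0, norm_zero]
    exact intervalIntegral.integral_nonneg hφ fun θ _ => norm_nonneg _
  -- Projecting onto the direction of the displacement yields a scalar Lipschitz function, for which
  -- the absolutely continuous fundamental theorem of calculus needs a derivative only almost
  -- everywhere.
  set u := (‖Δ‖⁻¹) • Δ with hu
  have hu1 : ‖u‖ = 1 := by
    rw [hu, norm_smul, norm_inv, norm_norm, inv_mul_cancel₀ (norm_ne_zero_iff.2 h0)]
  have huΔ : ⟪u, Δ⟫ = ‖Δ‖ := by
    rw [hu, real_inner_smul_left, real_inner_self_eq_norm_sq, sq,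
      inv_mul_cancel_left₀ (norm_ne_zero_iff.2 h0)]
  let f : ℝ → ℝ := fun θ => ⟪u, A (arc p.1 p.2 θ)⟫
  have hf : LipschitzWith (‖innerSL ℝ u‖₊ * (C * (‖p.1‖₊ + ‖p.2‖₊))) f :=
    (innerSL ℝ u).lipschitz.comp (hA.comp (lipschitzWith_arc p.1 p.2))
  have hac : AbsolutelyContinuousOnInterval f 0 φ :=
    (hf.lipschitzOnWith (s := Set.uIcc 0 φ)).absolutelyContinuousOnInterval
  have hftc := hac.integral_deriv_eq_sub
  have hend : f φ - f 0 = ‖Δ‖ := by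
    simp only [f]
    rw [← inner_sub_right, ← huΔ]
    simp [hΔ, arc]
  rw [← hend, ← hftc]
  refine intervalIntegral.integral_mono_ae hφ hac.intervalIntegrable_deriv ?_ ?_
  · rw [intervalIntegrable_iff]
    have : IsFiniteMeasure (volume.restrict (Set.uIoc 0 φ)) := ⟨by simp [Real.volume_uIoc]⟩
    refine Integrable.of_bound (C := C * (‖p.1‖ + ‖p.2‖)) ?_ ?_
    · exact (measurable_arcSpeed_right A p).aestronglyMeasurable
    · refine Eventually.of_forall fun θ => ?_
      rw [Real.norm_eq_abs, abs_of_nonneg (arcSpeed_nonneg _ _ _)]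
      exact arcSpeed_le hA p θ
  · filter_upwards [hd] with θ hθ
    have h1 : HasDerivAt (fun θ => A (arc p.1 p.2 θ))
        (fderiv ℝ A (arc p.1 p.2 θ) (arcVelocity p.1 p.2 θ)) θ :=
      hθ.hasFDerivAt.comp_hasDerivAt θ (hasDerivAt_arc p.1 p.2 θ)
    have h2 : HasDerivAt f ⟪u, fderiv ℝ A (arc p.1 p.2 θ) (arcVelocity p.1 p.2 θ)⟫ θ :=
      (innerSL ℝ u).hasFDerivAt.comp_hasDerivAt θ h1
    rw [h2.deriv]
    refine (real_inner_le_norm _ _).trans ?_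
    rw [hu1, one_mul]
    rfl

theorem convexOn_exp_mul_sq {lam : ℝ} (h : 0 ≤ lam) :
    ConvexOn ℝ Set.univ fun s : ℝ => Real.exp (lam * s ^ 2) := by
  have h1 : ConvexOn ℝ Set.univ fun s : ℝ => lam * s ^ 2 := by
    have := (even_two.convexOn_pow (𝕜 := ℝ)).smul h
    simpa using this
  have h2 := convexOn_exp.subset (Set.subset_univ ((fun s : ℝ => lam * s ^ 2) '' Set.univ)) ?_
  · exact h2.comp h1 (Real.exp_monotone.monotoneOn _)
  · have himg : IsPreconnected ((fun s : ℝ => lam * s ^ 2) '' Set.univ) :=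
      isPreconnected_univ.image _ (by fun_prop)
    exact himg.ordConnected.convex

theorem exp_average_sq_le {h : ℝ → ℝ} {R φ lam : ℝ} (hφ : 0 < φ) (hlam : 0 ≤ lam)
    (hm : Measurable h) (h0 : ∀ θ, 0 ≤ h θ) (hR : ∀ θ, h θ ≤ R) :
    ENNReal.ofReal (Real.exp (lam * ((∫ θ in (0 : ℝ)..φ, h θ) / φ) ^ 2)) ≤
      ∫⁻ θ, ENNReal.ofReal (Real.exp (lam * h θ ^ 2)) ∂(cond volume (Set.Ioc (0 : ℝ) φ)) := by
  set P := cond volume (Set.Ioc (0 : ℝ) φ) with hP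
  have : IsProbabilityMeasure P := cond_isProbabilityMeasure_of_finite (by simp [hφ]) (by simp)
  have hint : Integrable h P := by
    refine Integrable.of_bound (C := R) hm.aestronglyMeasurable ?_
    refine Eventually.of_forall fun θ => ?_
    rw [Real.norm_eq_abs, abs_of_nonneg (h0 θ)]
    exact hR θ
  have hint2 : Integrable (fun θ => Real.exp (lam * h θ ^ 2)) P := by
    refine Integrable.of_bound (C := Real.exp (lam * R ^ 2)) ?_ ?_
    · exact ((hm.pow_const 2).const_mul lam).exp.aestronglyMeasurable
    · refine Eventually.of_forall fun θ => ?_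
      rw [Real.norm_eq_abs, abs_of_pos (Real.exp_pos _)]
      apply Real.exp_le_exp.2
      have := h0 θ
      have := hR θ
      gcongr
  have hj := (convexOn_exp_mul_sq hlam).map_integral_le (μ := P) (f := h)
    (Continuous.continuousOn (by fun_prop)) isClosed_univ (by simp) hint hint2
  have havg : ∫ θ, h θ ∂P = (∫ θ in (0 : ℝ)..φ, h θ) / φ := by
    rw [hP, ProbabilityTheory.cond, integral_smul_measure, intervalIntegral.integral_of_le hφ.le]
    simp only [Real.volume_Ioc, sub_zero, ENNReal.toReal_inv, smul_eq_mul,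
      ENNReal.toReal_ofReal hφ.le]
    rw [div_eq_inv_mul]
  rw [← ofReal_integral_eq_lintegral_ofReal hint2
    (Eventually.of_forall fun θ => (Real.exp_pos _).le), ← havg]
  exact ENNReal.ofReal_le_ofReal hj

/-- Jensen's inequality for the displacement along `arc`. -/
theorem exp_norm_sub_le_average {A : E → F} {C : ℝ≥0} (hA : LipschitzWith C A) {p : E × E}
    {φ lam : ℝ} (hφ : 0 < φ) (hlam : 0 ≤ lam)
    (hd : ∀ᵐ θ : ℝ, DifferentiableAt ℝ A (arc p.1 p.2 θ)) :
    ENNReal.ofReal (Real.exp (lam * (‖A (arc p.1 p.2 φ) - A p.1‖ / φ) ^ 2)) ≤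
      ∫⁻ θ, ENNReal.ofReal (Real.exp (lam * arcSpeed A p θ ^ 2))
        ∂(cond volume (Set.Ioc (0 : ℝ) φ)) := by
  refine le_trans (ENNReal.ofReal_le_ofReal (Real.exp_le_exp.2 ?_)) (exp_average_sq_le
    (h := arcSpeed A p) (R := C * (‖p.1‖ + ‖p.2‖)) hφ hlam
    (measurable_arcSpeed_right A p)
    (arcSpeed_nonneg A p) (arcSpeed_le hA p))
  gcongr
  exact norm_sub_le_integral_arcSpeed hA hφ.le hd

theorem lintegral_exp_inner_stdGaussian (a : E) :
    ∫⁻ x, ENNReal.ofReal (Real.exp ⟪a, x⟫) ∂(stdGaussian E) =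
      ENNReal.ofReal (Real.exp (‖a‖ ^ 2 / 2)) := by
  have h := integral_exp_inner_stdGaussian a 1
  simp only [mgf, one_mul, one_pow, mul_one] at h
  have hint : Integrable (fun x => Real.exp ⟪a, x⟫) (stdGaussian E) := by
    have : Integrable (fun y => Real.exp (1 * y))
        ((stdGaussian E).map (fun x => ⟪a, x⟫)) := by
      rw [map_inner_stdGaussian]; exact integrable_exp_mul_gaussianReal _
    simpa [Function.comp_def] using this.comp_measurable (by fun_prop)
  rw [← ofReal_integral_eq_lintegral_ofReal hint (Eventually.of_forall fun x => (Real.exp_pos _).le),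
    h]

theorem integral_exp_sq_div_four_gaussianReal :
    ∫ x, Real.exp (x ^ 2 / 4) ∂(gaussianReal 0 1) = √2 := by
  rw [integral_gaussianReal_eq_integral_smul one_ne_zero]
  have : ∀ x : ℝ, gaussianPDFReal 0 1 x • Real.exp (x ^ 2 / 4) =
      (√(2 * Real.pi))⁻¹ * Real.exp (-(1 / 4) * x ^ 2) := by
    intro x
    rw [gaussianPDFReal, smul_eq_mul, mul_assoc, ← Real.exp_add]
    simp only [NNReal.coe_one, mul_one, sub_zero]
    congr 2
    ring
  simp_rw [this]
  rw [integral_const_mul, integral_gaussian, ← Real.sqrt_inv, ← Real.sqrt_mul (by positivity)]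
  congr 1
  field_simp
  norm_num

theorem lintegral_exp_norm_sq_div_four (N : ℕ) :
    ∫⁻ w, ENNReal.ofReal (Real.exp (‖w‖ ^ 2 / 4)) ∂(stdGaussian (EuclideanSpace ℝ (Fin N))) =
      ENNReal.ofReal (√2 ^ N) := by
  rw [← map_pi_eq_stdGaussian, lintegral_map (by fun_prop) (by fun_prop)]
  have h1 : ∀ w : Fin N → ℝ, ENNReal.ofReal (Real.exp (‖WithLp.toLp 2 w‖ ^ 2 / 4)) =
      ENNReal.ofReal (∏ i, Real.exp (w i ^ 2 / 4)) := by
    intro w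
    rw [EuclideanSpace.real_norm_sq_eq, Finset.sum_div, Real.exp_sum]
  simp_rw [h1]
  have hne : ∫ x, Real.exp (x ^ 2 / 4) ∂(gaussianReal 0 1) ≠ 0 := by
    rw [integral_exp_sq_div_four_gaussianReal]; positivity
  have hint1 : Integrable (fun x : ℝ => Real.exp (x ^ 2 / 4)) (gaussianReal 0 1) := by
    by_contra hcon; exact hne (integral_undef hcon)
  rw [← ofReal_integral_eq_lintegral_ofReal (Integrable.fintype_prod fun _ => hint1)
    (Eventually.of_forall fun x => by positivity)]
  rw [integral_fintype_prod_eq_prod (f := fun _ x => Real.exp (x ^ 2 / 4)),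
    integral_exp_sq_div_four_gaussianReal]
  simp

/-- Linearise the square with an auxiliary Gaussian `w` in the output space: `exp (λ‖L y‖²) = E_w
exp (√(2λ) ⟨L y, w⟩)`. Integrating over `y` first moves `L` to its adjoint, and what remains is a
moment of `‖w‖²`. The bound thus involves the output dimension `N` but not the dimension of `E`. -/
theorem lintegral_exp_norm_sq_clm_le {N : ℕ} (L : E →L[ℝ] EuclideanSpace ℝ (Fin N)) {C lam : ℝ}
    (hL : ‖L‖ ≤ C) (hlam : 0 ≤ lam) (hC : lam * C ^ 2 ≤ 1 / 4) :
    ∫⁻ y, ENNReal.ofReal (Real.exp (lam * ‖L y‖ ^ 2)) ∂(stdGaussian E) ≤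
      ENNReal.ofReal (√2 ^ N) := by
  set κ := √(2 * lam) with hκ
  have hκ2 : κ ^ 2 = 2 * lam := Real.sq_sqrt (by positivity)
  have e1 : ∀ y, ENNReal.ofReal (Real.exp (lam * ‖L y‖ ^ 2)) =
      ∫⁻ w, ENNReal.ofReal (Real.exp ⟪κ • L y, w⟫) ∂(stdGaussian (EuclideanSpace ℝ (Fin N))) := by
    intro y
    rw [lintegral_exp_inner_stdGaussian, norm_smul, mul_pow, Real.norm_eq_abs, sq_abs, hκ2]
    congr 2; ring
  simp_rw [e1]
  rw [lintegral_lintegral_swap (by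
    apply Measurable.aemeasurable
    have : Continuous fun p : E × EuclideanSpace ℝ (Fin N) => Real.exp ⟪κ • L p.1, p.2⟫ := by
      fun_prop
    exact this.measurable.ennreal_ofReal), ← lintegral_exp_norm_sq_div_four]
  refine lintegral_mono fun w => ?_
  have e2 : ∀ y, ⟪κ • L y, w⟫ = ⟪κ • (ContinuousLinearMap.adjoint L) w, y⟫ := by
    intro y
    rw [real_inner_smul_left, real_inner_smul_left, ContinuousLinearMap.adjoint_inner_left,
      real_inner_comm]
  simp_rw [e2]
  rw [lintegral_exp_inner_stdGaussian]
  apply ENNReal.ofReal_le_ofReal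
  apply Real.exp_le_exp.2
  rw [norm_smul, mul_pow, Real.norm_eq_abs, sq_abs, hκ2]
  have h3 : ‖(ContinuousLinearMap.adjoint L) w‖ ≤ C * ‖w‖ := by
    refine (ContinuousLinearMap.le_opNorm _ _).trans ?_
    rw [LinearIsometryEquiv.norm_map]
    gcongr
  calc 2 * lam * ‖(ContinuousLinearMap.adjoint L) w‖ ^ 2 / 2
      ≤ 2 * lam * (C * ‖w‖) ^ 2 / 2 := by gcongr
    _ = lam * C ^ 2 * ‖w‖ ^ 2 := by ring
    _ ≤ 1 / 4 * ‖w‖ ^ 2 := by gcongr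
    _ = ‖w‖ ^ 2 / 4 := by ring

/-- At every fixed angle the position and the velocity on the arc are independent standard
Gaussians. Conditionally on the position, the speed is the norm of a fixed linear map applied to a
Gaussian. -/
theorem lintegral_exp_arcSpeed_le {N : ℕ} {A : E → EuclideanSpace ℝ (Fin N)} {C : ℝ≥0}
    (hA : LipschitzWith C A) {lam : ℝ} (hlam : 0 ≤ lam) (hC : lam * C ^ 2 ≤ 1 / 4) (θ : ℝ) :
    ∫⁻ p, ENNReal.ofReal (Real.exp (lam * arcSpeed A p θ ^ 2))
      ∂((stdGaussian E).prod (stdGaussian E)) ≤ ENNReal.ofReal (√2 ^ N) := by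
  let f : E × E → ℝ≥0∞ := fun p => ENNReal.ofReal (Real.exp (lam * ‖fderiv ℝ A p.1 p.2‖ ^ 2))
  have hfm : Measurable f :=
    (((measurable_norm_fderiv_apply A).pow_const 2).const_mul lam).exp.ennreal_ofReal
  have hrot := stdGaussian_prod_map_reflection (E := E) (Real.cos_sq_add_sin_sq θ)
  calc ∫⁻ p, ENNReal.ofReal (Real.exp (lam * arcSpeed A p θ ^ 2))
      ∂((stdGaussian E).prod (stdGaussian E))
      = ∫⁻ p, f p ∂((stdGaussian E).prod (stdGaussian E)) := by
        conv_rhs => rw [← hrot]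
        rw [lintegral_map hfm (by fun_prop)]
        refine lintegral_congr fun p => ?_
        simp only [f, arcSpeed, arc, arcVelocity]
        rw [← neg_sub (Real.sin θ • p.1), map_neg, norm_neg]
    _ = ∫⁻ x, ∫⁻ y, f (x, y) ∂(stdGaussian E) ∂(stdGaussian E) :=
        lintegral_prod _ hfm.aemeasurable
    _ ≤ ∫⁻ _, ENNReal.ofReal (√2 ^ N) ∂(stdGaussian E) := by
        refine lintegral_mono fun x => ?_
        have hx : ‖fderiv ℝ A x‖ ≤ C := norm_fderiv_le_of_lipschitz ℝ hA
        exact lintegral_exp_norm_sq_clm_le (fderiv ℝ A x) hx hlam hC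
    _ = _ := by simp

/-- Dimension-free stability of Lipschitz maps under a small rotation of Gaussian inputs. -/
theorem LipschitzWith.ouPair_norm_sub_gt_le {N : ℕ} {A : E → EuclideanSpace ℝ (Fin N)} {C : ℝ≥0}
    (hA : LipschitzWith C A) (hC : 0 < C) {φ η : ℝ} (hφ0 : 0 < φ) (hφ1 : φ ≤ Real.pi)
    (hη : 0 ≤ η) :
    (ouPair E (Real.cos φ)).real {p | η < ‖A p.1 - A p.2‖} ≤
      √2 ^ N * Real.exp (-(η ^ 2 / (4 * C ^ 2 * φ ^ 2))) := by
  have hC' : (0 : ℝ) < C := hC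
  -- Makes `λC² = 1/4`, for which the exponential moment is at most `√2 ^ N`.
  set lam := 1 / (4 * (C : ℝ) ^ 2) with hlam
  have hlam0 : 0 ≤ lam := by positivity
  have hlamC : lam * (C : ℝ) ^ 2 ≤ 1 / 4 := by rw [hlam]; field_simp; exact le_rfl
  have hAm : Measurable A := hA.continuous.measurable
  have hSm : MeasurableSet {p : E × E | η < ‖A p.1 - A p.2‖} :=
    measurableSet_lt measurable_const (by fun_prop)
  have harc : ∀ p : E × E, ouStep (Real.cos φ) p.1 p.2 = arc p.1 p.2 φ := by
    intro p
    rw [ouStep, arc, ← Real.sin_sq, Real.sqrt_sq (Real.sin_nonneg_of_nonneg_of_le_pi hφ0.le hφ1)]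
  have : IsProbabilityMeasure (cond volume (Set.Ioc (0 : ℝ) φ)) :=
    cond_isProbabilityMeasure_of_finite (by simp [hφ0]) (by simp)
  -- For each fixed angle the arc point is Gaussian, hence almost surely a differentiability point;
  -- Fubini exchanges the quantifiers.
  have hdiff : ∀ᵐ p ∂((stdGaussian E).prod (stdGaussian E)), ∀ᵐ θ : ℝ,
      DifferentiableAt ℝ A (arc p.1 p.2 θ) := by
    rw [Measure.ae_ae_comm (p := fun (p : E × E) (θ : ℝ) => DifferentiableAt ℝ A (arc p.1 p.2 θ))
      (continuous_arc.measurable (measurableSet_of_differentiableAt ℝ A))]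
    refine Eventually.of_forall fun θ => ?_
    have h1 := hA.ae_differentiableAt_stdGaussian
    rw [← stdGaussian_prod_map_combination (Real.cos_sq_add_sin_sq θ)] at h1
    exact ae_of_ae_map (f := fun p : E × E => arc p.1 p.2 θ) (by unfold arc; fun_prop) h1
  have hexp : ∫⁻ p, ENNReal.ofReal (Real.exp (lam * (‖A (arc p.1 p.2 φ) - A p.1‖ / φ) ^ 2))
      ∂((stdGaussian E).prod (stdGaussian E)) ≤ ENNReal.ofReal (√2 ^ N) := by
    calc _ ≤ ∫⁻ p, ∫⁻ θ, ENNReal.ofReal (Real.exp (lam * arcSpeed A p θ ^ 2))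
          ∂(cond volume (Set.Ioc (0 : ℝ) φ)) ∂((stdGaussian E).prod (stdGaussian E)) := by
          refine lintegral_mono_ae ?_
          filter_upwards [hdiff] with p hp
          exact exp_norm_sub_le_average hA hφ0 hlam0 hp
      _ = ∫⁻ θ, ∫⁻ p, ENNReal.ofReal (Real.exp (lam * arcSpeed A p θ ^ 2))
          ∂((stdGaussian E).prod (stdGaussian E)) ∂(cond volume (Set.Ioc (0 : ℝ) φ)) := by
          refine lintegral_lintegral_swap (Measurable.aemeasurable ?_)
          exact (((measurable_arcSpeed A).pow_const 2).const_mul lam).exp.ennreal_ofReal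
      _ ≤ ∫⁻ _, ENNReal.ofReal (√2 ^ N) ∂(cond volume (Set.Ioc (0 : ℝ) φ)) :=
          lintegral_mono fun θ => lintegral_exp_arcSpeed_le hA hlam0 hlamC θ
      _ = _ := by simp
  rw [ouPair_real_apply _ hSm]
  set t := Real.exp (lam * (η / φ) ^ 2) with ht
  have hmark := mul_meas_ge_le_lintegral₀ (μ := (stdGaussian E).prod (stdGaussian E))
    (f := fun p => ENNReal.ofReal (Real.exp (lam * (‖A (arc p.1 p.2 φ) - A p.1‖ / φ) ^ 2)))
    (by
      have : Measurable fun p : E × E => arc p.1 p.2 φ := by unfold arc; fun_prop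
      fun_prop) (ENNReal.ofReal t)
  have hsub : {p : E × E | (p.1, ouStep (Real.cos φ) p.1 p.2) ∈
      {p : E × E | η < ‖A p.1 - A p.2‖}} ⊆
      {p : E × E | ENNReal.ofReal t ≤
        ENNReal.ofReal (Real.exp (lam * (‖A (arc p.1 p.2 φ) - A p.1‖ / φ) ^ 2))} := by
    intro p hp
    have hp' : η < ‖A p.1 - A (ouStep (Real.cos φ) p.1 p.2)‖ := hp
    rw [harc, norm_sub_rev] at hp'
    apply ENNReal.ofReal_le_ofReal
    apply Real.exp_le_exp.2
    gcongr
  have h5 : ENNReal.ofReal t * ((stdGaussian E).prod (stdGaussian E))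
      {p : E × E | (p.1, ouStep (Real.cos φ) p.1 p.2) ∈ {p : E × E | η < ‖A p.1 - A p.2‖}} ≤
      ENNReal.ofReal (√2 ^ N) :=
    (mul_le_mul_right (measure_mono hsub) _).trans (hmark.trans hexp)
  have h6 := ENNReal.toReal_mono ENNReal.ofReal_ne_top h5
  rw [ENNReal.toReal_mul, ENNReal.toReal_ofReal (Real.exp_pos _).le,
    ENNReal.toReal_ofReal (by positivity), ← measureReal_def] at h6
  have h7 : lam * (η / φ) ^ 2 = η ^ 2 / (4 * C ^ 2 * φ ^ 2) := by
    rw [hlam]; field_simp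
  rw [Real.exp_neg, ← h7, ← ht, ← div_eq_mul_inv, le_div_iff₀ (Real.exp_pos _)]
  linarith

end LipschitzStability

/-! ### Lipschitz algorithms -/

section LipschitzAlgorithms

universe u

theorem prod_real_le_of_forall {X Y : Type*} [MeasurableSpace X] [MeasurableSpace Y]
    (μ : Measure X) (ν : Measure Y) [IsProbabilityMeasure μ] [IsProbabilityMeasure ν]
    {S : Set (X × Y)} (hS : MeasurableSet S) {ε : ℝ} (hε : 0 ≤ ε)
    (h : ∀ y, μ.real {x | (x, y) ∈ S} ≤ ε) : (μ.prod ν).real S ≤ ε := by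
  rw [measureReal_def, Measure.prod_apply_symm hS]
  refine ENNReal.toReal_le_of_le_ofReal hε ?_
  calc _ ≤ ∫⁻ _, ENNReal.ofReal ε ∂ν := by
        refine lintegral_mono fun y => ?_
        rw [ENNReal.le_ofReal_iff_toReal_le (measure_ne_top _ _) hε]
        exact h y
    _ = _ := by simp

/-- From `1 - t ≤ exp (-t) = cos φ ≤ 1 - 2φ²/π²` and `π² ≤ 10`. -/
theorem arccos_exp_neg_sq_le {t : ℝ} (ht : 0 ≤ t) : Real.arccos (Real.exp (-t)) ^ 2 ≤ 5 * t := by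
  set φ := Real.arccos (Real.exp (-t)) with hφ
  have hq1 : Real.exp (-t) ≤ 1 := Real.exp_le_one_iff.2 (by linarith)
  have hcos : Real.cos φ = Real.exp (-t) :=
    Real.cos_arccos (by linarith [Real.exp_pos (-t)]) hq1
  have h0 : 0 ≤ φ := Real.arccos_nonneg _
  have h1 : φ ≤ Real.pi := Real.arccos_le_pi _
  have h2 := Real.cos_le_one_sub_mul_cos_sq (x := φ) (by rwa [abs_of_nonneg h0])
  have h3 := Real.add_one_le_exp (-t)
  have h4 : 2 / Real.pi ^ 2 * φ ^ 2 ≤ t := by linarith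
  have hpi : Real.pi ^ 2 ≤ 10 := by
    nlinarith [Real.pi_lt_d2, Real.pi_pos]
  rw [div_mul_eq_mul_div, div_le_iff₀ (by positivity)] at h4
  nlinarith

/-- A step of correlation `exp (-t)` rotates by an angle `φ` with `φ² ≤ 5t`. The smallness
assumption makes the exponent at least `2N`, which beats `√2 ^ N ≤ exp N`. -/
theorem lipschitz_instability_le {N : ℕ} {A : Disorder N → EuclideanSpace ℝ (Fin N)} {C : ℝ}
    (hC : 0 < C) (hA : LipschitzWith C.toNNReal A) {ρ t : ℝ} (hρ : 0 < ρ) (ht : 0 < t)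
    (hsmall : 40 * C ^ 2 * t ≤ ρ ^ 2) :
    (ouPair (Disorder N) (Real.exp (-t))).real {p | ρ * √N < ‖A p.1 - A p.2‖} ≤
      Real.exp (-N) := by
  set φ := Real.arccos (Real.exp (-t)) with hφ
  have hq1 : Real.exp (-t) < 1 := Real.exp_lt_one_iff.2 (by linarith)
  have hcos : Real.cos φ = Real.exp (-t) :=
    Real.cos_arccos (by linarith [Real.exp_pos (-t)]) hq1.le
  have h0 : 0 < φ := Real.arccos_pos.2 hq1
  have hφ2 : φ ^ 2 ≤ 5 * t := arccos_exp_neg_sq_le ht.le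
  have h := hA.ouPair_norm_sub_gt_le (Real.toNNReal_pos.2 hC) (φ := φ) (η := ρ * √N) h0
    (Real.arccos_le_pi _) (by positivity)
  rw [hcos, Real.coe_toNNReal C hC.le] at h
  refine h.trans ?_
  have h2 : √2 ^ N ≤ Real.exp N := by
    have : √2 ≤ Real.exp 1 := by
      have h3 : √2 ≤ 2 := by rw [Real.sqrt_le_left (by norm_num)]; norm_num
      linarith [Real.add_one_le_exp (1 : ℝ)]
    calc √2 ^ N ≤ Real.exp 1 ^ N := by gcongr
      _ = Real.exp N := by rw [← Real.exp_nat_mul, mul_one]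
  have h3 : 2 * (N : ℝ) ≤ (ρ * √N) ^ 2 / (4 * C ^ 2 * φ ^ 2) := by
    rw [le_div_iff₀ (by positivity), mul_pow, Real.sq_sqrt (Nat.cast_nonneg N)]
    have h5 : 4 * C ^ 2 * φ ^ 2 ≤ 4 * C ^ 2 * (5 * t) := by gcongr
    have h6 : 2 * (4 * C ^ 2 * φ ^ 2) ≤ ρ ^ 2 := by linarith
    have h7 := mul_le_mul_of_nonneg_right h6 (Nat.cast_nonneg (α := ℝ) N)
    linarith
  calc √2 ^ N * Real.exp (-((ρ * √N) ^ 2 / (4 * C ^ 2 * φ ^ 2)))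
      ≤ Real.exp N * Real.exp (-(2 * N)) := by gcongr
    _ = Real.exp (-N) := by rw [← Real.exp_add]; congr 1; ring

/-- The constant `12 = 1 + 1 + 10` collects the three error terms of the chain bound. -/
theorem le_exp_of_sq_le {p c N : ℝ} (hp : p ^ 2 ≤ 12 * Real.exp (-(4 * c * N)))
    (hN : 3 ≤ 2 * c * N) : p ≤ Real.exp (-(c * N)) := by
  refine abs_le_of_sq_le_sq' ?_ (Real.exp_pos _).le |>.2
  refine hp.trans ?_
  rw [← Real.exp_nat_mul]
  have h3 : (12 : ℝ) ≤ Real.exp 3 := by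
    have := Real.exp_one_gt_d9
    have h : Real.exp 3 = Real.exp 1 ^ 3 := by rw [← Real.exp_nat_mul]; norm_num
    rw [h]
    have : (2.7 : ℝ) ^ 3 ≤ Real.exp 1 ^ 3 := by gcongr; linarith
    norm_num at this ⊢
    linarith
  calc 12 * Real.exp (-(4 * c * N)) ≤ Real.exp (2 * c * N) * Real.exp (-(4 * c * N)) := by
        gcongr; exact h3.trans (Real.exp_le_exp.2 hN)
    _ = _ := by rw [← Real.exp_add]; congr 1; push_cast; ring

theorem eventually_lipschitz_success_le {γ δ ρ T c C : ℝ} {r : ℕ} (hρ : 0 < ρ) (hT : 0 < T)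
    (hc : 0 < c) (hC : 0 < C)
    (hmain : ∀ N : ℕ, 0 < N → ∀ m : ℕ, r ≤ m →
      ∀ (Ω : Type u) [MeasurableSpace Ω] (ν : Measure Ω) [IsProbabilityMeasure ν]
      (A : Disorder N → Ω → EuclideanSpace ℝ (Fin N)),
      Measurable (fun z : Disorder N × Ω => A z.1 z.2) →
      randomizedSuccess ν γ δ A ^ 2 ≤
        ((ouPair (Disorder N) (Real.exp (-(T / 2 ^ m)))).prod ν).real
          {z | ρ * √N < ‖A z.1.1 z.2 - A z.1.2 z.2‖} +
        (Real.exp (-(ρ * N)) + 10 * Real.exp (-(c * N / 2 ^ m)))) :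
    ∃ c' : ℝ, 0 < c' ∧ ∀ᶠ N : ℕ in atTop, ∀ (Ω : Type u) [MeasurableSpace Ω]
      (ν : Measure Ω) [IsProbabilityMeasure ν] (A : Disorder N → Ω → EuclideanSpace ℝ (Fin N)),
      Measurable (fun z : Disorder N × Ω => A z.1 z.2) →
      (∀ ω, LipschitzWith C.toNNReal (fun g => A g ω)) →
      randomizedSuccess ν γ δ A ≤ Real.exp (-(c' * N)) := by
  -- The number of steps is fixed independently of `N`, so `exp (-(c * N / 2 ^ m))` remains
  -- exponential in `N`.
  obtain ⟨m, hmr, hm⟩ : ∃ m : ℕ, r ≤ m ∧ 40 * C ^ 2 * (T / 2 ^ m) ≤ ρ ^ 2 := by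
    have h1 : Tendsto (fun m : ℕ => 40 * C ^ 2 * (T / (2 : ℝ) ^ m)) atTop (𝓝 (40 * C ^ 2 * 0)) :=
      (tendsto_const_nhds.div_atTop (tendsto_pow_atTop_atTop_of_one_lt one_lt_two)).const_mul _
    rw [mul_zero] at h1
    exact ((eventually_ge_atTop r).and (h1.eventually_le_const (by positivity))).exists
  set c' := min 1 (min ρ (c / 2 ^ m)) / 4 with hc'
  have hc'0 : 0 < c' := by
    rw [hc']; apply div_pos (lt_min one_pos (lt_min hρ (by positivity))) (by norm_num)
  have h1 : 4 * c' ≤ 1 := by rw [hc']; linarith [min_le_left 1 (min ρ (c / 2 ^ m))]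
  have h2 : 4 * c' ≤ ρ := by
    rw [hc']; linarith [(min_le_right 1 (min ρ (c / 2 ^ m))).trans (min_le_left _ _)]
  have h3 : 4 * c' ≤ c / 2 ^ m := by
    rw [hc']; linarith [(min_le_right 1 (min ρ (c / 2 ^ m))).trans (min_le_right _ _)]
  refine ⟨c', hc'0, ?_⟩
  have hlarge : ∀ᶠ N : ℕ in atTop, 3 ≤ 2 * c' * (N : ℝ) :=
    (tendsto_natCast_atTop_atTop.const_mul_atTop (by positivity)).eventually_ge_atTop 3
  filter_upwards [hlarge, eventually_gt_atTop 0] with N hN hN0 Ω _ ν _ A hA hLip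
  have hNr : (0 : ℝ) ≤ N := Nat.cast_nonneg N
  refine le_exp_of_sq_le ((hmain N hN0 m hmr Ω ν A hA).trans ?_) hN
  have hS : MeasurableSet {z : (Disorder N × Disorder N) × Ω |
      ρ * √N < ‖A z.1.1 z.2 - A z.1.2 z.2‖} := by
    have e1 : Measurable fun z : (Disorder N × Disorder N) × Ω => A z.1.1 z.2 :=
      hA.comp (by fun_prop : Measurable fun z : (Disorder N × Disorder N) × Ω => (z.1.1, z.2))
    have e2 : Measurable fun z : (Disorder N × Disorder N) × Ω => A z.1.2 z.2 :=
      hA.comp (by fun_prop : Measurable fun z : (Disorder N × Disorder N) × Ω => (z.1.2, z.2))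
    exact measurableSet_lt measurable_const (by fun_prop)
  have hu := prod_real_le_of_forall (ouPair (Disorder N) (Real.exp (-(T / 2 ^ m)))) ν hS
    (Real.exp_pos (-N)).le (fun ω => lipschitz_instability_le hC (hLip ω) hρ
      (by positivity : 0 < T / 2 ^ m) hm)
  have b1 : Real.exp (-(N : ℝ)) ≤ Real.exp (-(4 * c' * N)) := by
    apply Real.exp_le_exp.2
    have := mul_le_mul_of_nonneg_right h1 hNr
    linarith
  have b2 : Real.exp (-(ρ * N)) ≤ Real.exp (-(4 * c' * N)) := by
    apply Real.exp_le_exp.2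
    have := mul_le_mul_of_nonneg_right h2 hNr
    linarith
  have b3 : Real.exp (-(c * N / 2 ^ m)) ≤ Real.exp (-(4 * c' * N)) := by
    apply Real.exp_le_exp.2
    have := mul_le_mul_of_nonneg_right h3 hNr
    have e : c * N / 2 ^ m = c / 2 ^ m * N := by ring
    linarith
  linarith

end LipschitzAlgorithms

/-! ### Leading terms under affine substitution -/

section AffineSubstitution

variable {ι : Type*}

/-- Substitution of `q x + c` for the variables of a polynomial. -/
noncomputable def affineSubst (q : ℝ) (c : ι → ℝ) :
    MvPolynomial ι ℝ →ₐ[ℝ] MvPolynomial ι ℝ :=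
  MvPolynomial.aeval fun k => MvPolynomial.C q * MvPolynomial.X k + MvPolynomial.C (c k)

theorem eval_affineSubst (q : ℝ) (c x : ι → ℝ) (p : MvPolynomial ι ℝ) :
    MvPolynomial.eval x (affineSubst q c p) =
      MvPolynomial.eval (fun k => q * x k + c k) p := by
  induction p using MvPolynomial.induction_on with
  | C a => simp [affineSubst, MvPolynomial.algebraMap_eq]
  | add p r hp hr => rw [map_add, map_add, map_add, hp, hr]
  | mul_X p k hp =>
    rw [map_mul, map_mul, map_mul, hp]
    simp [affineSubst]

/-- The proposition that all monomials of `r` have degree less than `d`. -/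
def DegreeLT (r : MvPolynomial ι ℝ) (d : ℕ) : Prop := r = 0 ∨ r.totalDegree < d

theorem DegreeLT.add {r s : MvPolynomial ι ℝ} {d : ℕ} (hr : DegreeLT r d) (hs : DegreeLT s d) :
    DegreeLT (r + s) d := by
  rcases hr with rfl | hr
  · simpa using hs
  rcases hs with rfl | hs
  · rw [add_zero]; exact Or.inr hr
  · exact Or.inr ((MvPolynomial.totalDegree_add r s).trans_lt (max_lt hr hs))

theorem DegreeLT.mul {r s : MvPolynomial ι ℝ} {d e : ℕ} (hr : DegreeLT r d)
    (hs : s.totalDegree ≤ e) : DegreeLT (r * s) (d + e) := by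
  rcases hr with rfl | hr
  · exact Or.inl (zero_mul s)
  · exact Or.inr ((MvPolynomial.totalDegree_mul r s).trans_lt (by omega))

theorem DegreeLT.le {r : MvPolynomial ι ℝ} {d : ℕ} (hr : DegreeLT r (d + 1)) :
    r.totalDegree ≤ d := by
  rcases hr with rfl | hr
  · simp
  · omega

theorem DegreeLT.totalDegree_le {r : MvPolynomial ι ℝ} {d : ℕ} (hr : DegreeLT r d) :
    r.totalDegree ≤ d := by
  rcases hr with rfl | hr
  · simp
  · omega

/-- The leading term of an affine substitution into a monomial. -/
def HasLeadingTerm (q : ℝ) (c : ι → ℝ) (s : ι →₀ ℕ) : Prop :=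
  ∃ r, affineSubst q c (MvPolynomial.monomial s 1) =
    MvPolynomial.monomial s (q ^ s.degree) + r ∧ DegreeLT r s.degree

theorem HasLeadingTerm.add {q : ℝ} {c : ι → ℝ} {s t : ι →₀ ℕ} (hs : HasLeadingTerm q c s)
    (ht : HasLeadingTerm q c t) : HasLeadingTerm q c (s + t) := by
  obtain ⟨r, hr, hrd⟩ := hs
  obtain ⟨u, hu, hud⟩ := ht
  refine ⟨u * MvPolynomial.monomial s (q ^ s.degree) +
    r * (MvPolynomial.monomial t (q ^ t.degree) + u), ?_, ?_⟩
  · have h1 : (MvPolynomial.monomial (s + t) (1 : ℝ)) =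
        MvPolynomial.monomial s 1 * MvPolynomial.monomial t 1 := by
      rw [MvPolynomial.monomial_mul, one_mul]
    have h2 : (MvPolynomial.monomial (s + t) (q ^ (s + t).degree)) =
        MvPolynomial.monomial s (q ^ s.degree) * MvPolynomial.monomial t (q ^ t.degree) := by
      rw [MvPolynomial.monomial_mul, map_add, pow_add]
    rw [h1, map_mul, hr, hu, h2]
    ring
  · have hm : ∀ (v : ι →₀ ℕ) (a : ℝ), (MvPolynomial.monomial v a).totalDegree ≤ v.degree :=
      fun v a => MvPolynomial.totalDegree_monomial_le v a
    rw [map_add]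
    refine DegreeLT.add ?_ (hrd.mul ?_)
    · rw [add_comm]; exact hud.mul (hm s _)
    · exact (MvPolynomial.totalDegree_add _ _).trans (max_le (hm t _) hud.totalDegree_le)

theorem hasLeadingTerm (q : ℝ) (c : ι → ℝ) (s : ι →₀ ℕ) : HasLeadingTerm q c s := by
  induction s using Finsupp.induction_linear with
  -- For the empty monomial no total degree is below `0`; the alternative `r = 0` in `DegreeLT` is
  -- needed here.
  | zero => exact ⟨0, by simp [affineSubst], Or.inl rfl⟩
  | add s t hs ht => exact hs.add ht
  | single k n =>
    induction n with
    | zero => rw [Finsupp.single_zero]; exact ⟨0, by simp [affineSubst], Or.inl rfl⟩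
    | succ n ih =>
      rw [Finsupp.single_add]
      refine ih.add ⟨MvPolynomial.C (c k), ?_, Or.inr ?_⟩
      · rw [← MvPolynomial.X, affineSubst, MvPolynomial.aeval_X, Finsupp.degree_single, pow_one,
          MvPolynomial.X, MvPolynomial.C_mul_monomial, mul_one]
      · simp

/-- Substituting `q x + c` multiplies each monomial of top degree `n + 1` by `q ^ (n + 1)` modulo
lower degree. This replaces the Hermite expansion: with `q < 1` it gives the decay of correlations,
with `q = 1` the degree drop of differences. -/
theorem totalDegree_affineSubst_sub_le (q : ℝ) (c : ι → ℝ) {p : MvPolynomial ι ℝ} {n : ℕ}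
    (hp : p.totalDegree ≤ n + 1) :
    (affineSubst q c p - MvPolynomial.C (q ^ (n + 1)) * p).totalDegree ≤ n := by
  have hsum : affineSubst q c p - MvPolynomial.C (q ^ (n + 1)) * p =
      ∑ s ∈ p.support, MvPolynomial.C (p.coeff s) *
        (affineSubst q c (MvPolynomial.monomial s 1) -
          MvPolynomial.C (q ^ (n + 1)) * MvPolynomial.monomial s 1) := by
    conv_lhs => rw [p.as_sum]
    rw [map_sum, Finset.mul_sum, ← Finset.sum_sub_distrib]
    refine Finset.sum_congr rfl fun s _ => ?_
    have h1 : MvPolynomial.monomial s (p.coeff s) =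
        MvPolynomial.C (p.coeff s) * MvPolynomial.monomial s 1 := by
      rw [MvPolynomial.C_mul_monomial, mul_one]
    have h2 : affineSubst q c (MvPolynomial.C (p.coeff s)) = MvPolynomial.C (p.coeff s) := by
      simp [affineSubst, MvPolynomial.algebraMap_eq]
    rw [h1, map_mul, h2]
    ring
  rw [hsum]
  refine MvPolynomial.totalDegree_finsetSum_le fun s hs => ?_
  refine (MvPolynomial.totalDegree_mul _ _).trans ?_
  rw [MvPolynomial.totalDegree_C, zero_add]
  obtain ⟨r, hr, hrd⟩ := hasLeadingTerm q c s
  have hsn : s.degree ≤ n + 1 := (MvPolynomial.le_totalDegree hs).trans hp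
  rw [hr, MvPolynomial.C_mul_monomial, mul_one]
  rcases Nat.lt_or_eq_of_le hsn with h | h
  · have hm : ∀ a : ℝ, (MvPolynomial.monomial s a).totalDegree ≤ n := fun a =>
      (MvPolynomial.totalDegree_monomial_le s a).trans (Nat.lt_succ_iff.1 h)
    refine (MvPolynomial.totalDegree_sub _ _).trans (max_le ?_ (hm _))
    exact (MvPolynomial.totalDegree_add _ _).trans
      (max_le (hm _) (hrd.totalDegree_le.trans (Nat.lt_succ_iff.1 h)))
  · rw [h, add_sub_cancel_left]
    rw [h] at hrd
    exact hrd.le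

theorem totalDegree_affineSubst_le (q : ℝ) (c : ι → ℝ) {p : MvPolynomial ι ℝ} {n : ℕ}
    (hp : p.totalDegree ≤ n) : (affineSubst q c p).totalDegree ≤ n := by
  have h := totalDegree_affineSubst_sub_le q c (hp.trans (Nat.le_succ n))
  have h2 : affineSubst q c p = (affineSubst q c p - MvPolynomial.C (q ^ (n + 1)) * p) +
      MvPolynomial.C (q ^ (n + 1)) * p := by ring
  rw [h2]
  refine (MvPolynomial.totalDegree_add _ _).trans (max_le h ?_)
  refine (MvPolynomial.totalDegree_mul _ _).trans ?_
  rw [MvPolynomial.totalDegree_C, zero_add]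
  exact hp

end AffineSubstitution

/-! ### Second moment stability of low-degree polynomials -/

section PolynomialStability

variable {ι : Type*}

/-- The function on Euclidean space defined by a polynomial. -/
noncomputable def polyFun (p : MvPolynomial ι ℝ) (x : EuclideanSpace ℝ ι) : ℝ :=
  MvPolynomial.eval (fun k => x k) p

theorem continuous_polyFun (p : MvPolynomial ι ℝ) : Continuous (polyFun p) := by
  unfold polyFun
  exact (MvPolynomial.continuous_eval p).comp (by fun_prop)

theorem polyFun_mul (p r : MvPolynomial ι ℝ) (x : EuclideanSpace ℝ ι) :
    polyFun (p * r) x = polyFun p x * polyFun r x := by simp [polyFun]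

theorem polyFun_add (p r : MvPolynomial ι ℝ) (x : EuclideanSpace ℝ ι) :
    polyFun (p + r) x = polyFun p x + polyFun r x := by simp [polyFun]

variable [Fintype ι]

@[fun_prop]
theorem measurable_polyFun (p : MvPolynomial ι ℝ) : Measurable (polyFun p) :=
  (continuous_polyFun p).measurable

theorem integrable_pow_gaussianReal (n : ℕ) : Integrable (fun x : ℝ => x ^ n) (gaussianReal 0 1) := by
  have h := (memLp_id_gaussianReal (μ := 0) (v := 1) n).integrable_norm_pow'
  refine h.mono' (by fun_prop) (Eventually.of_forall fun x => ?_)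
  simp

theorem integrable_polyFun (p : MvPolynomial ι ℝ) :
    Integrable (polyFun p) (stdGaussian (EuclideanSpace ℝ ι)) := by
  rw [← map_pi_eq_stdGaussian, integrable_map_measure
    (continuous_polyFun p).aestronglyMeasurable (by fun_prop)]
  have h : polyFun p ∘ WithLp.toLp 2 = fun x : ι → ℝ =>
      ∑ s ∈ p.support, p.coeff s * ∏ k, x k ^ s k := by
    ext x
    simp [polyFun, MvPolynomial.eval_eq']
  rw [h]
  refine integrable_finsetSum _ fun s _ => Integrable.const_mul ?_ _
  exact Integrable.fintype_prod fun k => integrable_pow_gaussianReal (s k)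

theorem memLp_two_polyFun (p : MvPolynomial ι ℝ) :
    MemLp (polyFun p) 2 (stdGaussian (EuclideanSpace ℝ ι)) := by
  rw [memLp_two_iff_integrable_sq (continuous_polyFun p).aestronglyMeasurable]
  exact (integrable_polyFun (p * p)).congr
    (Eventually.of_forall fun x => by rw [polyFun_mul, ← sq])

variable (ι) in
/-- Polynomials as elements of the Gaussian `L²` space. -/
noncomputable def polyToL2 :
    MvPolynomial ι ℝ →ₗ[ℝ] Lp ℝ 2 (stdGaussian (EuclideanSpace ℝ ι)) where
  toFun p := (memLp_two_polyFun p).toLp (polyFun p)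
  map_add' p r := by
    rw [← MemLp.toLp_add]
    congr 1
    ext x
    exact polyFun_add p r x
  map_smul' a p := by
    rw [RingHom.id_apply, ← MemLp.toLp_const_smul]
    congr 1
    ext x
    simp [polyFun]

theorem inner_polyToL2 (p r : MvPolynomial ι ℝ) :
    ⟪polyToL2 ι p, polyToL2 ι r⟫ =
      ∫ x, polyFun p x * polyFun r x ∂(stdGaussian (EuclideanSpace ℝ ι)) := by
  rw [L2.inner_def]
  refine integral_congr_ae ?_
  filter_upwards [(memLp_two_polyFun p).coeFn_toLp, (memLp_two_polyFun r).coeFn_toLp] with x hp hr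
  simp only [polyToL2, LinearMap.coe_mk, AddHom.coe_mk]
  rw [hp, hr]
  simp [mul_comm]

/-- Every polynomial splits into a polynomial of degree at most `n` and one orthogonal to all
polynomials of degree at most `n`. -/
theorem exists_orthogonal_decomposition (n : ℕ) (p : MvPolynomial ι ℝ) :
    ∃ p₀ : MvPolynomial ι ℝ, p₀.totalDegree ≤ n ∧ ∀ r : MvPolynomial ι ℝ, r.totalDegree ≤ n →
      ∫ x, polyFun (p - p₀) x * polyFun r x ∂(stdGaussian (EuclideanSpace ℝ ι)) = 0 := by
  set K := (MvPolynomial.restrictTotalDegree ι ℝ n).map (polyToL2 ι)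
  have : FiniteDimensional ℝ K := by
    have : Module.Finite ℝ (MvPolynomial.restrictTotalDegree ι ℝ n) := inferInstance
    exact Module.Finite.map _ _
  obtain ⟨p₀, hp₀, hproj⟩ := (K.starProjection_apply_mem (polyToL2 ι p))
  refine ⟨p₀, (MvPolynomial.mem_restrictTotalDegree _ _ _).1 hp₀, fun r hr => ?_⟩
  rw [← inner_polyToL2, map_sub, hproj]
  exact K.starProjection_inner_eq_zero (polyToL2 ι p) _
    (Submodule.mem_map_of_mem ((MvPolynomial.mem_restrictTotalDegree _ _ _).2 hr))

theorem polyFun_ouStep (q : ℝ) (p : MvPolynomial ι ℝ) (x y : EuclideanSpace ℝ ι) :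
    polyFun p (ouStep q x y) = polyFun (affineSubst q (fun k => √(1 - q ^ 2) * y k) p) x := by
  unfold polyFun
  rw [eval_affineSubst]
  simp [ouStep]

theorem integral_ouPair {f : EuclideanSpace ℝ ι × EuclideanSpace ℝ ι → ℝ} (hf : Measurable f)
    (q : ℝ) : ∫ z, f z ∂(ouPair (EuclideanSpace ℝ ι) q) =
      ∫ z, f (z.1, ouStep q z.1 z.2)
        ∂((stdGaussian (EuclideanSpace ℝ ι)).prod (stdGaussian (EuclideanSpace ℝ ι))) := by
  rw [ouPair, integral_map (by fun_prop) hf.aestronglyMeasurable]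

theorem memLp_polyFun_fst (q : ℝ) (p : MvPolynomial ι ℝ) :
    MemLp (fun z => polyFun p z.1) 2 (ouPair (EuclideanSpace ℝ ι) q) :=
  (memLp_two_polyFun p).comp_measurePreserving ⟨measurable_fst, ouPair_map_fst q⟩

theorem memLp_polyFun_snd {q : ℝ} (h0 : 0 ≤ q) (h1 : q ≤ 1) (p : MvPolynomial ι ℝ) :
    MemLp (fun z => polyFun p z.2) 2 (ouPair (EuclideanSpace ℝ ι) q) :=
  (memLp_two_polyFun p).comp_measurePreserving ⟨measurable_snd, ouPair_map_snd h0 h1⟩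

/-- The correlation of two polynomials at the two ends of a step of the chain. -/
noncomputable def polyCorr (q : ℝ) (p r : MvPolynomial ι ℝ) : ℝ :=
  ∫ z, polyFun p z.1 * polyFun r z.2 ∂(ouPair (EuclideanSpace ℝ ι) q)

theorem integrable_polyFun_mul {q : ℝ} (h0 : 0 ≤ q) (h1 : q ≤ 1) (p r : MvPolynomial ι ℝ) :
    Integrable (fun z => polyFun p z.1 * polyFun r z.2) (ouPair (EuclideanSpace ℝ ι) q) :=
  (memLp_polyFun_fst q p).integrable_mul (memLp_polyFun_snd h0 h1 r)

theorem polyCorr_comm {q : ℝ} (h0 : 0 ≤ q) (h1 : q ≤ 1) (p r : MvPolynomial ι ℝ) :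
    polyCorr q p r = polyCorr q r p := by
  unfold polyCorr
  conv_lhs => rw [← ouPair_map_swap h0 h1, integral_map (by fun_prop)
    (Measurable.aestronglyMeasurable (by fun_prop))]
  refine integral_congr_ae (Eventually.of_forall fun z => ?_)
  simp [mul_comm]

/-- Integrating first over the starting point, with the innovation `y` frozen, leaves a polynomial
in `x` of no larger degree, to which orthogonality applies for every `y`. -/
theorem polyCorr_eq_integral_integral {q : ℝ} (h0 : 0 ≤ q) (h1 : q ≤ 1) (p r : MvPolynomial ι ℝ) :
    polyCorr q p r = ∫ y, ∫ x, polyFun p x *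
      polyFun (affineSubst q (fun k => √(1 - q ^ 2) * y k) r) x
      ∂(stdGaussian (EuclideanSpace ℝ ι)) ∂(stdGaussian (EuclideanSpace ℝ ι)) := by
  have hint := integrable_polyFun_mul h0 h1 p r
  rw [ouPair, integrable_map_measure (Measurable.aestronglyMeasurable (by fun_prop))
    (by fun_prop)] at hint
  rw [polyCorr, integral_ouPair (by fun_prop)]
  refine (integral_prod_symm _ hint).trans ?_
  simp only [Function.comp_apply]
  simp only [polyFun_ouStep]

theorem polyCorr_add_left {q : ℝ} (h0 : 0 ≤ q) (h1 : q ≤ 1) (p p' r : MvPolynomial ι ℝ) :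
    polyCorr q (p + p') r = polyCorr q p r + polyCorr q p' r := by
  unfold polyCorr
  rw [← integral_add (integrable_polyFun_mul h0 h1 p r) (integrable_polyFun_mul h0 h1 p' r)]
  simp only [polyFun_add, add_mul]

theorem integral_polyFun_mul_self_nonneg (p : MvPolynomial ι ℝ) :
    0 ≤ ∫ x, polyFun p x * polyFun p x ∂(stdGaussian (EuclideanSpace ℝ ι)) :=
  integral_nonneg fun _ => mul_self_nonneg _

theorem integrable_polyFun_mul_polyFun (p r : MvPolynomial ι ℝ) :
    Integrable (fun x => polyFun p x * polyFun r x) (stdGaussian (EuclideanSpace ℝ ι)) := by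
  exact (integrable_polyFun (p * r)).congr (Eventually.of_forall fun x => polyFun_mul p r x)

/-- Low-degree polynomials are stable: their autocorrelation is at least `q ^ D`. -/
theorem pow_mul_le_polyCorr {q : ℝ} (h0 : 0 ≤ q) (h1 : q ≤ 1) {D : ℕ} {p : MvPolynomial ι ℝ}
    (hp : p.totalDegree ≤ D) :
    q ^ D * ∫ x, polyFun p x * polyFun p x ∂(stdGaussian (EuclideanSpace ℝ ι)) ≤
      polyCorr q p p := by
  induction D generalizing p with
  | zero =>
    obtain ⟨a, rfl⟩ : ∃ a, p = MvPolynomial.C a :=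
      ⟨_, MvPolynomial.totalDegree_eq_zero_iff_eq_C.1 (Nat.le_zero.1 hp)⟩
    simp [polyCorr, polyFun]
  | succ D ih =>
    obtain ⟨p₀, hp₀, horth⟩ := exists_orthogonal_decomposition D p
    set p₁ := p - p₀ with hp₁
    have hp₁d : p₁.totalDegree ≤ D + 1 :=
      (MvPolynomial.totalDegree_sub _ _).trans (max_le hp (hp₀.trans (Nat.le_succ D)))
    have hsplit : p = p₁ + p₀ := by rw [hp₁]; ring
    -- With the innovation frozen, `p₀` still has degree at most `D` and is orthogonal to `p₁`.
    have c01 : polyCorr q p₁ p₀ = 0 := by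
      rw [polyCorr_eq_integral_integral h0 h1]
      simp only [horth _ (totalDegree_affineSubst_le _ _ hp₀), integral_zero]
    -- The step acts on `p₁` as multiplication by `q ^ (D + 1)`, up to degree at most `D`, which
    -- `p₁` does not see.
    have c11 : polyCorr q p₁ p₁ = q ^ (D + 1) *
        ∫ x, polyFun p₁ x * polyFun p₁ x ∂(stdGaussian (EuclideanSpace ℝ ι)) := by
      rw [polyCorr_eq_integral_integral h0 h1]
      have hy : ∀ y : EuclideanSpace ℝ ι, ∫ x, polyFun p₁ x *
          polyFun (affineSubst q (fun k => √(1 - q ^ 2) * y k) p₁) x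
          ∂(stdGaussian (EuclideanSpace ℝ ι)) =
          q ^ (D + 1) *
            ∫ x, polyFun p₁ x * polyFun p₁ x ∂(stdGaussian (EuclideanSpace ℝ ι)) := by
        intro y
        set c : ι → ℝ := fun k => √(1 - q ^ 2) * y k
        have hz := horth _ (totalDegree_affineSubst_sub_le q c hp₁d)
        have hx : ∀ x, polyFun p₁ x * polyFun (affineSubst q c p₁) x =
            polyFun p₁ x * polyFun (affineSubst q c p₁ - MvPolynomial.C (q ^ (D + 1)) * p₁) x +
            q ^ (D + 1) * (polyFun p₁ x * polyFun p₁ x) := by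
          intro x
          simp only [polyFun, map_sub, map_mul, MvPolynomial.eval_C]
          ring
        simp_rw [hx]
        rw [integral_add (integrable_polyFun_mul_polyFun _ _)
          ((integrable_polyFun_mul_polyFun _ _).const_mul _), hz, integral_const_mul, zero_add]
      simp only [hy, integral_const, probReal_univ, one_smul]
    have hnorm : ∫ x, polyFun p x * polyFun p x ∂(stdGaussian (EuclideanSpace ℝ ι)) =
        ∫ x, polyFun p₁ x * polyFun p₁ x ∂(stdGaussian (EuclideanSpace ℝ ι)) +
        ∫ x, polyFun p₀ x * polyFun p₀ x ∂(stdGaussian (EuclideanSpace ℝ ι)) := by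
      have hx : ∀ x, polyFun p x * polyFun p x = polyFun p₁ x * polyFun p₁ x +
          polyFun p₀ x * polyFun p₀ x + 2 * (polyFun p₁ x * polyFun p₀ x) := by
        intro x; rw [hsplit, polyFun_add]; ring
      have hi : Integrable (fun x => polyFun p₁ x * polyFun p₁ x + polyFun p₀ x * polyFun p₀ x)
          (stdGaussian (EuclideanSpace ℝ ι)) :=
        (integrable_polyFun_mul_polyFun _ _).add (integrable_polyFun_mul_polyFun _ _)
      simp_rw [hx]
      rw [integral_add hi ((integrable_polyFun_mul_polyFun _ _).const_mul _),
        integral_add (integrable_polyFun_mul_polyFun _ _) (integrable_polyFun_mul_polyFun _ _),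
        integral_const_mul, horth p₀ hp₀]
      ring
    have hcorr : polyCorr q p p = polyCorr q p₁ p₁ + polyCorr q p₀ p₀ := by
      rw [hsplit, polyCorr_add_left h0 h1, polyCorr_comm h0 h1 p₁ (p₁ + p₀),
        polyCorr_comm h0 h1 p₀ (p₁ + p₀), polyCorr_add_left h0 h1, polyCorr_add_left h0 h1,
        polyCorr_comm h0 h1 p₀ p₁, c01]
      ring
    rw [hcorr, c11, hnorm, mul_add]
    gcongr
    refine le_trans ?_ (ih hp₀)
    have := integral_polyFun_mul_self_nonneg p₀
    exact mul_le_mul_of_nonneg_right (pow_le_pow_of_le_one h0 h1 (Nat.le_succ D)) this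

/-- Expand the square: stationarity gives two equal second moments, and the cross term is the
autocorrelation. -/
theorem integral_sq_polyFun_sub_le {q : ℝ} (h0 : 0 ≤ q) (h1 : q ≤ 1) {D : ℕ}
    {p : MvPolynomial ι ℝ} (hp : p.totalDegree ≤ D) :
    ∫ z, (polyFun p z.1 - polyFun p z.2) ^ 2 ∂(ouPair (EuclideanSpace ℝ ι) q) ≤
      2 * (1 - q ^ D) * ∫ x, polyFun p x ^ 2 ∂(stdGaussian (EuclideanSpace ℝ ι)) := by
  have h2 := pow_mul_le_polyCorr h0 h1 hp
  have e1 : ∫ z, polyFun p z.1 ^ 2 ∂(ouPair (EuclideanSpace ℝ ι) q) =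
      ∫ x, polyFun p x ^ 2 ∂(stdGaussian (EuclideanSpace ℝ ι)) := by
    conv_rhs => rw [← ouPair_map_fst q, integral_map (by fun_prop)
      (Measurable.aestronglyMeasurable (by fun_prop))]
  have e2 : ∫ z, polyFun p z.2 ^ 2 ∂(ouPair (EuclideanSpace ℝ ι) q) =
      ∫ x, polyFun p x ^ 2 ∂(stdGaussian (EuclideanSpace ℝ ι)) := by
    conv_rhs => rw [← ouPair_map_snd h0 h1, integral_map (by fun_prop)
      (Measurable.aestronglyMeasurable (by fun_prop))]
  have hx : ∀ z : EuclideanSpace ℝ ι × EuclideanSpace ℝ ι, (polyFun p z.1 - polyFun p z.2) ^ 2 =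
      polyFun p z.1 ^ 2 + polyFun p z.2 ^ 2 - 2 * (polyFun p z.1 * polyFun p z.2) := by
    intro z; ring
  have hi : Integrable (fun z => polyFun p z.1 ^ 2 + polyFun p z.2 ^ 2)
      (ouPair (EuclideanSpace ℝ ι) q) :=
    (memLp_polyFun_fst q p).integrable_sq.add (memLp_polyFun_snd h0 h1 p).integrable_sq
  simp_rw [hx]
  rw [integral_sub hi ((integrable_polyFun_mul h0 h1 p p).const_mul 2),
    integral_add (memLp_polyFun_fst q p).integrable_sq (memLp_polyFun_snd h0 h1 p).integrable_sq,
    integral_const_mul, e1, e2]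
  simp only [polyCorr, ← sq] at h2
  linarith

end PolynomialStability

/-! ### The two-point hypercontractive inequality -/

section TwoPointInequality

/-- Coefficientwise form of the two-point inequality. The ratio of consecutive left-hand terms is
`(k - j)(2k - 2j - 1) / ((j + 1)(2j + 1))`, at most the ratio `(k - j)(2k - 1) / (j + 1)` on the
right. -/
theorem choose_two_mul_le (k j : ℕ) :
    (2 * k).choose (2 * j) ≤ k.choose j * (2 * k - 1) ^ j := by
  induction j with
  | zero => simp
  | succ j ih =>
    rcases Nat.lt_or_ge j k with hj | hj
    · have h1 := Nat.choose_succ_right_eq (2 * k) (2 * j)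
      have h2 := Nat.choose_succ_right_eq (2 * k) (2 * j + 1)
      have h3 := Nat.choose_succ_right_eq k j
      obtain ⟨d, rfl⟩ : ∃ d, k = j + 1 + d := ⟨k - j - 1, by omega⟩
      have e1 : 2 * (j + 1 + d) - 2 * j = 2 * (d + 1) := by omega
      have e2 : 2 * (j + 1 + d) - (2 * j + 1) = 2 * d + 1 := by omega
      have e3 : j + 1 + d - j = d + 1 := by omega
      have e4 : 2 * (j + 1 + d) - 1 = 2 * j + 2 * d + 1 := by omega
      rw [e1] at h1
      rw [e2] at h2
      rw [e3] at h3
      rw [e4] at ih ⊢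
      have e5 : 2 * (j + 1) = 2 * j + 1 + 1 := by ring
      rw [e5]
      set A := (2 * (j + 1 + d)).choose (2 * j)
      set A' := (2 * (j + 1 + d)).choose (2 * j + 1)
      set A'' := (2 * (j + 1 + d)).choose (2 * j + 1 + 1)
      set B := (j + 1 + d).choose j
      set B' := (j + 1 + d).choose (j + 1)
      set M := 2 * j + 2 * d + 1
      refine Nat.le_of_mul_le_mul_right (c := 2 * (j + 1) * (2 * j + 1)) ?_ (by positivity)
      calc A'' * (2 * (j + 1) * (2 * j + 1)) = (A'' * (2 * j + 1 + 1)) * (2 * j + 1) := by ring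
        _ = (A' * (2 * j + 1)) * (2 * d + 1) := by rw [h2]; ring
        _ = A * ((2 * (d + 1)) * (2 * d + 1)) := by rw [h1]; ring
        _ ≤ (B * M ^ j) * ((2 * (d + 1)) * (M * (2 * j + 1))) := by
          refine Nat.mul_le_mul ih (Nat.mul_le_mul le_rfl ?_)
          calc 2 * d + 1 ≤ M := by omega
            _ ≤ M * (2 * j + 1) := Nat.le_mul_of_pos_right _ (by omega)
        _ = (B * (d + 1)) * (2 * M ^ (j + 1) * (2 * j + 1)) := by ring
        _ = B' * M ^ (j + 1) * (2 * (j + 1) * (2 * j + 1)) := by rw [← h3]; ring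
    · rw [Nat.choose_eq_zero_of_lt (by omega)]
      exact Nat.zero_le _

theorem sum_range_two_mul_add_one {M : Type*} [AddCommMonoid M] (f : ℕ → M) (k : ℕ) :
    ∑ i ∈ Finset.range (2 * k + 1), f i =
      ∑ j ∈ Finset.range (k + 1), f (2 * j) + ∑ j ∈ Finset.range k, f (2 * j + 1) := by
  induction k with
  | zero => simp
  | succ k ih =>
    rw [show 2 * (k + 1) + 1 = 2 * k + 1 + 1 + 1 by ring, Finset.sum_range_succ,
      Finset.sum_range_succ, ih, Finset.sum_range_succ (fun j => f (2 * j)) (k + 1),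
      Finset.sum_range_succ (fun j => f (2 * j + 1)) k,
      show 2 * (k + 1) = 2 * k + 1 + 1 by ring]
    abel

/-- The two-point hypercontractive inequality for even exponents. -/
theorem half_add_pow_two_mul_le (x y : ℝ) {k : ℕ} (hk : 1 ≤ k) :
    ((x + y) ^ (2 * k) + (x - y) ^ (2 * k)) / 2 ≤ (x ^ 2 + (2 * k - 1) * y ^ 2) ^ k := by
  have hc : ((2 * k - 1 : ℕ) : ℝ) = 2 * k - 1 := by
    rw [Nat.cast_sub (by omega)]; push_cast; ring
  have hsum : ((x + y) ^ (2 * k) + (x - y) ^ (2 * k)) / 2 =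
      ∑ j ∈ Finset.range (k + 1), (y ^ 2) ^ j * (x ^ 2) ^ (k - j) * (2 * k).choose (2 * j) := by
    rw [sub_eq_add_neg, add_comm x, add_comm x, add_pow, add_pow, sum_range_two_mul_add_one,
      sum_range_two_mul_add_one]
    have he : ∀ j ∈ Finset.range (k + 1), y ^ (2 * j) * x ^ (2 * k - 2 * j) *
        ((2 * k).choose (2 * j) : ℝ) =
        (y ^ 2) ^ j * (x ^ 2) ^ (k - j) * (2 * k).choose (2 * j) := by
      intro j _
      rw [← pow_mul, ← pow_mul, Nat.mul_sub]
    have hen : ∀ j ∈ Finset.range (k + 1), (-y) ^ (2 * j) * x ^ (2 * k - 2 * j) *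
        ((2 * k).choose (2 * j) : ℝ) =
        (y ^ 2) ^ j * (x ^ 2) ^ (k - j) * (2 * k).choose (2 * j) := by
      intro j hj
      rw [Even.neg_pow (even_two_mul j), he j hj]
    have ho : ∀ j ∈ Finset.range k, (-y) ^ (2 * j + 1) * x ^ (2 * k - (2 * j + 1)) *
        ((2 * k).choose (2 * j + 1) : ℝ) =
        -(y ^ (2 * j + 1) * x ^ (2 * k - (2 * j + 1)) * (2 * k).choose (2 * j + 1)) := by
      intro j _
      rw [Odd.neg_pow (odd_two_mul_add_one j)]
      ring
    rw [Finset.sum_congr rfl he, Finset.sum_congr rfl hen, Finset.sum_congr rfl ho,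
      Finset.sum_neg_distrib]
    ring
  rw [hsum, add_comm (x ^ 2), add_pow]
  refine Finset.sum_le_sum fun j _ => ?_
  have h : ((2 * k).choose (2 * j) : ℝ) ≤ k.choose j * (2 * k - 1) ^ j := by
    rw [← hc]
    exact_mod_cast choose_two_mul_le k j
  calc (y ^ 2) ^ j * (x ^ 2) ^ (k - j) * ((2 * k).choose (2 * j) : ℝ)
      ≤ (y ^ 2) ^ j * (x ^ 2) ^ (k - j) * (k.choose j * (2 * k - 1) ^ j) := by gcongr
    _ = ((2 * k - 1) * y ^ 2) ^ j * (x ^ 2) ^ (k - j) * k.choose j := by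
      rw [mul_pow]; ring

end TwoPointInequality

/-! ### Minkowski and hypercontractivity for positive functionals -/

section PositiveFunctional

variable {ι : Type*}

/-- A linear functional on polynomials is positive if it is nonnegative on polynomials that are
nonnegative everywhere. -/
def IsPositiveFunctional (L : MvPolynomial ι ℝ →ₗ[ℝ] ℝ) : Prop :=
  ∀ p, (∀ x, 0 ≤ MvPolynomial.eval x p) → 0 ≤ L p

theorem IsPositiveFunctional.mono {L : MvPolynomial ι ℝ →ₗ[ℝ] ℝ} (hL : IsPositiveFunctional L)
    {p r : MvPolynomial ι ℝ} (h : ∀ x, MvPolynomial.eval x p ≤ MvPolynomial.eval x r) :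
    L p ≤ L r := by
  have := hL (r - p) fun x => by rw [map_sub]; exact sub_nonneg.2 (h x)
  rw [map_sub] at this
  linarith

/-- Jensen for the power `k + 1` with weights `α i / ∑ α`. Being pointwise and linear in the powers
of `x i`, it yields Minkowski's inequality for any positive functional. -/
theorem sum_pow_succ_le {κ : Type*} (s : Finset κ) (x α : κ → ℝ) (hx : ∀ i ∈ s, 0 ≤ x i)
    (hα : ∀ i ∈ s, 0 < α i) (hs : s.Nonempty) (k : ℕ) :
    (∑ i ∈ s, x i) ^ (k + 1) ≤
      ∑ i ∈ s, (∑ i ∈ s, α i) ^ k * ((α i) ^ k)⁻¹ * x i ^ (k + 1) := by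
  set S := ∑ i ∈ s, α i
  have hS : 0 < S := Finset.sum_pos hα hs
  have h := Real.pow_arith_mean_le_arith_mean_pow s (fun i => α i / S)
    (fun i => S * (α i)⁻¹ * x i) (fun i hi => (div_pos (hα i hi) hS).le)
    (by rw [← Finset.sum_div, div_self hS.ne'])
    (fun i hi => mul_nonneg (mul_nonneg hS.le (inv_nonneg.2 (hα i hi).le)) (hx i hi)) (k + 1)
  have e1 : ∑ i ∈ s, α i / S * (S * (α i)⁻¹ * x i) = ∑ i ∈ s, x i := by
    refine Finset.sum_congr rfl fun i hi => ?_
    have := (hα i hi).ne'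
    field_simp
  rw [e1] at h
  refine h.trans (le_of_eq (Finset.sum_congr rfl fun i hi => ?_))
  have := (hα i hi).ne'
  rw [mul_pow, mul_pow, inv_pow]
  field_simp
  ring

/-- Minkowski's inequality for a positive functional. -/
theorem IsPositiveFunctional.map_sum_pow_le {L : MvPolynomial ι ℝ →ₗ[ℝ] ℝ}
    (hL : IsPositiveFunctional L) {κ : Type*} (s : Finset κ) (u : κ → MvPolynomial ι ℝ)
    (α : κ → ℝ) (hu : ∀ i ∈ s, ∀ x, 0 ≤ MvPolynomial.eval x (u i)) (hα : ∀ i ∈ s, 0 ≤ α i)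
    {k : ℕ} (hk : 1 ≤ k) (h : ∀ i ∈ s, L (u i ^ k) ≤ α i ^ k) :
    L ((∑ i ∈ s, u i) ^ k) ≤ (∑ i ∈ s, α i) ^ k := by
  obtain ⟨k, rfl⟩ : ∃ j, k = j + 1 := ⟨k - 1, by omega⟩
  rcases s.eq_empty_or_nonempty with rfl | hs
  · simp
  -- The weights require positive `α i`, so these are shifted by `ε`, which then tends to `0`.
  have hpos : ∀ ε : ℝ, 0 < ε →
      L ((∑ i ∈ s, u i) ^ (k + 1)) ≤ (∑ i ∈ s, (α i + ε)) ^ (k + 1) := by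
    intro ε hε
    have hβ : ∀ i ∈ s, 0 < α i + ε := fun i hi => add_pos_of_nonneg_of_pos (hα i hi) hε
    set S := ∑ i ∈ s, (α i + ε) with hSdef
    have hS : 0 < S := Finset.sum_pos hβ hs
    have h1 : L ((∑ i ∈ s, u i) ^ (k + 1)) ≤
        L (∑ i ∈ s, (S ^ k * ((α i + ε) ^ k)⁻¹) • u i ^ (k + 1)) := by
      refine hL.mono fun x => ?_
      simp only [map_pow, map_sum, MvPolynomial.smul_eval]
      exact sum_pow_succ_le s _ (fun i => α i + ε) (fun i hi => hu i hi x) hβ hs k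
    refine h1.trans ?_
    rw [map_sum, pow_succ S k]
    conv_rhs => rw [hSdef, Finset.mul_sum]
    refine Finset.sum_le_sum fun i hi => ?_
    rw [map_smul, smul_eq_mul, ← hSdef]
    have hb := hβ i hi
    calc S ^ k * ((α i + ε) ^ k)⁻¹ * L (u i ^ (k + 1))
        ≤ S ^ k * ((α i + ε) ^ k)⁻¹ * (α i + ε) ^ (k + 1) := by
          refine mul_le_mul_of_nonneg_left ((h i hi).trans ?_) (by positivity)
          exact pow_le_pow_left₀ (hα i hi) (by linarith) _
      _ = S ^ k * (α i + ε) := by rw [pow_succ (α i + ε)]; field_simp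
  have hlim : Tendsto (fun ε : ℝ => (∑ i ∈ s, (α i + ε)) ^ (k + 1)) (𝓝[>] 0)
      (𝓝 ((∑ i ∈ s, (α i + 0)) ^ (k + 1))) :=
    (Continuous.tendsto (by fun_prop) 0).mono_left nhdsWithin_le_nhds
  simp only [add_zero] at hlim
  exact ge_of_tendsto hlim (eventually_mem_nhdsWithin.mono hpos)

theorem IsPositiveFunctional.map_add_pow_le {L : MvPolynomial ι ℝ →ₗ[ℝ] ℝ}
    (hL : IsPositiveFunctional L) {u w : MvPolynomial ι ℝ} {α β : ℝ}
    (hu : ∀ x, 0 ≤ MvPolynomial.eval x u) (hw : ∀ x, 0 ≤ MvPolynomial.eval x w)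
    (hα : 0 ≤ α) (hβ : 0 ≤ β) {k : ℕ} (hk : 1 ≤ k) (h1 : L (u ^ k) ≤ α ^ k)
    (h2 : L (w ^ k) ≤ β ^ k) : L ((u + w) ^ k) ≤ (α + β) ^ k := by
  have h := hL.map_sum_pow_le Finset.univ (fun b : Bool => cond b u w) (fun b => cond b α β)
    (fun b _ => by cases b <;> assumption) (fun b _ => by cases b <;> assumption) hk
    (fun b _ => by cases b <;> assumption)
  simpa only [Fintype.sum_bool, cond_true, cond_false] using h

/-- The moment comparison between `L²` and `L^{2k}` on polynomials. -/
def IsHypercontractive (k : ℕ) (L : MvPolynomial ι ℝ →ₗ[ℝ] ℝ) : Prop :=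
  ∀ (D : ℕ) (p : MvPolynomial ι ℝ), p.totalDegree ≤ D →
    L (p ^ (2 * k)) ≤ ((2 * k - 1) ^ D * L (p ^ 2)) ^ k

/-- The average of a functional over the two shifts by `v` and `-v`. -/
noncomputable def flipFunctional (v : ι → ℝ) (L : MvPolynomial ι ℝ →ₗ[ℝ] ℝ) :
    MvPolynomial ι ℝ →ₗ[ℝ] ℝ :=
  (1 / 2 : ℝ) • (L ∘ₗ (affineSubst 1 v).toLinearMap + L ∘ₗ (affineSubst 1 (-v)).toLinearMap)

theorem flipFunctional_apply (v : ι → ℝ) (L : MvPolynomial ι ℝ →ₗ[ℝ] ℝ) (p : MvPolynomial ι ℝ) :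
    flipFunctional v L p = 1 / 2 * (L (affineSubst 1 v p) + L (affineSubst 1 (-v) p)) := by
  simp [flipFunctional]
  ring

theorem IsPositiveFunctional.flip {L : MvPolynomial ι ℝ →ₗ[ℝ] ℝ} (hL : IsPositiveFunctional L)
    (v : ι → ℝ) : IsPositiveFunctional (flipFunctional v L) := by
  intro p hp
  rw [flipFunctional_apply]
  have h1 := hL (affineSubst 1 v p) fun x => by rw [eval_affineSubst]; exact hp _
  have h2 := hL (affineSubst 1 (-v) p) fun x => by rw [eval_affineSubst]; exact hp _
  positivity

/-- Write `p(x ± v) = a(x) ± b(x)`. The two-point inequality bounds the average of the `2k`-th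
powers by `(a² + (2k - 1) b²)^k`. Minkowski separates the two squares, and the factor `2k - 1` is
absorbed because `b` has degree one less than `p`. -/
theorem IsHypercontractive.flip {k : ℕ} (hk : 1 ≤ k) {L : MvPolynomial ι ℝ →ₗ[ℝ] ℝ}
    (hL : IsPositiveFunctional L) (hh : IsHypercontractive k L) (v : ι → ℝ) :
    IsHypercontractive k (flipFunctional v L) := by
  intro D p hp
  have hc : (1 : ℝ) ≤ 2 * k - 1 := by
    have : (1 : ℝ) ≤ k := by exact_mod_cast hk
    linarith
  cases D with
  | zero =>
    obtain ⟨a, rfl⟩ : ∃ a, p = MvPolynomial.C a :=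
      ⟨_, MvPolynomial.totalDegree_eq_zero_iff_eq_C.1 (Nat.le_zero.1 hp)⟩
    have h := hh 0 (MvPolynomial.C a) (by simp)
    have e : ∀ w n, affineSubst 1 w (MvPolynomial.C a ^ n) = (MvPolynomial.C a : MvPolynomial ι ℝ) ^ n := by
      intro w n
      simp [affineSubst, MvPolynomial.algebraMap_eq]
    have e' : ∀ n, flipFunctional v L (MvPolynomial.C a ^ n) = L (MvPolynomial.C a ^ n) := by
      intro n
      rw [flipFunctional_apply, e, e]
      ring
    rw [e', e']
    exact h
  | succ D =>
    obtain ⟨a, ha⟩ : ∃ a, a = (1 / 2 : ℝ) • (affineSubst 1 v p + affineSubst 1 (-v) p) := ⟨_, rfl⟩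
    obtain ⟨b, hb⟩ : ∃ b, b = (1 / 2 : ℝ) • (affineSubst 1 v p - affineSubst 1 (-v) p) := ⟨_, rfl⟩
    have had : a.totalDegree ≤ D + 1 := by
      rw [ha]
      refine (MvPolynomial.totalDegree_smul_le _ _).trans ?_
      exact (MvPolynomial.totalDegree_add _ _).trans
        (max_le (totalDegree_affineSubst_le 1 v hp) (totalDegree_affineSubst_le 1 (-v) hp))
    -- The two shifts have the same top-degree part as `p`, so it cancels in the difference.
    have hbd : b.totalDegree ≤ D := by
      rw [hb]
      refine (MvPolynomial.totalDegree_smul_le _ _).trans ?_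
      have e : affineSubst 1 v p - affineSubst 1 (-v) p =
          (affineSubst 1 v p - MvPolynomial.C (1 ^ (D + 1)) * p) -
          (affineSubst 1 (-v) p - MvPolynomial.C (1 ^ (D + 1)) * p) := by ring
      rw [e]
      exact (MvPolynomial.totalDegree_sub _ _).trans
        (max_le (totalDegree_affineSubst_sub_le 1 v hp)
          (totalDegree_affineSubst_sub_le 1 (-v) hp))
    have hab : ∀ n, affineSubst 1 v (p ^ n) = (a + b) ^ n := by
      intro n; rw [map_pow, ha, hb]; congr 1; module
    have hab' : ∀ n, affineSubst 1 (-v) (p ^ n) = (a - b) ^ n := by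
      intro n; rw [map_pow, ha, hb]; congr 1; module
    have h2 : flipFunctional v L (p ^ 2) = L (a ^ 2) + L (b ^ 2) := by
      rw [flipFunctional_apply, hab, hab', ← map_add,
        show (a + b) ^ 2 + (a - b) ^ 2 = (2 : ℝ) • (a ^ 2 + b ^ 2) by rw [two_smul]; ring,
        map_smul, map_add, smul_eq_mul]
      ring
    have ha2 := hL (a ^ 2) fun x => by rw [map_pow]; positivity
    have hb2 := hL (b ^ 2) fun x => by rw [map_pow]; positivity
    have hc0 : (0 : ℝ) ≤ 2 * k - 1 := by linarith
    have h3 : flipFunctional v L (p ^ (2 * k)) ≤ L ((a ^ 2 + (2 * k - 1 : ℝ) • b ^ 2) ^ k) := by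
      have e : flipFunctional v L (p ^ (2 * k)) =
          L ((1 / 2 : ℝ) • ((a + b) ^ (2 * k) + (a - b) ^ (2 * k))) := by
        rw [flipFunctional_apply, hab, hab', ← map_add, map_smul, smul_eq_mul]
      rw [e]
      refine hL.mono fun x => ?_
      simp only [MvPolynomial.smul_eval, map_add, map_pow, map_sub]
      have := half_add_pow_two_mul_le (MvPolynomial.eval x a) (MvPolynomial.eval x b) hk
      linarith
    refine h3.trans ?_
    rw [h2, mul_add]
    refine hL.map_add_pow_le ?_ ?_ (by positivity) (by positivity) hk ?_ ?_
    · intro x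
      rw [map_pow]
      positivity
    · intro x
      rw [MvPolynomial.smul_eval, map_pow]
      positivity
    · rw [← pow_mul]
      exact hh (D + 1) a had
    · rw [smul_pow, ← pow_mul, map_smul, smul_eq_mul]
      have h5 := hh D b hbd
      calc (2 * k - 1 : ℝ) ^ k * L (b ^ (2 * k))
          ≤ (2 * k - 1 : ℝ) ^ k * ((2 * k - 1) ^ D * L (b ^ 2)) ^ k := by gcongr
        _ = ((2 * k - 1) ^ (D + 1) * L (b ^ 2)) ^ k := by
          rw [← mul_pow]; congr 1; ring

end PositiveFunctional

/-! ### Product functionals and sums of independent signs -/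

section MomentFunctional

variable {ι : Type*}

theorem linearMap_ext_monomial {L L' : MvPolynomial ι ℝ →ₗ[ℝ] ℝ}
    (h : ∀ s, L (MvPolynomial.monomial s 1) = L' (MvPolynomial.monomial s 1)) : L = L' := by
  refine (MvPolynomial.basisMonomials ι ℝ).ext fun s => ?_
  rw [MvPolynomial.coe_basisMonomials]
  exact h s

variable [Fintype ι]

/-- The product functional on polynomials in several variables built from functionals on
polynomials in one variable. -/
noncomputable def productFunctional (m : ι → Polynomial ℝ →ₗ[ℝ] ℝ) : MvPolynomial ι ℝ →ₗ[ℝ] ℝ :=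
  (MvPolynomial.basisMonomials ι ℝ).constr ℝ fun s => ∏ k, m k (Polynomial.X ^ s k)

theorem productFunctional_monomial (m : ι → Polynomial ℝ →ₗ[ℝ] ℝ) (s : ι →₀ ℕ) :
    productFunctional m (MvPolynomial.monomial s 1) = ∏ k, m k (Polynomial.X ^ s k) := by
  have := (MvPolynomial.basisMonomials ι ℝ).constr_basis ℝ
    (fun s => ∏ k, m k (Polynomial.X ^ s k)) s
  rwa [MvPolynomial.coe_basisMonomials] at this

theorem productFunctional_eq_sum (m : ι → Polynomial ℝ →ₗ[ℝ] ℝ) (p : MvPolynomial ι ℝ) :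
    productFunctional m p = ∑ s ∈ p.support, p.coeff s * ∏ k, m k (Polynomial.X ^ s k) := by
  conv_lhs => rw [p.as_sum]
  rw [map_sum]
  refine Finset.sum_congr rfl fun s _ => ?_
  rw [← productFunctional_monomial, ← smul_eq_mul, ← map_smul, MvPolynomial.smul_monomial,
    smul_eq_mul, mul_one]

theorem tendsto_productFunctional {m : ℕ → ι → Polynomial ℝ →ₗ[ℝ] ℝ}
    {m' : ι → Polynomial ℝ →ₗ[ℝ] ℝ}
    (h : ∀ k a, Tendsto (fun n => m n k (Polynomial.X ^ a)) atTop (𝓝 (m' k (Polynomial.X ^ a))))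
    (p : MvPolynomial ι ℝ) :
    Tendsto (fun n => productFunctional (m n) p) atTop (𝓝 (productFunctional m' p)) := by
  simp only [productFunctional_eq_sum]
  exact tendsto_finsetSum _ fun s _ => (tendsto_finsetProd _ fun k _ => h k (s k)).const_mul _

theorem productFunctional_leval (p : MvPolynomial ι ℝ) :
    productFunctional (fun _ => Polynomial.leval 0) p = MvPolynomial.eval 0 p := by
  rw [productFunctional_eq_sum, MvPolynomial.eval_eq']
  simp [Polynomial.leval]

/-- The average of a functional over the two shifts by `t` and `-t`. -/
noncomputable def flipMoments (t : ℝ) (m : Polynomial ℝ →ₗ[ℝ] ℝ) : Polynomial ℝ →ₗ[ℝ] ℝ :=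
  (1 / 2 : ℝ) • (m ∘ₗ Polynomial.taylor t + m ∘ₗ Polynomial.taylor (-t))

theorem flipMoments_apply (t : ℝ) (m : Polynomial ℝ →ₗ[ℝ] ℝ) (p : Polynomial ℝ) :
    flipMoments t m p = 1 / 2 * (m (Polynomial.taylor t p) + m (Polynomial.taylor (-t) p)) := by
  simp [flipMoments]
  ring

variable [DecidableEq ι]

theorem productFunctional_mul_aeval (m : ι → Polynomial ℝ →ₗ[ℝ] ℝ) (k : ι) (s : ι →₀ ℕ)
    (hs : s k = 0) (r : Polynomial ℝ) :
    productFunctional m (MvPolynomial.monomial s 1 * Polynomial.aeval (MvPolynomial.X k) r) =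
      (∏ j ∈ Finset.univ.erase k, m j (Polynomial.X ^ s j)) * m k r := by
  induction r using Polynomial.induction_on' with
  | add p q hp hq => rw [map_add, mul_add, map_add, hp, hq, map_add, mul_add]
  | monomial n a =>
    have e : MvPolynomial.monomial s 1 *
        Polynomial.aeval (MvPolynomial.X k : MvPolynomial ι ℝ) (Polynomial.monomial n a) =
        a • MvPolynomial.monomial (s + Finsupp.single k n) 1 := by
      rw [Polynomial.aeval_monomial, MvPolynomial.X_pow_eq_monomial, MvPolynomial.algebraMap_eq,
        MvPolynomial.C_mul_monomial, MvPolynomial.monomial_mul, MvPolynomial.smul_monomial]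
      simp
    rw [e, map_smul, productFunctional_monomial, ← Finset.mul_prod_erase _ _ (Finset.mem_univ k),
      ← mul_one a, ← smul_eq_mul a, ← Polynomial.smul_monomial, map_smul,
      Polynomial.monomial_one_right_eq_X_pow]
    have hk : (s + Finsupp.single k n) k = n := by simp [hs]
    have hj : ∏ j ∈ Finset.univ.erase k, m j (Polynomial.X ^ (s + Finsupp.single k n) j) =
        ∏ j ∈ Finset.univ.erase k, m j (Polynomial.X ^ s j) := by
      refine Finset.prod_congr rfl fun j hj => ?_
      have : (s + Finsupp.single k n) j = s j := by
        simp [(Finset.ne_of_mem_erase hj).symm]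
      rw [this]
    rw [hk, hj]
    simp only [smul_eq_mul, mul_one]
    ring

theorem productFunctional_affineSubst (m : ι → Polynomial ℝ →ₗ[ℝ] ℝ) (k : ι) (t : ℝ)
    (s : ι →₀ ℕ) :
    productFunctional m (affineSubst 1 (Pi.single k t) (MvPolynomial.monomial s 1)) =
      (∏ j ∈ Finset.univ.erase k, m j (Polynomial.X ^ s j)) *
        m k (Polynomial.taylor t (Polynomial.X ^ s k)) := by
  have e : affineSubst 1 (Pi.single k t) (MvPolynomial.monomial s 1) =
      MvPolynomial.monomial (s.erase k) 1 *
        Polynomial.aeval (MvPolynomial.X k : MvPolynomial ι ℝ)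
          (Polynomial.taylor t (Polynomial.X ^ s k)) := by
    have h1 : MvPolynomial.monomial s (1 : ℝ) =
        MvPolynomial.monomial (s.erase k) 1 * MvPolynomial.X k ^ s k := by
      rw [MvPolynomial.X_pow_eq_monomial, MvPolynomial.monomial_mul, mul_one,
        Finsupp.erase_add_single]
    have h2 : affineSubst 1 (Pi.single k t) (MvPolynomial.monomial (s.erase k) (1 : ℝ)) =
        MvPolynomial.monomial (s.erase k) 1 := by
      rw [affineSubst, MvPolynomial.aeval_monomial, map_one, one_mul, MvPolynomial.monomial_eq,
        map_one, one_mul]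
      refine Finset.prod_congr rfl fun j hj => ?_
      have hne : j ≠ k := by
        rintro rfl
        simp at hj
      simp [hne]
    rw [h1, map_mul, h2, map_pow]
    congr 1
    simp [affineSubst, MvPolynomial.algebraMap_eq]
  rw [e, productFunctional_mul_aeval m k _ (by simp)]
  congr 1
  refine Finset.prod_congr rfl fun j hj => ?_
  rw [Finsupp.erase_ne (Finset.ne_of_mem_erase hj)]

/-- Adding an independent sign `±t` to one coordinate is a flip in that coordinate direction, so
products of sign sums are built by flips from evaluation at `0`. -/
theorem productFunctional_update (m : ι → Polynomial ℝ →ₗ[ℝ] ℝ) (k : ι) (t : ℝ) :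
    productFunctional (Function.update m k (flipMoments t (m k))) =
      flipFunctional (Pi.single k t) (productFunctional m) := by
  refine linearMap_ext_monomial fun s => ?_
  rw [flipFunctional_apply, ← Pi.single_neg, productFunctional_affineSubst,
    productFunctional_affineSubst, productFunctional_monomial,
    ← Finset.mul_prod_erase _ _ (Finset.mem_univ k), Function.update_self, flipMoments_apply]
  have hj : ∏ j ∈ Finset.univ.erase k,
      Function.update m k (flipMoments t (m k)) j (Polynomial.X ^ s j) =
      ∏ j ∈ Finset.univ.erase k, m j (Polynomial.X ^ s j) := by
    refine Finset.prod_congr rfl fun j hj => ?_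
    rw [Function.update_of_ne (Finset.ne_of_mem_erase hj)]
  rw [hj]
  ring

/-- The moments of a sum of `n` independent signs multiplied by `t`. -/
noncomputable def signMoments (t : ℝ) (n : ℕ) : Polynomial ℝ →ₗ[ℝ] ℝ :=
  (flipMoments t)^[n] (Polynomial.leval 0)

theorem signMoments_zero (t : ℝ) (p : Polynomial ℝ) : signMoments t 0 p = p.eval 0 := rfl

theorem signMoments_succ (t : ℝ) (n : ℕ) :
    signMoments t (n + 1) = flipMoments t (signMoments t n) :=
  Function.iterate_succ_apply' _ _ _

theorem good_productFunctional_update {k : ℕ} (hk : 1 ≤ k) {m : ι → Polynomial ℝ →ₗ[ℝ] ℝ}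
    (h : IsPositiveFunctional (productFunctional m) ∧ IsHypercontractive k (productFunctional m))
    (i : ι) (hi : m i = Polynomial.leval 0) (t : ℝ) (n : ℕ) :
    IsPositiveFunctional (productFunctional (Function.update m i (signMoments t n))) ∧
      IsHypercontractive k (productFunctional (Function.update m i (signMoments t n))) := by
  induction n with
  | zero =>
    have : signMoments t 0 = m i := by rw [hi]; rfl
    rwa [this, Function.update_eq_self]
  | succ n ih =>
    have e : Function.update m i (signMoments t (n + 1)) =
        Function.update (Function.update m i (signMoments t n)) i
          (flipMoments t (Function.update m i (signMoments t n) i)) := by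
      rw [Function.update_idem, Function.update_self, signMoments_succ]
    rw [e, productFunctional_update]
    exact ⟨ih.1.flip _, IsHypercontractive.flip hk ih.1 ih.2 _⟩

/-- Evaluation at `0` is positive and hypercontractive because `2k - 1 ≥ 1`. Both properties survive
each added sign, one coordinate after another, with no loss in the constant. -/
theorem good_productFunctional_signMoments {k : ℕ} (hk : 1 ≤ k) (t : ℝ) (n : ℕ) :
    IsPositiveFunctional (productFunctional fun _ : ι => signMoments t n) ∧
      IsHypercontractive k (productFunctional fun _ : ι => signMoments t n) := by
  have hc : (1 : ℝ) ≤ 2 * k - 1 := by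
    have : (1 : ℝ) ≤ k := by exact_mod_cast hk
    linarith
  have key : ∀ S : Finset ι,
      IsPositiveFunctional (productFunctional fun i : ι =>
        if i ∈ S then signMoments t n else Polynomial.leval 0) ∧
      IsHypercontractive k (productFunctional fun i : ι =>
        if i ∈ S then signMoments t n else Polynomial.leval 0) := by
    intro S
    induction S using Finset.induction_on with
    | empty =>
      simp only [Finset.notMem_empty, if_false]
      refine ⟨fun p hp => ?_, fun D p _ => ?_⟩
      · rw [productFunctional_leval]
        exact hp 0
      · rw [productFunctional_leval, productFunctional_leval, map_pow, map_pow, mul_pow,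
          pow_mul (MvPolynomial.eval (0 : ι → ℝ) p) 2 k]
        refine le_mul_of_one_le_left (by positivity) ?_
        exact one_le_pow₀ (one_le_pow₀ hc)
    | insert i S hi ih =>
      have h := good_productFunctional_update hk ih i (if_neg hi) t n
      have e : Function.update (fun i : ι => if i ∈ S then signMoments t n else Polynomial.leval 0)
          i (signMoments t n) =
          fun j => if j ∈ insert i S then signMoments t n else Polynomial.leval 0 := by
        ext1 j
        by_cases hj : j = i
        · subst hj; simp
        · simp [hj]
      rwa [e] at h
  simpa using key Finset.univ

end MomentFunctional

/-! ### Convergence of sign-sum moments to Gaussian moments -/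

section SignMomentLimit

open Polynomial in
-- Discrete integration by parts. For `W` the sum of `n + 1` signs times `t`, exchangeability
-- reduces `E[W p(W)]` to `(n + 1) t E[ε p(W)]` for one sign `ε`, and averaging over `ε` leaves half
-- a difference.
theorem signMoments_X_mul (t : ℝ) (n : ℕ) (p : Polynomial ℝ) :
    signMoments t (n + 1) (X * p) =
      (n + 1) * t * (1 / 2 * (signMoments t n (taylor t p) - signMoments t n (taylor (-t) p))) := by
  induction n generalizing p with
  | zero =>
    rw [signMoments_succ, flipMoments_apply]
    simp [signMoments_zero, Polynomial.taylor_mul, Polynomial.taylor_eval]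
    ring
  | succ n ih =>
    have h1 : signMoments t (n + 1 + 1) (X * p) =
        1 / 2 * (signMoments t (n + 1) (X * (taylor t p + taylor (-t) p)) +
          t * (signMoments t (n + 1) (taylor t p) - signMoments t (n + 1) (taylor (-t) p))) := by
      rw [signMoments_succ t (n + 1), flipMoments_apply, taylor_mul, taylor_mul, taylor_X,
        taylor_X, add_mul, add_mul, map_add, map_add, mul_add X, map_add, C_mul', C_mul', map_smul,
        map_smul, smul_eq_mul, smul_eq_mul]
      ring
    have h2 : ∀ r, signMoments t (n + 1) r =
        1 / 2 * (signMoments t n (taylor t r) + signMoments t n (taylor (-t) r)) := fun r => by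
      rw [signMoments_succ, flipMoments_apply]
    rw [h1, ih, h2 (taylor t p), h2 (taylor (-t) p)]
    simp only [map_add, taylor_taylor]
    push_cast
    rw [neg_add_cancel, add_neg_cancel]
    ring

open Polynomial in
theorem signMoments_eq_comp (t : ℝ) (n : ℕ) (p : Polynomial ℝ) :
    signMoments t n p = signMoments 1 n (p.comp (C t * X)) := by
  induction n generalizing p with
  | zero => simp [signMoments_zero]
  | succ n ih =>
    rw [signMoments_succ, signMoments_succ, flipMoments_apply, flipMoments_apply, ih, ih]
    have h1 : (taylor t p).comp (C t * X) = taylor 1 (p.comp (C t * X)) := by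
      simp [taylor_apply, comp_assoc, mul_add]
    have h2 : (taylor (-t) p).comp (C t * X) = taylor (-1) (p.comp (C t * X)) := by
      simp [taylor_apply, comp_assoc, mul_add]
    rw [h1, h2]

open Polynomial in
theorem signMoments_X_pow (t : ℝ) (n a : ℕ) :
    signMoments t n (X ^ a) = t ^ a * signMoments 1 n (X ^ a) := by
  rw [signMoments_eq_comp, X_pow_comp, mul_pow, ← C_pow, C_mul', map_smul, smul_eq_mul]

open Polynomial in
theorem signMoments_one_X_pow_succ (n a : ℕ) :
    signMoments 1 (n + 1) (X ^ (a + 1)) = (n + 1) * ∑ i ∈ Finset.range (a + 1),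
      (1 - (-1) ^ (a - i)) / 2 * a.choose i * signMoments 1 n (X ^ i) := by
  have h : ∀ s : ℝ, signMoments 1 n (taylor s (X ^ a)) = ∑ i ∈ Finset.range (a + 1),
      s ^ (a - i) * a.choose i * signMoments 1 n (X ^ i) := by
    intro s
    rw [taylor_X_pow, add_pow, map_sum]
    refine Finset.sum_congr rfl fun i _ => ?_
    rw [← smul_eq_mul (s ^ (a - i) * (a.choose i : ℝ)), ← map_smul]
    congr 1
    rw [← C_pow, mul_assoc, ← C_eq_natCast, ← C_mul, mul_comm, C_mul']
  rw [pow_succ', signMoments_X_mul, h, h, ← Finset.sum_sub_distrib, mul_one, Finset.mul_sum]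
  congr 1
  refine Finset.sum_congr rfl fun i _ => ?_
  rw [one_pow]
  ring

/-- Integration by parts: the Gaussian density `φ` satisfies `φ' = -x φ`. -/
theorem integral_pow_gaussianReal_add_two (a : ℕ) :
    ∫ x, x ^ (a + 2) ∂(gaussianReal 0 1) = (a + 1) * ∫ x, x ^ a ∂(gaussianReal 0 1) := by
  have hi : ∀ n, Integrable (fun x : ℝ => gaussianPDFReal 0 1 x * x ^ n) := by
    intro n
    have h := integrable_pow_gaussianReal n
    rw [gaussianReal_of_var_ne_zero 0 one_ne_zero, gaussianPDF_def,
      integrable_withDensity_iff_integrable_smul' (by fun_prop) (by simp)] at h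
    simpa [gaussianPDFReal_nonneg] using h
  have hd : ∀ x : ℝ, HasDerivAt (fun x => gaussianPDFReal 0 1 x * x ^ (a + 1))
      ((a + 1) * (gaussianPDFReal 0 1 x * x ^ a) - gaussianPDFReal 0 1 x * x ^ (a + 2)) x := by
    intro x
    have h1 : HasDerivAt (gaussianPDFReal 0 1) (-x * gaussianPDFReal 0 1 x) x := by
      unfold gaussianPDFReal
      have h2 : HasDerivAt (fun x : ℝ => -(x - 0) ^ 2 / (2 * ((1 : ℝ≥0) : ℝ))) (-x) x := by
        have := (((hasDerivAt_id' x).sub_const 0).fun_pow 2).fun_neg.div_const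
          (2 * ((1 : ℝ≥0) : ℝ))
        refine this.congr_deriv ?_
        simp
        ring
      refine (h2.exp.const_mul _).congr_deriv ?_
      ring
    refine (h1.fun_mul (hasDerivAt_pow (a + 1) x)).congr_deriv ?_
    rw [Nat.add_sub_cancel]
    push_cast
    ring
  have h := integral_eq_zero_of_hasDerivAt_of_integrable hd
    (((hi a).const_mul _).sub (hi (a + 2))) (hi (a + 1))
  rw [integral_sub ((hi a).const_mul _) (hi (a + 2)), integral_const_mul] at h
  rw [integral_gaussianReal_eq_integral_smul one_ne_zero,
    integral_gaussianReal_eq_integral_smul one_ne_zero]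
  simp only [smul_eq_mul]
  linarith

open Polynomial in
-- Moment form of the central limit theorem, by strong induction: the recursion from discrete
-- integration by parts converges to the Gaussian one.
theorem tendsto_signMoments_div (a : ℕ) :
    Tendsto (fun n : ℕ => signMoments 1 n (X ^ a) / √(n : ℝ) ^ a) atTop
      (𝓝 (∫ x, x ^ a ∂(gaussianReal 0 1))) := by
  induction a using Nat.strong_induction_on with
  | _ a ih =>
  match a with
  | 0 =>
    have h : ∀ n, signMoments 1 n (X ^ 0) = 1 := by
      intro n
      induction n with
      | zero => simp [signMoments_zero]
      | succ n ihn =>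
        rw [pow_zero] at ihn
        rw [signMoments_succ, flipMoments_apply, pow_zero, taylor_one, taylor_one, C_1, ihn]
        norm_num
    simp only [h]
    simp
  | 1 =>
    have h : ∀ n, signMoments 1 n (X ^ 1) = 0 := by
      intro n
      cases n with
      | zero => simp [signMoments_zero]
      | succ n => rw [show X ^ 1 = (X : ℝ[X]) ^ (0 + 1) by rfl, signMoments_one_X_pow_succ]; simp
    simp only [h]
    simp
  | a + 2 =>
    -- After normalisation only the term `i = a` survives, with coefficient `a + 1`; lower powers
    -- vanish in the limit.
    have hr : ∀ i, i ≤ a → Tendsto (fun n : ℕ => √(n : ℝ) ^ i / √((n + 1 : ℕ) : ℝ) ^ a) atTop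
        (𝓝 (if i = a then 1 else 0)) := by
      intro i hia
      have h1 : Tendsto (fun n : ℕ => √(n : ℝ) / √((n + 1 : ℕ) : ℝ)) atTop (𝓝 1) := by
        have h2 := (tendsto_natCast_div_add_atTop (1 : ℝ)).sqrt
        rw [Real.sqrt_one] at h2
        refine h2.congr fun n => ?_
        push_cast
        rw [Real.sqrt_div (Nat.cast_nonneg n)]
      have h3 : Tendsto (fun n : ℕ => (√((n + 1 : ℕ) : ℝ))⁻¹) atTop (𝓝 0) :=
        tendsto_inv_atTop_zero.comp (Real.tendsto_sqrt_atTop.comp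
          (tendsto_natCast_atTop_atTop.comp (tendsto_add_atTop_nat 1)))
      have h4 := (h1.pow i).mul (h3.pow (a - i))
      rw [one_pow, one_mul] at h4
      have e : (0 : ℝ) ^ (a - i) = if i = a then 1 else 0 := by
        split_ifs with h
        · rw [h, Nat.sub_self, pow_zero]
        · exact zero_pow (by omega)
      rw [e] at h4
      refine h4.congr fun n => ?_
      have hp : √((n + 1 : ℕ) : ℝ) ≠ 0 := (Real.sqrt_pos.2 (by positivity)).ne'
      conv_rhs => rw [← Nat.add_sub_cancel' hia, pow_add]
      rw [div_pow, inv_pow]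
      field_simp
    rw [← tendsto_add_atTop_iff_nat 1]
    have hterm : ∀ i ∈ Finset.range (a + 1), Tendsto (fun n : ℕ =>
        (1 - (-1 : ℝ) ^ (a + 1 - i)) / 2 * (a + 1).choose i *
          (signMoments 1 n (X ^ i) / √(n : ℝ) ^ i * (√(n : ℝ) ^ i / √((n + 1 : ℕ) : ℝ) ^ a))) atTop
        (𝓝 ((1 - (-1 : ℝ) ^ (a + 1 - i)) / 2 * (a + 1).choose i *
          ((∫ x, x ^ i ∂(gaussianReal 0 1)) * (if i = a then 1 else 0)))) := by
      intro i hi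
      have hi' : i ≤ a := by simpa [Nat.lt_succ_iff] using hi
      exact ((ih i (by omega)).mul (hr i hi')).const_mul _
    have hsum := tendsto_finsetSum _ hterm
    have hlim : ∑ i ∈ Finset.range (a + 1), (1 - (-1 : ℝ) ^ (a + 1 - i)) / 2 * (a + 1).choose i *
          ((∫ x, x ^ i ∂(gaussianReal 0 1)) * (if i = a then 1 else 0)) =
        ∫ x, x ^ (a + 2) ∂(gaussianReal 0 1) := by
      rw [integral_pow_gaussianReal_add_two, Finset.sum_eq_single a]
      · simp
      · intro i _ hne
        simp [hne]
      · simp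
    rw [hlim] at hsum
    refine hsum.congr' ((eventually_gt_atTop 0).mono fun n hn => ?_)
    have hn' : (0 : ℝ) < n := Nat.cast_pos.2 hn
    have hsn : √(n : ℝ) ≠ 0 := (Real.sqrt_pos.2 hn').ne'
    have hp : √((n + 1 : ℕ) : ℝ) ≠ 0 := (Real.sqrt_pos.2 (by positivity)).ne'
    have hsq : √((n + 1 : ℕ) : ℝ) ^ 2 = n + 1 := by
      rw [Real.sq_sqrt (by positivity)]; push_cast; ring
    beta_reduce
    -- The term of index `a + 1` has coefficient `1 - (-1) ^ 0 = 0`.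
    rw [show a + 2 = a + 1 + 1 by rfl, signMoments_one_X_pow_succ n (a + 1), Finset.sum_range_succ _ (a + 1), Nat.sub_self,
      pow_zero, sub_self, zero_div, zero_mul, zero_mul, add_zero, show a + 1 + 1 = a + 2 by rfl, pow_add _ a 2, hsq,
      mul_comm (_ ^ a), mul_div_mul_left _ _ (by positivity), Finset.sum_div]
    refine Finset.sum_congr rfl fun i _ => ?_
    field_simp

/-- The moments of the standard Gaussian measure. -/
noncomputable def gaussianMoments : Polynomial ℝ →ₗ[ℝ] ℝ :=
  (Polynomial.basisMonomials ℝ).constr ℝ fun a => ∫ x, x ^ a ∂(gaussianReal 0 1)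

theorem gaussianMoments_X_pow (a : ℕ) :
    gaussianMoments (Polynomial.X ^ a) = ∫ x, x ^ a ∂(gaussianReal 0 1) := by
  have := (Polynomial.basisMonomials ℝ).constr_basis ℝ
    (fun a => ∫ x, x ^ a ∂(gaussianReal 0 1)) a
  rw [Polynomial.coe_basisMonomials] at this
  beta_reduce at this
  rwa [Polynomial.monomial_one_right_eq_X_pow] at this

/-- Positivity and the moment comparison are closed under convergence on each polynomial, so they
pass to the limit of `n` signs of size `1 / √n`. -/
theorem good_productFunctional_gaussianMoments {ι : Type*} [Fintype ι] {k : ℕ} (hk : 1 ≤ k) :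
    IsPositiveFunctional (productFunctional fun _ : ι => gaussianMoments) ∧
      IsHypercontractive k (productFunctional fun _ : ι => gaussianMoments) := by
  classical
  have hlim : ∀ p : MvPolynomial ι ℝ,
      Tendsto (fun n : ℕ => productFunctional (fun _ : ι => signMoments (√(n : ℝ))⁻¹ n) p) atTop
        (𝓝 (productFunctional (fun _ : ι => gaussianMoments) p)) := by
    refine tendsto_productFunctional fun _ a => ?_
    rw [gaussianMoments_X_pow]
    refine (tendsto_signMoments_div a).congr fun n => ?_
    rw [signMoments_X_pow (√(n : ℝ))⁻¹, inv_pow]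
    field_simp
  have hgood := fun n : ℕ => good_productFunctional_signMoments (ι := ι) hk (√(n : ℝ))⁻¹ n
  refine ⟨fun p hp => ge_of_tendsto' (hlim p) fun n => (hgood n).1 p hp, fun D p hp => ?_⟩
  exact le_of_tendsto_of_tendsto' (hlim _) (((hlim (p ^ 2)).const_mul _).pow k)
    fun n => (hgood n).2 D p hp

end SignMomentLimit

/-! ### Higher moments of polynomial increments -/

section PolynomialConcentration

variable {ι : Type*}

theorem totalDegree_aeval_le_of_totalDegree_le_one {κ : Type*} (f : ι → MvPolynomial κ ℝ)
    (hf : ∀ i, (f i).totalDegree ≤ 1) (p : MvPolynomial ι ℝ) :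
    (MvPolynomial.aeval f p).totalDegree ≤ p.totalDegree := by
  rw [MvPolynomial.aeval_def, MvPolynomial.eval₂_eq]
  refine MvPolynomial.totalDegree_finsetSum_le fun s hs => ?_
  rw [MvPolynomial.algebraMap_eq]
  refine (MvPolynomial.totalDegree_mul _ _).trans ?_
  rw [MvPolynomial.totalDegree_C, zero_add]
  refine le_trans ?_ (MvPolynomial.le_totalDegree hs)
  refine (MvPolynomial.totalDegree_finsetProd _ _).trans (Finset.sum_le_sum fun i _ => ?_)
  refine (MvPolynomial.totalDegree_pow _ _).trans ?_
  simpa using Nat.mul_le_mul_left (s i) (hf i)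

/-- The increment of a polynomial over a step of the chain, as a polynomial in the starting point
and the innovation. -/
noncomputable def incrementPoly (q : ℝ) (p : MvPolynomial ι ℝ) : MvPolynomial (ι ⊕ ι) ℝ :=
  MvPolynomial.rename Sum.inl p -
    MvPolynomial.aeval (fun k => MvPolynomial.C q * MvPolynomial.X (Sum.inl k) +
      MvPolynomial.C (√(1 - q ^ 2)) * MvPolynomial.X (Sum.inr k)) p

theorem totalDegree_incrementPoly_le (q : ℝ) {p : MvPolynomial ι ℝ} {D : ℕ}
    (hp : p.totalDegree ≤ D) : (incrementPoly q p).totalDegree ≤ D := by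
  refine (MvPolynomial.totalDegree_sub _ _).trans (max_le ?_ ?_)
  · exact (MvPolynomial.totalDegree_rename_le _ _).trans hp
  · refine (totalDegree_aeval_le_of_totalDegree_le_one _ (fun k => ?_) p).trans hp
    have h : ∀ (a : ℝ) (j : ι ⊕ ι),
        (MvPolynomial.C a * MvPolynomial.X j : MvPolynomial (ι ⊕ ι) ℝ).totalDegree ≤ 1 := by
      intro a j
      refine (MvPolynomial.totalDegree_mul _ _).trans ?_
      rw [MvPolynomial.totalDegree_C, MvPolynomial.totalDegree_X]
    exact (MvPolynomial.totalDegree_add _ _).trans (max_le (h _ _) (h _ _))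

variable [Fintype ι]

theorem eval_incrementPoly (q : ℝ) (p : MvPolynomial ι ℝ) (x y : EuclideanSpace ℝ ι) :
    MvPolynomial.eval (Sum.elim x y) (incrementPoly q p) =
      polyFun p x - polyFun p (ouStep q x y) := by
  rw [incrementPoly, map_sub, MvPolynomial.eval_rename]
  congr 1
  induction p using MvPolynomial.induction_on with
  | C a => simp [polyFun, MvPolynomial.algebraMap_eq]
  | add p r hp hr => rw [map_add, map_add, hp, hr, polyFun_add]
  | mul_X p k hp =>
    rw [map_mul, map_mul, hp, polyFun_mul]
    simp [polyFun, ouStep]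

theorem integral_prod_pow_stdGaussian (s : ι → ℕ) :
    ∫ x, ∏ k, x k ^ s k ∂(stdGaussian (EuclideanSpace ℝ ι)) =
      ∏ k, ∫ x, x ^ s k ∂(gaussianReal 0 1) := by
  rw [← map_pi_eq_stdGaussian, integral_map (by fun_prop) (by fun_prop)]
  exact integral_fintype_prod_eq_prod (fun k x => x ^ s k)

theorem integrable_prod_pow_stdGaussian (s : ι → ℕ) :
    Integrable (fun x => ∏ k, x k ^ s k) (stdGaussian (EuclideanSpace ℝ ι)) := by
  rw [← map_pi_eq_stdGaussian, integrable_map_measure (by fun_prop) (by fun_prop)]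
  exact Integrable.fintype_prod (f := fun k x => x ^ s k) fun k => integrable_pow_gaussianReal (s k)

theorem eval_sumElim (p : MvPolynomial (ι ⊕ ι) ℝ) (x y : ι → ℝ) :
    MvPolynomial.eval (Sum.elim x y) p = ∑ s ∈ p.support,
      p.coeff s * ((∏ k, x k ^ s (Sum.inl k)) * ∏ k, y k ^ s (Sum.inr k)) := by
  rw [MvPolynomial.eval_eq']
  simp only [Fintype.prod_sum_type, Sum.elim_inl, Sum.elim_inr]

theorem integrable_eval_sumElim (p : MvPolynomial (ι ⊕ ι) ℝ) :
    Integrable (fun z => MvPolynomial.eval (Sum.elim z.1 z.2) p)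
      ((stdGaussian (EuclideanSpace ℝ ι)).prod (stdGaussian (EuclideanSpace ℝ ι))) := by
  simp only [eval_sumElim]
  refine integrable_finsetSum _ fun s _ => Integrable.const_mul ?_ _
  exact (integrable_prod_pow_stdGaussian fun k => s (Sum.inl k)).mul_prod
    (integrable_prod_pow_stdGaussian fun k => s (Sum.inr k))

/-- Identifies the formal functional with genuine Gaussian integration over the starting point and
the innovation, so the algebraic moment comparison controls actual increments. -/
theorem integral_eval_sumElim (p : MvPolynomial (ι ⊕ ι) ℝ) :
    ∫ z, MvPolynomial.eval (Sum.elim z.1 z.2) p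
      ∂((stdGaussian (EuclideanSpace ℝ ι)).prod (stdGaussian (EuclideanSpace ℝ ι))) =
      productFunctional (fun _ => gaussianMoments) p := by
  simp only [eval_sumElim]
  rw [productFunctional_eq_sum, integral_finsetSum]
  · refine Finset.sum_congr rfl fun s _ => ?_
    rw [integral_const_mul, integral_prod_mul (fun x : EuclideanSpace ℝ ι =>
      ∏ k, x k ^ s (Sum.inl k)) (fun y : EuclideanSpace ℝ ι => ∏ k, y k ^ s (Sum.inr k)),
      integral_prod_pow_stdGaussian, integral_prod_pow_stdGaussian, Fintype.prod_sum_type]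
    simp only [gaussianMoments_X_pow]
  · intro s _
    refine Integrable.const_mul ?_ _
    exact (integrable_prod_pow_stdGaussian fun k => s (Sum.inl k)).mul_prod
      (integrable_prod_pow_stdGaussian fun k => s (Sum.inr k))

variable {κ : Type*} [Fintype κ]

theorem integral_norm_sq_polynomial {A : EuclideanSpace ℝ ι → EuclideanSpace ℝ κ}
    {P : κ → MvPolynomial ι ℝ} (hA : ∀ i g, A g i = polyFun (P i) g) :
    ∫ x, ‖A x‖ ^ 2 ∂(stdGaussian (EuclideanSpace ℝ ι)) =
      ∑ i, ∫ x, polyFun (P i) x ^ 2 ∂(stdGaussian (EuclideanSpace ℝ ι)) := by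
  simp only [EuclideanSpace.real_norm_sq_eq, hA]
  exact integral_finsetSum _ fun i _ => (memLp_two_polyFun (P i)).integrable_sq

/-- Concentration of the increments of a low-degree polynomial map over a step of the chain. -/
theorem ouPair_polynomial_norm_sub_gt_le {A : EuclideanSpace ℝ ι → EuclideanSpace ℝ κ}
    {P : κ → MvPolynomial ι ℝ} (hA : ∀ i g, A g i = polyFun (P i) g) {D : ℕ}
    (hP : ∀ i, (P i).totalDegree ≤ D) {q : ℝ} (h0 : 0 ≤ q) (h1 : q ≤ 1) {k : ℕ} (hk : 1 ≤ k)
    {τ : ℝ} (hτ : 0 < τ) :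
    (ouPair (EuclideanSpace ℝ ι) q).real {p | τ < ‖A p.1 - A p.2‖} ≤
      ((2 * k - 1) ^ D * (2 * (1 - q ^ D) *
        ∫ x, ‖A x‖ ^ 2 ∂(stdGaussian (EuclideanSpace ℝ ι))) / τ ^ 2) ^ k := by
  have hc : (0 : ℝ) ≤ 2 * k - 1 := by
    have : (1 : ℝ) ≤ k := by exact_mod_cast hk
    linarith
  obtain ⟨hpos, hhyp⟩ := good_productFunctional_gaussianMoments (ι := ι ⊕ ι) hk
  set L := productFunctional fun _ : ι ⊕ ι => gaussianMoments with hL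
  set V := ∫ x, ‖A x‖ ^ 2 ∂(stdGaussian (EuclideanSpace ℝ ι)) with hV
  set F : κ → MvPolynomial (ι ⊕ ι) ℝ := fun i => incrementPoly q (P i) with hF
  set f : EuclideanSpace ℝ ι × EuclideanSpace ℝ ι → ℝ := fun z =>
    (∑ i, (polyFun (P i) z.1 - polyFun (P i) z.2) ^ 2) ^ k with hf
  have hfm : Measurable f := by fun_prop
  have hfe : ∀ z : EuclideanSpace ℝ ι × EuclideanSpace ℝ ι, f (z.1, ouStep q z.1 z.2) =
      MvPolynomial.eval (Sum.elim z.1 z.2) ((∑ i, F i ^ 2) ^ k) := by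
    intro z
    simp only [hf, hF, map_pow, map_sum, eval_incrementPoly]
  have hfi : Integrable f (ouPair (EuclideanSpace ℝ ι) q) := by
    rw [ouPair, integrable_map_measure hfm.aestronglyMeasurable (by fun_prop)]
    exact (integrable_eval_sumElim ((∑ i, F i ^ 2) ^ k)).congr
      (Eventually.of_forall fun z => (hfe z).symm)
  have hfL : ∫ z, f z ∂(ouPair (EuclideanSpace ℝ ι) q) = L ((∑ i, F i ^ 2) ^ k) := by
    rw [integral_ouPair hfm]
    simp only [hfe]
    exact integral_eval_sumElim _
  have hsq : ∀ i, L (F i ^ 2) ≤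
      2 * (1 - q ^ D) * ∫ x, polyFun (P i) x ^ 2 ∂(stdGaussian (EuclideanSpace ℝ ι)) := by
    intro i
    refine le_trans (le_of_eq ?_) (integral_sq_polyFun_sub_le h0 h1 (hP i))
    rw [hL, ← integral_eval_sumElim, integral_ouPair (by fun_prop)]
    simp only [hF, map_pow, eval_incrementPoly]
  have hsq0 : ∀ i, 0 ≤ L (F i ^ 2) := fun i => hpos _ fun x => by rw [map_pow]; positivity
  -- Minkowski in `L^k` applied to the squares `F i ^ 2` combines the coordinatewise comparisons
  -- with no loss in the output dimension.
  have hmom : L ((∑ i, F i ^ 2) ^ k) ≤ ((2 * k - 1) ^ D * (2 * (1 - q ^ D) * V)) ^ k := by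
    refine (hpos.map_sum_pow_le Finset.univ (fun i => F i ^ 2)
      (fun i => (2 * k - 1) ^ D * L (F i ^ 2)) (fun i _ x => by rw [map_pow]; positivity)
      (fun i _ => mul_nonneg (pow_nonneg hc D) (hsq0 i)) hk fun i _ => ?_).trans ?_
    · rw [← pow_mul]
      exact hhyp D (F i) (totalDegree_incrementPoly_le q (hP i))
    · refine pow_le_pow_left₀ (Finset.sum_nonneg fun i _ =>
        mul_nonneg (pow_nonneg hc D) (hsq0 i)) ?_ k
      rw [← Finset.mul_sum, hV, integral_norm_sq_polynomial hA,
        Finset.mul_sum _ _ (2 * (1 - q ^ D))]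
      exact mul_le_mul_of_nonneg_left (Finset.sum_le_sum fun i _ => hsq i) (pow_nonneg hc D)
  have hsub : {p : EuclideanSpace ℝ ι × EuclideanSpace ℝ ι | τ < ‖A p.1 - A p.2‖} ⊆
      {p | (τ ^ 2) ^ k ≤ f p} := by
    intro p hp
    have hp' : τ < ‖A p.1 - A p.2‖ := hp
    have e : f p = (‖A p.1 - A p.2‖ ^ 2) ^ k := by
      simp only [hf, EuclideanSpace.real_norm_sq_eq, PiLp.sub_apply, hA]
    change (τ ^ 2) ^ k ≤ f p
    rw [e]
    gcongr
  have hmarkov := mul_meas_ge_le_integral_of_nonneg (μ := ouPair (EuclideanSpace ℝ ι) q)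
    (Eventually.of_forall fun z => pow_nonneg (Finset.sum_nonneg fun i _ => sq_nonneg _) k)
    hfi ((τ ^ 2) ^ k)
  rw [div_pow, le_div_iff₀ (by positivity), mul_comm]
  calc (τ ^ 2) ^ k * (ouPair (EuclideanSpace ℝ ι) q).real {p | τ < ‖A p.1 - A p.2‖}
      ≤ (τ ^ 2) ^ k * (ouPair (EuclideanSpace ℝ ι) q).real {p | (τ ^ 2) ^ k ≤ f p} :=
        mul_le_mul_of_nonneg_left (measureReal_mono hsub) (by positivity)
    _ ≤ ∫ z, f z ∂(ouPair (EuclideanSpace ℝ ι) q) := hmarkov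
    _ ≤ _ := hfL.trans_le hmom

end PolynomialConcentration

/-! ### Polynomial algorithms and the main theorem -/

section PolynomialAlgorithms

theorem measurable_of_isPolynomialOfDegree {N D : ℕ} {A : Disorder N → EuclideanSpace ℝ (Fin N)}
    (hA : IsPolynomialOfDegree D A) : Measurable A := by
  obtain ⟨P, hP⟩ := hA
  have h : A = fun g => WithLp.toLp 2 fun i => polyFun (P i) g := by
    ext g i
    exact (hP i).2 g
  rw [h]
  fun_prop

/-- The bound on the success probability of a polynomial algorithm, as a function of the step size
and of the moment used in Markov's inequality. -/
theorem polynomial_success_sq_le {γ δ ρ T c C : ℝ} {r : ℕ} (hρ : 0 < ρ) (hT : 0 < T)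
    (hC : 0 < C)
    (hmain : ∀ N : ℕ, 0 < N → ∀ m : ℕ, r ≤ m →
      ∀ A : Disorder N → EuclideanSpace ℝ (Fin N), Measurable A →
      deterministicSuccess γ δ A ^ 2 ≤
        (ouPair (Disorder N) (Real.exp (-(T / 2 ^ m)))).real {p | ρ * √N < ‖A p.1 - A p.2‖} +
        (Real.exp (-(ρ * N)) + 10 * Real.exp (-(c * N / 2 ^ m))))
    {N : ℕ} (hN : 0 < N) {m : ℕ} (hm : r ≤ m) {k : ℕ} (hk : 1 ≤ k) {D : ℕ}
    {A : Disorder N → EuclideanSpace ℝ (Fin N)} (hA : IsPolynomialOfDegree D A)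
    (hA2 : SecondMomentBound C A) :
    deterministicSuccess γ δ A ^ 2 ≤
      ((2 * k - 1) ^ D * (2 * T * C / ρ ^ 2 * D / 2 ^ m)) ^ k +
        (Real.exp (-(ρ * N)) + 10 * Real.exp (-(c * N / 2 ^ m))) := by
  refine (hmain N hN m hm A (measurable_of_isPolynomialOfDegree hA)).trans (add_le_add ?_ le_rfl)
  obtain ⟨P, hP⟩ := hA
  have hN' : (0 : ℝ) < N := Nat.cast_pos.2 hN
  have hq1 : Real.exp (-(T / 2 ^ m)) ≤ 1 := Real.exp_le_one_iff.2 (by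
    rw [neg_nonpos]; positivity)
  refine (ouPair_polynomial_norm_sub_gt_le (fun i g => (hP i).2 g) (fun i => (hP i).1)
    (Real.exp_pos _).le hq1 hk (mul_pos hρ (Real.sqrt_pos.2 hN'))).trans ?_
  rw [SecondMomentBound, disorderLaw_eq_stdGaussian] at hA2
  set V := ∫ x, ‖A x‖ ^ 2 ∂(stdGaussian (Disorder N))
  have hV : 0 ≤ V := integral_nonneg fun x => by positivity
  have hc : (0 : ℝ) ≤ 2 * k - 1 := by
    have : (1 : ℝ) ≤ k := by exact_mod_cast hk
    linarith
  have hq : 1 - Real.exp (-(T / 2 ^ m)) ^ D ≤ D * (T / 2 ^ m) := by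
    rw [← Real.exp_nat_mul]
    have := Real.add_one_le_exp ((D : ℝ) * -(T / 2 ^ m))
    linarith
  have hq0 : 0 ≤ 1 - Real.exp (-(T / 2 ^ m)) ^ D :=
    sub_nonneg.2 (pow_le_one₀ (Real.exp_pos _).le hq1)
  refine pow_le_pow_left₀ (by positivity) ?_ k
  rw [mul_pow, Real.sq_sqrt hN'.le, div_le_iff₀ (by positivity)]
  calc (2 * k - 1 : ℝ) ^ D * (2 * (1 - Real.exp (-(T / 2 ^ m)) ^ D) * V)
      ≤ (2 * k - 1 : ℝ) ^ D * (2 * (D * (T / 2 ^ m)) * (C * N)) := by gcongr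
    _ = (2 * k - 1) ^ D * (2 * T * C / ρ ^ 2 * D / 2 ^ m) * (ρ ^ 2 * N) := by
      field_simp

theorem exp_neg_le_inv {u : ℝ} (hu : 0 < u) : Real.exp (-u) ≤ u⁻¹ := by
  rw [Real.exp_neg]
  exact inv_anti₀ hu (by linarith [Real.add_one_le_exp u])

/-- The chain length must be a power of two with exponent at least `r`; any desired real length is
met up to a factor `2`. -/
theorem exists_two_pow_near {y : ℝ} {r : ℕ} (hy : 2 ^ (r + 1) ≤ y) :
    ∃ m : ℕ, r ≤ m ∧ (2 : ℝ) ^ m ≤ y ∧ y < 2 * 2 ^ m := by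
  obtain ⟨m, h1, h2⟩ := exists_nat_pow_near ((one_le_pow₀ one_le_two).trans hy) (one_lt_two (α := ℝ))
  refine ⟨m, ?_, h1, by rw [← pow_succ']; exact h2⟩
  have := (pow_lt_pow_iff_right₀ (one_lt_two (α := ℝ))).1 (hy.trans_lt h2)
  omega

/-- With `x = D/N`, take `k = 1` and `2 ^ m` close to `N√x = √(ND)`. This balances the instability
`D / 2 ^ m` with the chain error, where `exp (-u) ≤ 1/u` already suffices, and the squared success
is `O(√x)`. One factor `x^(1/4)` absorbs the constant, and the square root of the other gives the
exponent `1/8`. -/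
theorem eventually_polynomial_success_le {γ δ ρ T c C : ℝ} {r : ℕ} (hρ : 0 < ρ) (hT : 0 < T)
    (hc : 0 < c) (hC : 0 < C)
    (hmain : ∀ N : ℕ, 0 < N → ∀ m : ℕ, r ≤ m →
      ∀ A : Disorder N → EuclideanSpace ℝ (Fin N), Measurable A →
      deterministicSuccess γ δ A ^ 2 ≤
        (ouPair (Disorder N) (Real.exp (-(T / 2 ^ m)))).real {p | ρ * √N < ‖A p.1 - A p.2‖} +
        (Real.exp (-(ρ * N)) + 10 * Real.exp (-(c * N / 2 ^ m))))
    {D : ℕ → ℕ} (hD : ∀ N, 1 ≤ D N)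
    (hDN : (fun N => (D N : ℝ)) =o[atTop] (fun N => (N : ℝ))) :
    ∀ᶠ N : ℕ in atTop, ∀ A : Disorder N → EuclideanSpace ℝ (Fin N),
      IsPolynomialOfDegree (D N) A → SecondMomentBound C A →
      deterministicSuccess γ δ A ≤ ((D N : ℝ) / N) ^ (1 / 8 : ℝ) := by
  set K := 2 * T * C / ρ ^ 2 with hK
  have hK0 : 0 < K := by positivity
  set K' := 2 * K + ρ⁻¹ + 10 * c⁻¹ with hK'
  have hlim : Tendsto (fun N : ℕ => ((D N : ℝ) / N)) atTop (𝓝 0) := hDN.tendsto_div_nhds_zero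
  have hlim4 : Tendsto (fun N : ℕ => K' * ((D N : ℝ) / N) ^ (1 / 4 : ℝ)) atTop (𝓝 0) := by
    have h := (hlim.rpow_const (p := (1 / 4 : ℝ)) (Or.inr (by norm_num))).const_mul K'
    rwa [Real.zero_rpow (by norm_num), mul_zero] at h
  have hsqrt : Tendsto (fun N : ℕ => √(N : ℝ)) atTop atTop :=
    Real.tendsto_sqrt_atTop.comp tendsto_natCast_atTop_atTop
  filter_upwards [hlim.eventually_le_const zero_lt_one, hlim4.eventually_le_const zero_lt_one,
    hsqrt.eventually_ge_atTop ((2 : ℝ) ^ (r + 1)), eventually_gt_atTop 0] with N hx1 hx4 hr hN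
  intro A hA hA2
  have hN' : (0 : ℝ) < N := Nat.cast_pos.2 hN
  have hD1 : (1 : ℝ) ≤ D N := by exact_mod_cast hD N
  have hD0 : (0 : ℝ) < D N := by linarith
  set x := (D N : ℝ) / N with hx
  have hx0 : 0 < x := by positivity
  have hs0 : 0 < √x := Real.sqrt_pos.2 hx0
  have hsx : √x ^ 2 = x := Real.sq_sqrt hx0.le
  have hNx : (N : ℝ) * √x = √(N * D N) := by
    have : (N : ℝ) * D N = (N * √x) ^ 2 := by rw [mul_pow, hsx, hx]; field_simp
    rw [this, Real.sqrt_sq (by positivity)]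
  obtain ⟨m, hrm, hm1, hm2⟩ := exists_two_pow_near (y := N * √x) (r := r) (by
    rw [hNx]
    exact hr.trans (Real.sqrt_le_sqrt (le_mul_of_one_le_right hN'.le hD1)))
  have h := polynomial_success_sq_le hρ hT hC hmain hN hrm le_rfl hA hA2
  have hm0 : (0 : ℝ) < 2 ^ m := by positivity
  have t1 : K * D N / 2 ^ m ≤ 2 * K * √x := by
    rw [div_le_iff₀ hm0]
    have e : K * (D N : ℝ) = K * √x * (N * √x) := by
      calc K * (D N : ℝ) = K * (N * x) := by rw [hx]; field_simp
        _ = K * (N * √x ^ 2) := by rw [hsx]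
        _ = _ := by ring
    rw [e]
    calc K * √x * (N * √x) ≤ K * √x * (2 * 2 ^ m) := by gcongr
      _ = _ := by ring
  have t2 : Real.exp (-(ρ * N)) ≤ ρ⁻¹ * √x := by
    refine (exp_neg_le_inv (by positivity)).trans ?_
    rw [mul_inv]
    refine mul_le_mul_of_nonneg_left ?_ (by positivity)
    rw [inv_le_iff_one_le_mul₀ hN', mul_comm]
    have e : 1 ≤ (N : ℝ) * x := by rw [hx]; field_simp; exact hD1
    have e2 : x ≤ √x := by
      have : √x ≤ 1 := Real.sqrt_le_one.2 hx1
      nlinarith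
    exact e.trans (by gcongr)
  have t3 : Real.exp (-(c * N / 2 ^ m)) ≤ c⁻¹ * √x := by
    refine (exp_neg_le_inv (by positivity)).trans ?_
    rw [inv_div, div_le_iff₀ (by positivity)]
    calc (2 : ℝ) ^ m ≤ N * √x := hm1
      _ = c⁻¹ * √x * (c * N) := by field_simp
  have hone : ((2 * (1 : ℕ) - 1 : ℝ)) ^ D N * (2 * T * C / ρ ^ 2 * D N / 2 ^ m) =
      K * D N / 2 ^ m := by norm_num [hK]
  rw [hone, pow_one] at h
  have h2 : deterministicSuccess γ δ A ^ 2 ≤ K' * √x := by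
    rw [hK']; linarith
  have e4 : √x = x ^ (1 / 4 : ℝ) * x ^ (1 / 4 : ℝ) := by
    rw [← Real.rpow_add hx0, Real.sqrt_eq_rpow]; norm_num
  have e8 : (x ^ (1 / 8 : ℝ)) ^ 2 = x ^ (1 / 4 : ℝ) := by
    rw [← Real.rpow_natCast, ← Real.rpow_mul hx0.le]; norm_num
  refine (abs_le_of_sq_le_sq' ?_ (by positivity)).2
  rw [e8]
  refine h2.trans ?_
  rw [e4, ← mul_assoc]
  exact mul_le_of_le_one_left (by positivity) hx4

/-- From `exp s ≥ s` with `s = log N / (3D)`. It makes the low-degree bound at most a negative power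
of `N`, uniformly in `D`. -/
theorem log_div_three_le_mul_rpow {N D : ℕ} (hN : 0 < N) (hD : 1 ≤ D) :
    Real.log N / 3 ≤ D * (N : ℝ) ^ (1 / (3 * D) : ℝ) := by
  have hN' : (0 : ℝ) < N := Nat.cast_pos.2 hN
  have hD' : (0 : ℝ) < D := by exact_mod_cast hD
  rw [Real.rpow_def_of_pos hN']
  have h := Real.add_one_le_exp (Real.log N * (1 / (3 * D)))
  calc Real.log N / 3 = D * (Real.log N * (1 / (3 * D))) := by field_simp
    _ ≤ D * Real.exp (Real.log N * (1 / (3 * D))) := by gcongr; linarith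

/-- Let `Z = N^(1/(3D))`, so `Z^D = N^(1/3)`. Take `2 ^ m` close to `√N` and `k` close to `Z/6`. The
hypercontractive factor is at most `(Z/e)^D = N^(1/3) e^(-D)`, and `N^(1/3)` is cancelled by the
instability `D / 2 ^ m`, up to logarithms of order `N^(-1/2)`. The moment bound becomes `e^(-Dk)`,
with `Dk` at least `DZ/12`. -/
theorem eventually_low_degree_success_le {γ δ ρ T c C : ℝ} {r : ℕ} (hρ : 0 < ρ) (hT : 0 < T)
    (hc : 0 < c) (hC : 0 < C)
    (hmain : ∀ N : ℕ, 0 < N → ∀ m : ℕ, r ≤ m →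
      ∀ A : Disorder N → EuclideanSpace ℝ (Fin N), Measurable A →
      deterministicSuccess γ δ A ^ 2 ≤
        (ouPair (Disorder N) (Real.exp (-(T / 2 ^ m)))).real {p | ρ * √N < ‖A p.1 - A p.2‖} +
        (Real.exp (-(ρ * N)) + 10 * Real.exp (-(c * N / 2 ^ m)))) :
    ∃ c₁ : ℝ, 0 < c₁ ∧ ∀ᶠ N : ℕ in atTop, ∀ D : ℕ, 1 ≤ D → (D : ℝ) ≤ Real.log N / 11 →
      ∀ A : Disorder N → EuclideanSpace ℝ (Fin N),
        IsPolynomialOfDegree D A → SecondMomentBound C A →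
        deterministicSuccess γ δ A ≤ Real.exp (-(c₁ * (D * (N : ℝ) ^ (1 / (3 * D) : ℝ)))) := by
  set K := 2 * T * C / ρ ^ 2 with hK
  have hK0 : 0 < K := by positivity
  set c₁ := min (1 / 12) (min ρ c) / 4 with hc₁
  have hc₁0 : 0 < c₁ := by
    rw [hc₁]; exact div_pos (lt_min (by norm_num) (lt_min hρ hc)) (by norm_num)
  have b1 : 4 * c₁ ≤ 1 / 12 := by rw [hc₁]; linarith [min_le_left (1 / 12) (min ρ c)]
  have b2 : 4 * c₁ ≤ ρ := by
    rw [hc₁]; linarith [(min_le_right (1 / 12) (min ρ c)).trans (min_le_left _ _)]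
  have b3 : 4 * c₁ ≤ c := by
    rw [hc₁]; linarith [(min_le_right (1 / 12) (min ρ c)).trans (min_le_right _ _)]
  refine ⟨c₁, hc₁0, ?_⟩
  have hsqrt : Tendsto (fun N : ℕ => √(N : ℝ)) atTop atTop :=
    Real.tendsto_sqrt_atTop.comp tendsto_natCast_atTop_atTop
  have hlog : Tendsto (fun N : ℕ => Real.log (N : ℝ)) atTop atTop :=
    Real.tendsto_log_atTop.comp tendsto_natCast_atTop_atTop
  have hsmall : ∀ ε : ℝ, 0 < ε →
      ∀ᶠ N : ℕ in atTop, Real.log (N : ℝ) ≤ ε * (N : ℝ) ^ (1 / 6 : ℝ) := by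
    intro ε hε
    have h := tendsto_natCast_atTop_atTop.eventually
      ((isLittleO_log_rpow_atTop (r := 1 / 6) (by norm_num)).bound hε)
    filter_upwards [h] with N hN
    have h6 : (0 : ℝ) ≤ (N : ℝ) ^ (1 / 6 : ℝ) := by positivity
    rw [Real.norm_eq_abs, Real.norm_eq_abs, abs_of_nonneg h6] at hN
    exact (le_abs_self _).trans hN
  filter_upwards [hsmall 1 one_pos, hsmall (2 * K)⁻¹ (by positivity),
    hsqrt.eventually_ge_atTop ((2 : ℝ) ^ (r + 1)), hlog.eventually_ge_atTop (9 / (2 * c₁)),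
    eventually_gt_atTop 0] with N hl1 hlK hr hlc hN
  intro D hD hDlog A hA hA2
  have hN' : (0 : ℝ) < N := Nat.cast_pos.2 hN
  have hN1 : (1 : ℝ) ≤ N := by exact_mod_cast hN
  have hD1 : (1 : ℝ) ≤ D := by exact_mod_cast hD
  have hD0 : (0 : ℝ) < D := by linarith
  have hDl : (D : ℝ) ≤ Real.log N := by linarith
  set Z := (N : ℝ) ^ (1 / (3 * D) : ℝ) with hZ
  have hZ0 : 0 < Z := by positivity
  -- This is where `D ≤ log N / 11` enters: `Z ≥ exp (11/3) ≥ 6`, so the moment parameter below is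
  -- at least `1`.
  have hZ6 : 6 ≤ Z := by
    have h1 : (11 / 3 : ℝ) ≤ Real.log N * (1 / (3 * D)) := by
      rw [mul_one_div, le_div_iff₀ (by positivity)]
      linarith
    have h2 : (6 : ℝ) ≤ Real.exp (11 / 3) := by
      have e := Real.exp_one_gt_d9
      have : Real.exp 1 ^ 2 ≤ Real.exp (11 / 3) := by
        rw [← Real.exp_nat_mul]; exact Real.exp_le_exp.2 (by norm_num)
      nlinarith
    rw [hZ, Real.rpow_def_of_pos hN']
    exact h2.trans (Real.exp_le_exp.2 h1)
  have hZD : Z ^ D = (N : ℝ) ^ (1 / 3 : ℝ) := by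
    rw [hZ, ← Real.rpow_natCast, ← Real.rpow_mul hN'.le]
    congr 1
    field_simp
  have e36 : (N : ℝ) ^ (1 / 3 : ℝ) * (N : ℝ) ^ (1 / 6 : ℝ) = √N := by
    rw [← Real.rpow_add hN', Real.sqrt_eq_rpow]; norm_num
  have hsN : √(N : ℝ) ≤ N := by
    rw [Real.sqrt_le_left hN'.le]
    nlinarith
  have hW : D * Z ≤ √N := by
    have hZ3 : Z ≤ (N : ℝ) ^ (1 / 3 : ℝ) := by
      refine Real.rpow_le_rpow_of_exponent_le hN1 ?_
      rw [div_le_div_iff₀ (by positivity) (by norm_num)]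
      linarith
    calc D * Z ≤ (N : ℝ) ^ (1 / 6 : ℝ) * (N : ℝ) ^ (1 / 3 : ℝ) := by
          refine mul_le_mul (by linarith) hZ3 hZ0.le (by positivity)
      _ = √N := by rw [mul_comm, e36]
  obtain ⟨m, hrm, hm1, hm2⟩ := exists_two_pow_near hr
  have hm0 : (0 : ℝ) < 2 ^ m := by positivity
  have hKD : K * D / 2 ^ m ≤ ((N : ℝ) ^ (1 / 3 : ℝ))⁻¹ := by
    rw [inv_eq_one_div, div_le_div_iff₀ hm0 (by positivity), one_mul]
    have h1 : 2 * (K * D) ≤ (N : ℝ) ^ (1 / 6 : ℝ) := by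
      calc 2 * (K * D) = 2 * K * D := by ring
        _ ≤ 2 * K * ((2 * K)⁻¹ * (N : ℝ) ^ (1 / 6 : ℝ)) := by
          gcongr; exact hDl.trans hlK
        _ = _ := by field_simp
    have h2 : 2 * (K * D) * (N : ℝ) ^ (1 / 3 : ℝ) ≤ √N := by
      rw [← e36, mul_comm ((N : ℝ) ^ (1 / 3 : ℝ))]
      gcongr
    linarith
  -- Then `2k - 1 ≤ Z/3 ≤ Z/e`, which yields a factor `e⁻¹` per degree.
  set k := ⌊Z / 6⌋₊ with hk
  have hk1 : 1 ≤ k := by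
    rw [hk, Nat.one_le_floor_iff]; linarith
  have hkle : (k : ℝ) ≤ Z / 6 := Nat.floor_le (by positivity)
  have hklt : Z / 6 < k + 1 := Nat.lt_floor_add_one _
  have hk1' : (1 : ℝ) ≤ k := by exact_mod_cast hk1
  have hbase : (2 * k - 1 : ℝ) ^ D * (K * D / 2 ^ m) ≤ Real.exp (-1) ^ D := by
    have h1 : (2 * k - 1 : ℝ) ≤ Z * Real.exp (-1) := by
      have : (1 / 3 : ℝ) ≤ Real.exp (-1) := by
        rw [Real.exp_neg, one_div]
        exact inv_anti₀ (Real.exp_pos 1) Real.exp_one_lt_three.le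
      nlinarith
    calc (2 * k - 1 : ℝ) ^ D * (K * D / 2 ^ m)
        ≤ (Z * Real.exp (-1)) ^ D * ((N : ℝ) ^ (1 / 3 : ℝ))⁻¹ := by
          refine mul_le_mul (pow_le_pow_left₀ (by linarith) h1 D) hKD (by positivity)
            (by positivity)
      _ = Real.exp (-1) ^ D := by
          rw [mul_pow, hZD]
          field_simp
  have t1 : ((2 * k - 1 : ℝ) ^ D * (K * D / 2 ^ m)) ^ k ≤ Real.exp (-(4 * c₁ * (D * Z))) := by
    have h0 : (0 : ℝ) ≤ 2 * k - 1 := by linarith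
    refine (pow_le_pow_left₀ (by positivity) hbase k).trans ?_
    rw [← pow_mul, ← Real.exp_nat_mul, Real.exp_le_exp]
    push_cast
    have h12 : Z / 12 ≤ k := by linarith
    have h2 : 4 * c₁ * (D * Z) ≤ 1 / 12 * (D * Z) := by gcongr
    have h3 : (D : ℝ) * (Z / 12) ≤ D * k := by gcongr
    linarith
  have t2 : Real.exp (-(ρ * N)) ≤ Real.exp (-(4 * c₁ * (D * Z))) := by
    rw [Real.exp_le_exp, neg_le_neg_iff]
    exact mul_le_mul b2 (hW.trans hsN) (by positivity) hρ.le
  have t3 : Real.exp (-(c * N / 2 ^ m)) ≤ Real.exp (-(4 * c₁ * (D * Z))) := by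
    rw [Real.exp_le_exp, neg_le_neg_iff, mul_div_assoc]
    refine mul_le_mul b3 (hW.trans ?_) (by positivity) hc.le
    rw [le_div_iff₀ hm0]
    calc √(N : ℝ) * 2 ^ m ≤ √N * √N := by gcongr
      _ = N := Real.mul_self_sqrt hN'.le
  have h := polynomial_success_sq_le hρ hT hC hmain hN hrm hk1 hA hA2
  refine le_exp_of_sq_le (by linarith) ?_
  have hlow := log_div_three_le_mul_rpow hN hD
  rw [← hZ] at hlow
  rw [div_le_iff₀ (by positivity)] at hlc
  have : 2 * c₁ * (Real.log N / 3) ≤ 2 * c₁ * (D * Z) := by gcongr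
  linarith

end PolynomialAlgorithms

theorem theorem1p3 (γ : ℝ) (hγ : 0 < γ) :
    ∃ δ : ℝ, 0 < δ ∧ ∀ C : ℝ, 0 < C →
      -- (I) Lipschitz algorithms
      (∃ c : ℝ, 0 < c ∧ ∀ᶠ N : ℕ in atTop,
        ∀ (Ω : Type*) [TopologicalSpace Ω] [PolishSpace Ω] [MeasurableSpace Ω] [BorelSpace Ω]
          (ν : Measure Ω) [IsProbabilityMeasure ν]
          (A : Disorder N → Ω → EuclideanSpace ℝ (Fin N)),
          Measurable (fun z : Disorder N × Ω => A z.1 z.2) →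
          (∀ ω, LipschitzWith C.toNNReal (fun g => A g ω)) →
          randomizedSuccess ν γ δ A ≤ Real.exp (-(c * N))) ∧
      -- (II) polynomials of degree at most `log N / 11`
      (∃ c c' : ℝ, 0 < c ∧ 0 < c' ∧ ∀ᶠ N : ℕ in atTop, ∀ D : ℕ, 1 ≤ D →
        (D : ℝ) ≤ Real.log N / 11 →
          (∀ A : Disorder N → EuclideanSpace ℝ (Fin N),
            IsPolynomialOfDegree D A → SecondMomentBound C A →
            deterministicSuccess γ δ A ≤
              Real.exp (-(c * (D * (N : ℝ) ^ (1 / (3 * D) : ℝ))))) ∧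
          Real.exp (-(c * (D * (N : ℝ) ^ (1 / (3 * D) : ℝ)))) ≤ (N : ℝ) ^ (-c')) ∧
      -- (III) polynomials of degree `o(N)`
      (∃ c : ℝ, 0 < c ∧ ∀ D : ℕ → ℕ, (∀ N, 1 ≤ D N) →
        (fun N => (D N : ℝ)) =o[atTop] (fun N => (N : ℝ)) →
          (∀ᶠ N : ℕ in atTop, ∀ A : Disorder N → EuclideanSpace ℝ (Fin N),
            IsPolynomialOfDegree (D N) A → SecondMomentBound C A →
            deterministicSuccess γ δ A ≤ ((D N : ℝ) / N) ^ c) ∧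
          Tendsto (fun N : ℕ => ((D N : ℝ) / N) ^ c) atTop (𝓝 0)) := by
  -- The chain bound involves no regularity of the algorithm, so `δ` is fixed before `C`.
  obtain ⟨δ, ρ, T, c, r, hδ, hρ, hT, hc, hmain⟩ := exists_rounded_success_sq_le hγ
  refine ⟨δ, hδ, fun C hC => ⟨?_, ?_, 1 / 8, by norm_num, fun D hD hDN => ⟨?_, ?_⟩⟩⟩
  · obtain ⟨c', hc', h⟩ := eventually_lipschitz_success_le hρ hT hc hC
      fun N hN m hm => (hmain N hN m hm).1
    exact ⟨c', hc', h.mono fun N hN Ω _ _ _ _ ν _ A => hN Ω ν A⟩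
  · obtain ⟨c₁, hc₁, h⟩ := eventually_low_degree_success_le hρ hT hc hC
      fun N hN m hm => (hmain N hN m hm).2
    refine ⟨c₁, c₁ / 3, hc₁, by positivity, ?_⟩
    filter_upwards [h, eventually_gt_atTop 0] with N hN hN0 D hD hDlog
    refine ⟨hN D hD hDlog, ?_⟩
    rw [Real.rpow_def_of_pos (Nat.cast_pos.2 hN0) (-(c₁ / 3)), Real.exp_le_exp]
    have := mul_le_mul_of_nonneg_left (log_div_three_le_mul_rpow hN0 hD) hc₁.le
    linarith
  · exact eventually_polynomial_success_le hρ hT hc hC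
      (fun N hN m hm => (hmain N hN m hm).2) hD hDN
  · have h := hDN.tendsto_div_nhds_zero.rpow_const (p := (1 / 8 : ℝ)) (Or.inr (by norm_num))
    rwa [Real.zero_rpow (by norm_num)] at h
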